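/- There is a universal constant $C>0$ such that the following holds. Let $n\ge 4$, $d\ge 1$, $k\ge 1$ be integers and let $X_1,\dots,X_n$ be i.i.d. $\mathbb{R}^d$-valued random vectors such that $\|X_1-X_2\|$ (Euclidean norm) is a continuous random variable, that is, $\mathbb{P}(\|X_1-X_2\|=t)=0$ for every $t\in\mathbb{R}$. Let $$f(x_1,\dots,x_n)=\frac1{\sqrt n}\sum_{\ell=1}^n f_\ell(x_1,\dots,x_n),$$ where each $f_\ell:(\mathbb{R}^d)^n\to\mathbb{R}$ is measurable and is a function of only $x_\ell$ and its $k$ nearest neighbors: $f_\ell(x)=f_\ell(y)$ whenever $x_\ell=y_\ell$, the indices of the $k$ nearest neighbors of $x_\ell$ among $\{x_j\}_{j\ne\ell}$ are the same as those of $y_\ell$ among $\{y_j\}_{j\neq\ell}$, and $x_j=y_j$ for all these indices $j$. Here ties between equal distances are broken by an arbitrary fixed strict linear order $\prec$ on $\mathbb{R}^d$ that is a Borel subset of $\mathbb{R}^d\times\mathbb{R}^d$ (for instance the lexicographic order); explicitly, $j\ne\ell$ is a nearest-neighbor index of $\ell$ if fewer than $k$ indices $m\neq\ell$ satisfy $\|x_\ell-x_m\|<\|x_\ell-x_j\|$,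 or $\|x_\ell-x_m\|=\|x_\ell-x_j\|$ and $x_m\prec x_j$. (If $k\ge n-1$, all $j\neq\ell$ are nearest-neighbor indices.) Suppose that for some real $p\ge 8$ the number $\gamma_p:=\max_\ell\mathbb{E}|f_\ell(X_1,\dots,X_n)|^p$ is finite. Let $W=f(X_1,\dots,X_n)$ and $\sigma^2=\mathrm{Var}(W)$, and suppose $\sigma>0$. Then $$\delta_W\le C\,\frac{\alpha(d)^3k^4\gamma_p^{2/p}}{\sigma^2\,n^{(p-8)/(2p)}}+C\,\frac{\alpha(d)^3k^3\gamma_p^{3/p}}{\sigma^3\,n^{(p-6)/(2p)}}.$$ Here $\delta_W$ is the Kantorovich–Wasserstein distance between the law $\mu$ of $(W-\mathbb{E}W)/\sigma$ and the standard Gaussian law $\nu$ on $\mathbb{R}$, namely $\sup|\int h\,d\mu-\int h\,d\nu|$ over all $h:\mathbb{R}\to\mathbb{R}$ with Lipschitz constant at most $1$, and $\alpha(d)$ is the minimum number of $60^\circ$ cones at the origin required to cover $\mathbb{R}^d$, a $60^\circ$ cone being a set $\{y:\langle v,y\rangle\ge\cos(30^\circ)\|y\|\}$ with $\|v\|=1$.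 -/

import Mathlib

open MeasureTheory ProbabilityTheory

noncomputable section

/-- The Kantorovich-Wasserstein distance between two measures on the real line, in its dual form:
the supremum of `|∫ h dμ - ∫ h dν|` over all 1-Lipschitz `h`, as an extended nonnegative real. -/
def wassersteinDist (μ ν : Measure ℝ) : ENNReal :=
  ⨆ (h : ℝ → ℝ) (_ : LipschitzWith 1 h), ENNReal.ofReal |∫ t, h t ∂μ - ∫ t, h t ∂ν|

/-- The distance to normality of a random variable `W` (with finite, nonzero variance): the
Kantorovich-Wasserstein distance between the law of `(W - E W) / √(Var W)` and the standard
Gaussian law. -/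
def distToNormal {Ω : Type*} [MeasurableSpace Ω] (P : Measure Ω) (W : Ω → ℝ) : ENNReal :=
  wassersteinDist
    (P.map (fun ω => (W ω - ∫ ω', W ω' ∂P) / Real.sqrt (variance W P)))
    (gaussianReal 0 1)

/-- The closed 60° cone at the origin around the unit vector `v`: the origin together with all
vectors that make an angle of at most 30° with `v` (so that the opening angle is 60°). -/
def cone60 {d : ℕ} (v : EuclideanSpace ℝ (Fin d)) : Set (EuclideanSpace ℝ (Fin d)) :=
  {y | Real.cos (Real.pi / 6) * ‖y‖ ≤ inner ℝ v y}

/-- `α(d)`: the minimum number of 60° cones at the origin required to cover `ℝ^d`. -/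
def coneCoverNumber (d : ℕ) : ℕ :=
  sInf {N : ℕ | ∃ v : Fin N → EuclideanSpace ℝ (Fin d),
    (∀ i, ‖v i‖ = 1) ∧ ∀ y : EuclideanSpace ℝ (Fin d), ∃ i, y ∈ cone60 (v i)}

/-- `a` is nearer to `c` than `b` is, where equal distances are compared by means of the
relation `r` (in the theorem, a linear order). -/
def Nearer {d : ℕ} (r : EuclideanSpace ℝ (Fin d) → EuclideanSpace ℝ (Fin d) → Prop)
    (c a b : EuclideanSpace ℝ (Fin d)) : Prop :=
  ‖c - a‖ < ‖c - b‖ ∨ (‖c - a‖ = ‖c - b‖ ∧ r a b)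

open scoped Classical in
/-- The index set of the `k` nearest neighbors of `x ℓ` among the other points of `x`: those
`j ≠ ℓ` for which fewer than `k` other points `x m`, `m ≠ ℓ`, are nearer to `x ℓ` than `x j`.
If there are fewer than `k` other points, it consists of all of them. -/
def kNearest {n d : ℕ} (r : EuclideanSpace ℝ (Fin d) → EuclideanSpace ℝ (Fin d) → Prop)
    (k : ℕ) (x : Fin n → EuclideanSpace ℝ (Fin d)) (ℓ : Fin n) : Finset (Fin n) :=
  Finset.univ.filter fun j =>
    j ≠ ℓ ∧ (Finset.univ.filter fun m => m ≠ ℓ ∧ Nearer r (x ℓ) (x m) (x j)).card < k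

/-- `g x` is a function of only `x ℓ` and its `k` nearest neighbors: it takes the same value on
any two configurations that share `x ℓ` and its `k` nearest neighbors. (The function may use the
labels of the neighbors, which is more general than a function of the unlabelled points.) -/
def DependsOnlyOnNearest {n d : ℕ}
    (r : EuclideanSpace ℝ (Fin d) → EuclideanSpace ℝ (Fin d) → Prop)
    (k : ℕ) (ℓ : Fin n) (g : (Fin n → EuclideanSpace ℝ (Fin d)) → ℝ) : Prop :=
  ∀ x y : Fin n → EuclideanSpace ℝ (Fin d),
    x ℓ = y ℓ → kNearest r k x ℓ = kNearest r k y ℓ → (∀ j ∈ kNearest r k x ℓ, x j = y j) →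
      g x = g y

/-- The statistic `f(x) = n^{-1/2} ∑_ℓ f_ℓ(x)`. -/
def localSum {n d : ℕ} (f : Fin n → (Fin n → EuclideanSpace ℝ (Fin d)) → ℝ)
    (x : Fin n → EuclideanSpace ℝ (Fin d)) : ℝ :=
  1 / Real.sqrt n * ∑ ℓ, f ℓ x

end

set_option linter.unusedSectionVars false

section

open Filter Topology Set

/-! ### Stein's method on the real line -/

/-! The proof is Chatterjee's form of Stein's method. For a sample of independent pairs (original,
copy), let Δ_j F be the effect on F of replacing coordinate j by its copy (`resampleDiff`), and
Δ_j^B F the same effect once the other coordinates in B are replaced (`resampleDiffOn`). Telescoping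
from the original sample to the copy over weighted sets B, then swapping coordinate j, gives Cov(g,
F) as a weighted mean over B of ½ ∑_j E[Δ_j g · Δ_j^B F] (`covariance_eq_sum`). Take g = φ ∘ F, with
φ a solution of Stein's equation (`exists_stein_solution`), and expand Δ_j(φ ∘ F) ≈ φ'(F) Δ_j F.
Since the weighted mean of E[T_B], where T_B = ½ ∑_j Δ_j F · Δ_j^B F (`resampleCov`), is Var F, the
distance to normality is controlled by the standard deviations of the T_B and by ∑_j E|Δ_j F|³
(`distToNormal_le`).

To bound Var T_B, view T_B as a function of i.i.d. pairs and resample a second time (`efron_stein`).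
Resampling pair i changes the term j only if i and j are near a common point in some of the
configurations involved (`exists_interact_of_resampleDiffOn_ne`). By the cone argument a point is
among the k nearest of at most α(d)(k+1) others (`card_filter_mem_kNearest_le`), which suggests that
about α(d)k² terms change. This is not a pointwise bound, because each j brings its own resampled
configuration. It does hold for fourth moments: expand over 4-tuples of indices and resample each
whole tuple at once, which shifts ranks by at most 4 (`lintegral_interactCount_pow_four_le`).

Sizes: |Δ_j^B F| is at most of order α(d)k/√n times the largest |f_ℓ|, and that maximum is at most
the p-th root of a sum of p-th powers. Summing over all ℓ, and for T_B over all j as well, gives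
expectations of order nγ and n²γ. Hence √(Var T_B) is of order √n · (α(d)k/√n)² · α(d)k² ·
(n²γ)^(2/p), and the third moment term is of order n · (α(d)k/√n)³ · (nγ)^(3/p): the two terms of
the bound. -/

/-- The standard Gaussian density. -/
noncomputable abbrev stdPDF (x : ℝ) : ℝ := gaussianPDFReal 0 1 x

lemma stdPDF_eq (x : ℝ) : stdPDF x = (√(2 * Real.pi))⁻¹ * Real.exp (-x ^ 2 / 2) := by
  simp [stdPDF, gaussianPDFReal_def]

lemma stdPDF_pos (x : ℝ) : 0 < stdPDF x := gaussianPDFReal_pos 0 1 x (by norm_num)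

lemma hasDerivAt_stdPDF (x : ℝ) : HasDerivAt stdPDF (-x * stdPDF x) x := by
  have h1 : stdPDF = fun x => (√(2 * Real.pi))⁻¹ * Real.exp (-x ^ 2 / 2) := funext stdPDF_eq
  rw [h1]
  have h2 : HasDerivAt (fun x : ℝ => -x ^ 2 / 2) (-x) x := by
    have := ((hasDerivAt_pow 2 x).neg).div_const 2
    convert! this using 1
    push_cast; ring
  convert! (h2.exp).const_mul (√(2 * Real.pi))⁻¹ using 1
  ring

lemma continuous_stdPDF : Continuous stdPDF :=
  continuous_iff_continuousAt.2 fun x => (hasDerivAt_stdPDF x).continuousAt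

lemma stdPDF_neg (x : ℝ) : stdPDF (-x) = stdPDF x := by simp [stdPDF_eq]

lemma tendsto_exp_neg_sq_half_atTop (k : ℕ) :
    Tendsto (fun x : ℝ => x ^ k * Real.exp (-x ^ 2 / 2)) atTop (𝓝 0) := by
  have h := Real.tendsto_pow_mul_exp_neg_atTop_nhds_zero k
  refine squeeze_zero' (g := fun x : ℝ => x ^ k * Real.exp (-x)) ?_ ?_ h
  · filter_upwards [eventually_ge_atTop 0] with x hx
    positivity
  · filter_upwards [eventually_ge_atTop 2] with x hx
    have : -x ^ 2 / 2 ≤ -x := by nlinarith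
    gcongr

lemma tendsto_affine_mul_stdPDF_atTop (a b : ℝ) :
    Tendsto (fun x : ℝ => (a + b * x) * stdPDF x) atTop (𝓝 0) := by
  have h0 := (tendsto_exp_neg_sq_half_atTop 0).const_mul (a * (√(2 * Real.pi))⁻¹)
  have h1 := (tendsto_exp_neg_sq_half_atTop 1).const_mul (b * (√(2 * Real.pi))⁻¹)
  have := h0.add h1
  simp only [mul_zero, add_zero] at this
  refine this.congr fun x => ?_
  rw [stdPDF_eq]
  ring

/-- One-sided comparison for the equation `g' = x g + K`. -/
lemma le_of_stein_eq_right {g K : ℝ → ℝ} {a b : ℝ} (ha : 0 ≤ a)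
    (hg : ∀ x, HasDerivAt g (x * g x + K x) x) (hK : ∀ x, 0 ≤ x → |K x| ≤ a + b * x)
    (hlim : Tendsto (fun x => g x * stdPDF x) atTop (𝓝 0)) {x : ℝ} (hx : 0 ≤ x) :
    g x ≤ b + 2 * a / (1 + x) := by
  -- S is a supersolution of the equation on the half-line. Multiplying by the density, an
  -- integrating factor, makes (g - S) times the density increasing; it tends to 0 at infinity, so
  -- it is nonpositive.
  set S : ℝ → ℝ := fun t => b + 2 * a / (1 + t) with hS
  have hSd : ∀ t, 0 ≤ t → HasDerivAt S (-(2 * a) / (1 + t) ^ 2) t := by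
    intro t ht
    have h1 : HasDerivAt (fun t : ℝ => 1 + t) 1 t := (hasDerivAt_id t).const_add 1
    have h2 := (h1.inv (by positivity)).const_mul (2 * a)
    have h3 := h2.const_add b
    convert! h3 using 1
    field_simp
  have hq : ∀ t, 0 ≤ t → HasDerivAt (fun t => (g t - S t) * stdPDF t)
      ((t * g t + K t - -(2 * a) / (1 + t) ^ 2) * stdPDF t
        + (g t - S t) * (-t * stdPDF t)) t := fun t ht =>
    ((hg t).sub (hSd t ht)).mul (hasDerivAt_stdPDF t)
  have hmono : MonotoneOn (fun t => (g t - S t) * stdPDF t) (Ici x) := by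
    refine monotoneOn_of_hasDerivWithinAt_nonneg (convex_Ici x)
      (fun t ht => (hq t (hx.trans ht)).continuousAt.continuousWithinAt)
      (fun t ht => (hq t ?_).hasDerivWithinAt) ?_
    · rw [interior_Ici] at ht; exact hx.trans (le_of_lt ht)
    · intro t ht
      rw [interior_Ici] at ht
      have ht0 : 0 ≤ t := hx.trans (le_of_lt ht)
      have hKt := (abs_le.1 (hK t ht0)).1
      have hmain : 0 ≤ K t + 2 * a / (1 + t) ^ 2 + t * S t := by
        -- The factor 2 in S is used here: 2 + 2t(1 + t) ≥ (1 + t)².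
        have : a ≤ 2 * a / (1 + t) ^ 2 + t * (2 * a / (1 + t)) := by
          rw [show 2 * a / (1 + t) ^ 2 + t * (2 * a / (1 + t))
            = a * ((2 + 2 * t * (1 + t)) / (1 + t) ^ 2) by field_simp]
          refine le_mul_of_one_le_right ha ?_
          rw [one_le_div (by positivity)]
          nlinarith
        simp only [hS]
        nlinarith
      have h5 : (t * g t + K t - -(2 * a) / (1 + t) ^ 2) * stdPDF t
          + (g t - S t) * (-t * stdPDF t)
          = (K t + 2 * a / (1 + t) ^ 2 + t * S t) * stdPDF t := by ring
      rw [h5]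
      exact mul_nonneg hmain (stdPDF_pos t).le
  have hSlim : Tendsto (fun t => S t * stdPDF t) atTop (𝓝 0) := by
    have h0 := tendsto_affine_mul_stdPDF_atTop (|b| + 2 * a) 0
    refine squeeze_zero_norm' ?_ h0
    filter_upwards [eventually_ge_atTop 0] with t ht
    rw [norm_mul, Real.norm_eq_abs, Real.norm_eq_abs, abs_of_pos (stdPDF_pos t)]
    refine mul_le_mul_of_nonneg_right ?_ (stdPDF_pos t).le
    have h1 : 2 * a / (1 + t) ≤ 2 * a := div_le_self (by positivity) (by linarith)
    have h2 : 0 ≤ 2 * a / (1 + t) := by positivity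
    calc |S t| ≤ |b| + |2 * a / (1 + t)| := abs_add_le _ _
      _ ≤ _ := by rw [abs_of_nonneg h2]; linarith
  have hlim' : Tendsto (fun t => (g t - S t) * stdPDF t) atTop (𝓝 0) := by
    have := hlim.sub hSlim
    simp only [sub_zero] at this
    refine this.congr fun t => by ring
  have hle : (g x - S x) * stdPDF x ≤ 0 := by
    refine ge_of_tendsto hlim' ?_
    filter_upwards [eventually_ge_atTop x] with t ht
    exact hmono (mem_Ici.2 le_rfl) (mem_Ici.2 ht) ht
  have := nonpos_of_mul_nonpos_left hle (stdPDF_pos x)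
  linarith

/-- A solution of `g' = x g + K` with `|K x| ≤ a + b |x|` that grows slower than `exp (x ^ 2 / 2)`
is bounded. -/
lemma abs_le_of_stein_eq {g K : ℝ → ℝ} {a b : ℝ} (ha : 0 ≤ a)
    (hg : ∀ x, HasDerivAt g (x * g x + K x) x) (hK : ∀ x, |K x| ≤ a + b * |x|)
    (htop : Tendsto (fun x => g x * stdPDF x) atTop (𝓝 0))
    (hbot : Tendsto (fun x => g x * stdPDF x) atBot (𝓝 0)) (x : ℝ) :
    |g x| ≤ b + 2 * a / (1 + |x|) := by
  have pos : ∀ {g K : ℝ → ℝ}, (∀ x, HasDerivAt g (x * g x + K x) x) →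
      (∀ x, |K x| ≤ a + b * |x|) → Tendsto (fun x => g x * stdPDF x) atTop (𝓝 0) →
      ∀ x, 0 ≤ x → |g x| ≤ b + 2 * a / (1 + x) := by
    intro g K hg hK hlim x hx
    refine abs_le'.2 ⟨le_of_stein_eq_right ha hg
      (fun y hy => by simpa [abs_of_nonneg hy] using hK y) hlim hx, ?_⟩
    refine le_of_stein_eq_right (g := fun x => -g x) (K := fun x => -K x) ha (fun y => ?_)
      (fun y hy => by simpa [abs_of_nonneg hy] using hK y) ?_ hx
    · convert! (hg y).neg using 1
      ring
    · simpa using hlim.neg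
  rcases le_total 0 x with hx | hx
  · simpa [abs_of_nonneg hx] using pos hg hK htop x hx
  -- The equation is invariant under replacing g(x) by -g(-x) and K(x) by K(-x), so the negative
  -- half-line reduces to the positive one.
  · have := pos (g := fun x => -g (-x)) (K := fun x => K (-x)) (fun y => ?_)
      (fun y => by simpa using hK (-y)) ?_ (-x) (by linarith)
    · simpa [abs_of_nonpos hx] using this
    · have h1 := ((hg (-y)).comp y (hasDerivAt_neg y)).neg
      convert! h1 using 1
      ring
    · have := (hbot.comp tendsto_neg_atTop_atBot).neg
      simp only [neg_zero] at this
      refine this.congr fun y => ?_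
      simp [stdPDF_neg]

lemma integrable_id_gaussianReal : Integrable (fun x : ℝ => x) (gaussianReal 0 1) :=
  memLp_one_iff_integrable.1 (memLp_id_gaussianReal 1)

lemma integral_abs_gaussianReal_le : ∫ x, |x| ∂(gaussianReal 0 1) ≤ 1 := by
  have h2 : Integrable (fun x : ℝ => x ^ 2) (gaussianReal 0 1) :=
    (memLp_id_gaussianReal 2).integrable_sq
  have hv : ∫ x, x ^ 2 ∂(gaussianReal 0 1) = 1 := by
    have := variance_fun_id_gaussianReal (μ := 0) (v := 1)
    rw [variance_of_integral_eq_zero (by fun_prop) integral_id_gaussianReal] at this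
    simpa using this
  calc ∫ x, |x| ∂(gaussianReal 0 1) ≤ ∫ x, (1 + x ^ 2) / 2 ∂(gaussianReal 0 1) := by
        refine integral_mono integrable_id_gaussianReal.abs
          (((integrable_const _).add h2).div_const _) fun x => ?_
        have : |x| ^ 2 = x ^ 2 := sq_abs x
        simp only
        nlinarith [sq_nonneg (|x| - 1)]
    _ = 1 := by
        rw [integral_div, integral_add (integrable_const _) h2, hv]
        simp

lemma integrable_gaussianReal_iff {H : ℝ → ℝ} :
    Integrable H (gaussianReal 0 1) ↔ Integrable (fun t => stdPDF t * H t) := by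
  rw [gaussianReal_of_var_ne_zero _ one_ne_zero,
    integrable_withDensity_iff_integrable_smul' (measurable_gaussianPDF 0 1)
      (ae_of_all _ fun x => gaussianPDF_lt_top)]
  simp [stdPDF]

lemma LipschitzWith.integrable_of_integrable_id {μ : Measure ℝ} [IsFiniteMeasure μ]
    {h : ℝ → ℝ} {L : NNReal} (hh : LipschitzWith L h) (hμ : Integrable (fun x => x) μ) :
    Integrable h μ := by
  have h1 : Integrable (fun x : ℝ => |h 0| + L * |x|) μ :=
    (integrable_const _).add (hμ.abs.const_mul _)
  refine h1.mono' hh.continuous.aestronglyMeasurable (ae_of_all _ fun x => ?_)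
  have h2 := hh.dist_le_mul x 0
  rw [Real.dist_eq, Real.dist_eq, sub_zero] at h2
  calc ‖h x‖ = |h 0 + (h x - h 0)| := by rw [Real.norm_eq_abs]; ring_nf
    _ ≤ |h 0| + |h x - h 0| := abs_add_le _ _
    _ ≤ _ := by linarith

/-- The solution of Stein's equation for a differentiable `1`-Lipschitz test function. -/
lemma exists_stein_solution {h h' : ℝ → ℝ} (hd : ∀ x, HasDerivAt h (h' x) x)
    (hb : ∀ x, |h' x| ≤ 1) :
    ∃ φ φ' : ℝ → ℝ, (∀ x, HasDerivAt φ (φ' x) x) ∧ (∀ x, |φ x| ≤ 3) ∧ (∀ x, |φ' x| ≤ 12) ∧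
      (∀ x y, |φ' x - φ' y| ≤ 12 * |x - y|) ∧
      ∀ x, φ' x - x * φ x = h x - ∫ t, h t ∂(gaussianReal 0 1) := by
  set e := ∫ t, h t ∂(gaussianReal 0 1) with he
  have hlip : LipschitzWith 1 h := by
    refine lipschitzWith_of_nnnorm_deriv_le (fun x => (hd x).differentiableAt) fun x => ?_
    rw [(hd x).deriv, ← NNReal.coe_le_coe]
    simpa using hb x
  have hcont : Continuous h := hlip.continuous
  have hint : Integrable h (gaussianReal 0 1) :=
    hlip.integrable_of_integrable_id integrable_id_gaussianReal
  set H : ℝ → ℝ := fun x => h x - e with hH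
  have hHcont : Continuous H := hcont.sub continuous_const
  have hHint : Integrable H (gaussianReal 0 1) := hint.sub (integrable_const _)
  have hpH : Integrable (fun t => stdPDF t * H t) := integrable_gaussianReal_iff.1 hHint
  have hpHc : Continuous (fun t => stdPDF t * H t) := continuous_stdPDF.mul hHcont
  -- Centering makes the total integral vanish, so G below tends to 0 at both ends; this is the
  -- growth condition of `abs_le_of_stein_eq`.
  have hzero : ∫ t, stdPDF t * H t = 0 := by
    have h1 : ∫ t, H t ∂(gaussianReal 0 1) = 0 := by
      rw [integral_sub hint (integrable_const _)]
      simp [he]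
    rw [integral_gaussianReal_eq_integral_smul one_ne_zero] at h1
    simpa using h1
  have hHb : ∀ x, |H x| ≤ 1 + 1 * |x| := by
    intro x
    have h1 : H x = ∫ t, (h x - h t) ∂(gaussianReal 0 1) := by
      rw [integral_sub (integrable_const _) hint]
      simp [hH, he]
    rw [h1]
    calc |∫ t, (h x - h t) ∂(gaussianReal 0 1)| ≤ ∫ t, |h x - h t| ∂(gaussianReal 0 1) :=
          abs_integral_le_integral_abs
      _ ≤ ∫ t, (|x| + |t|) ∂(gaussianReal 0 1) := by
          refine integral_mono (((integrable_const _).sub hint).abs)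
            ((integrable_const _).add integrable_id_gaussianReal.abs) fun t => ?_
          have := hlip.dist_le_mul x t
          rw [Real.dist_eq, Real.dist_eq] at this
          simp only [NNReal.coe_one, one_mul] at this
          exact this.trans (abs_sub x t)
      _ ≤ 1 + 1 * |x| := by
          rw [integral_add (integrable_const _) integrable_id_gaussianReal.abs]
          have := integral_abs_gaussianReal_le
          simp only [integral_const, probReal_univ, smul_eq_mul]
          linarith
  set G : ℝ → ℝ := fun x => ∫ t in Iic x, stdPDF t * H t with hG
  have hGd : ∀ x, HasDerivAt G (stdPDF x * H x) x := by
    intro x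
    have h1 : ∀ y, G y = G 0 + ∫ t in (0 : ℝ)..y, stdPDF t * H t := by
      intro y
      rw [← intervalIntegral.integral_Iic_sub_Iic hpH.integrableOn hpH.integrableOn]
      simp [hG]
    have h2 : HasDerivAt (fun y => G 0 + ∫ t in (0 : ℝ)..y, stdPDF t * H t)
        (stdPDF x * H x) x :=
      (intervalIntegral.integral_hasDerivAt_right hpH.intervalIntegrable
        hpHc.aestronglyMeasurable.stronglyMeasurableAtFilter
        hpHc.continuousAt).const_add _
    rwa [← funext h1] at h2
  have hGbot : Tendsto G atBot (𝓝 0) := by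
    exact tendsto_integral_Iic_zero tendsto_id
  have hGtop : Tendsto G atTop (𝓝 0) := by
    have := (aecover_Iic (μ := volume) (tendsto_id (α := ℝ) (x := atTop))).integral_tendsto_of_countably_generated hpH
    rwa [hzero] at this
  set φ : ℝ → ℝ := fun x => G x / stdPDF x with hφ
  have hφp : ∀ x, φ x * stdPDF x = G x := fun x => div_mul_cancel₀ _ (stdPDF_pos x).ne'
  have hφd : ∀ x, HasDerivAt φ (x * φ x + H x) x := by
    intro x
    have h1 := (hGd x).div (hasDerivAt_stdPDF x) (stdPDF_pos x).ne'
    convert! h1 using 1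
    have := (stdPDF_pos x).ne'
    simp only [hφ]
    field_simp
    ring
  have hφb0 := abs_le_of_stein_eq zero_le_one hφd hHb
    (by simpa only [hφp] using hGtop) (by simpa only [hφp] using hGbot)
  have hφb : ∀ x, |φ x| ≤ 3 := fun x => by
    refine (hφb0 x).trans ?_
    have : 2 * (1 : ℝ) / (1 + |x|) ≤ 2 := by
      rw [mul_one]; exact div_le_self (by norm_num) (by linarith [abs_nonneg x])
    linarith
  -- g = φ' solves an equation of the same type with forcing term φ + h', bounded by 3 + 1. A second
  -- use of the comparison lemma gives |g| ≤ 8/(1 + |x|), so that x g is bounded too and g' is at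
  -- most 8 + 4, without a second derivative of h.
  set g : ℝ → ℝ := fun x => x * φ x + H x with hg
  have hgd : ∀ x, HasDerivAt g (x * g x + (φ x + h' x)) x := by
    intro x
    have h1 := ((hasDerivAt_id x).mul (hφd x)).add ((hd x).sub_const e)
    convert! h1 using 1
    simp [hg]
    ring
  have hgb0 : ∀ x, |g x| ≤ 1 + 4 * |x| := by
    intro x
    calc |g x| ≤ |x * φ x| + |H x| := abs_add_le _ _
      _ ≤ |x| * 3 + (1 + 1 * |x|) := by
          rw [abs_mul]
          gcongr
          · exact hφb x
          · exact hHb x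
      _ = _ := by ring
  have hgtop : Tendsto (fun x => g x * stdPDF x) atTop (𝓝 0) := by
    refine squeeze_zero_norm' ?_ (tendsto_affine_mul_stdPDF_atTop 1 4)
    filter_upwards [eventually_ge_atTop 0] with x hx
    rw [norm_mul, Real.norm_eq_abs, Real.norm_eq_abs, abs_of_pos (stdPDF_pos x)]
    have := hgb0 x
    rw [abs_of_nonneg hx] at this
    exact mul_le_mul_of_nonneg_right this (stdPDF_pos x).le
  have hgbot : Tendsto (fun x => g x * stdPDF x) atBot (𝓝 0) := by
    refine squeeze_zero_norm' ?_ ((tendsto_affine_mul_stdPDF_atTop 1 4).comp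
      tendsto_neg_atBot_atTop)
    filter_upwards [eventually_le_atBot 0] with x hx
    rw [norm_mul, Real.norm_eq_abs, Real.norm_eq_abs, abs_of_pos (stdPDF_pos x)]
    have := hgb0 x
    rw [abs_of_nonpos hx] at this
    simp only [Function.comp, stdPDF_neg]
    exact mul_le_mul_of_nonneg_right this (stdPDF_pos x).le
  have hgb1 := abs_le_of_stein_eq (a := 4) (b := 0) (by norm_num) hgd
    (fun x => by
      calc |φ x + h' x| ≤ |φ x| + |h' x| := abs_add_le _ _
        _ ≤ 4 + 0 * |x| := by linarith [hφb x, hb x]) hgtop hgbot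
  have hgx : ∀ x, |g x| * (1 + |x|) ≤ 8 := by
    intro x
    have h1 := hgb1 x
    rw [zero_add, le_div_iff₀ (by positivity)] at h1
    linarith
  refine ⟨φ, g, hφd, hφb, fun x => ?_, fun x y => ?_, fun x => by simp [hg, hH]⟩
  · nlinarith [hgx x, mul_nonneg (abs_nonneg (g x)) (abs_nonneg x)]
  · have hlip : LipschitzWith 12 g := by
      refine lipschitzWith_of_nnnorm_deriv_le (fun x => (hgd x).differentiableAt) fun x => ?_
      rw [(hgd x).deriv, ← NNReal.coe_le_coe]
      simp only [coe_nnnorm, NNReal.coe_ofNat, Real.norm_eq_abs]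
      calc |x * g x + (φ x + h' x)| ≤ |x * g x| + (|φ x| + |h' x|) :=
            (abs_add_le _ _).trans (by gcongr; exact abs_add_le _ _)
        _ ≤ 8 + (3 + 1) := by
            rw [abs_mul]
            gcongr
            · nlinarith [hgx x, abs_nonneg (g x)]
            · exact hφb x
            · exact hb x
        _ = 12 := by norm_num
    simpa [Real.dist_eq] using hlip.dist_le_mul x y

/-- A Lipschitz function is uniformly close to differentiable ones with the same Lipschitz
constant. -/
lemma exists_smooth_lipschitz_approx {h : ℝ → ℝ} (hh : LipschitzWith 1 h) {ε : ℝ} (hε : 0 < ε) :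
    ∃ k k' : ℝ → ℝ, (∀ x, HasDerivAt k (k' x) x) ∧ (∀ x, |k' x| ≤ 1) ∧
      ∀ x, |k x - h x| ≤ ε := by
  have hd : ∀ x y, |h x - h y| ≤ |x - y| := fun x y => by
    simpa [Real.dist_eq] using hh.dist_le_mul x y
  have hi : ∀ a b, IntervalIntegrable h volume a b := fun a b =>
    hh.continuous.intervalIntegrable a b
  -- A moving average over a window of length ε; its derivative is a difference quotient of h, hence
  -- bounded by the Lipschitz constant.
  refine ⟨fun x => (∫ t in x..(x + ε), h t) / ε, fun x => (h (x + ε) - h x) / ε,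
    fun x => ?_, fun x => ?_, fun x => ?_⟩
  · have h1 : ∀ x, ∫ t in x..(x + ε), h t = (∫ t in (0 : ℝ)..(x + ε), h t) - ∫ t in (0 : ℝ)..x, h t :=
      fun x => (intervalIntegral.integral_interval_sub_left (hi _ _) (hi _ _)).symm
    simp only [h1]
    have hF : ∀ x, HasDerivAt (fun x => ∫ t in (0 : ℝ)..x, h t) (h x) x := fun x =>
      intervalIntegral.integral_hasDerivAt_right (hi _ _)
        hh.continuous.aestronglyMeasurable.stronglyMeasurableAtFilter hh.continuous.continuousAt
    exact (((hF (x + ε)).comp_add_const x ε).sub (hF x)).div_const ε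
  · rw [abs_div, abs_of_pos hε, div_le_one hε]
    simpa [abs_of_pos hε] using hd (x + ε) x
  · have h1 : (∫ t in x..(x + ε), h t) / ε - h x = (∫ t in x..(x + ε), (h t - h x)) / ε := by
      rw [intervalIntegral.integral_sub (hi _ _) (by simp)]
      simp
      field_simp
    rw [h1, abs_div, abs_of_pos hε, div_le_iff₀ hε]
    have h2 := intervalIntegral.norm_integral_le_of_norm_le_const (a := x) (b := x + ε)
      (f := fun t => h t - h x) (C := ε) ?_
    · simpa [abs_of_pos hε] using h2
    · intro t ht
      rw [uIoc_of_le (by linarith)] at ht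
      refine (hd t x).trans ?_
      rw [abs_of_nonneg (by linarith [ht.1])]
      linarith [ht.2]

/-- **Stein's method**: the Wasserstein distance to the standard Gaussian law is controlled by
`E[φ'(W) - W φ(W)]` for `φ` bounded with bounded and Lipschitz derivative. -/
theorem wassersteinDist_gaussian_le {μ : Measure ℝ} [IsProbabilityMeasure μ]
    (hμ : Integrable (fun x => x) μ) {ε : ℝ}
    (H : ∀ φ φ' : ℝ → ℝ, (∀ x, HasDerivAt φ (φ' x) x) → (∀ x, |φ x| ≤ 3) → (∀ x, |φ' x| ≤ 12) →
      (∀ x y, |φ' x - φ' y| ≤ 12 * |x - y|) → |∫ x, (φ' x - x * φ x) ∂μ| ≤ ε) :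
    wassersteinDist μ (gaussianReal 0 1) ≤ ENNReal.ofReal ε := by
  refine iSup₂_le fun h hh => ENNReal.ofReal_le_ofReal ?_
  refine le_of_forall_pos_le_add fun η hη => ?_
  obtain ⟨k, k', hk, hk', hkh⟩ := exists_smooth_lipschitz_approx hh (half_pos hη)
  obtain ⟨φ, φ', h1, h2, h3, h4, h5⟩ := exists_stein_solution hk hk'
  have hklip : LipschitzWith 1 k := by
    refine lipschitzWith_of_nnnorm_deriv_le (fun x => (hk x).differentiableAt) fun x => ?_
    rw [(hk x).deriv, ← NNReal.coe_le_coe]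
    simpa using hk' x
  have hki : Integrable k μ := hklip.integrable_of_integrable_id hμ
  have key := H φ φ' h1 h2 h3 h4
  simp only [h5] at key
  rw [integral_sub hki (integrable_const _)] at key
  simp only [integral_const, probReal_univ, one_smul] at key
  have close : ∀ (ρ : Measure ℝ) [IsProbabilityMeasure ρ], Integrable (fun x => x) ρ →
      |∫ t, h t ∂ρ - ∫ t, k t ∂ρ| ≤ η / 2 := by
    intro ρ _ hρ
    rw [← integral_sub (hh.integrable_of_integrable_id hρ) (hklip.integrable_of_integrable_id hρ)]
    have := norm_integral_le_of_norm_le_const (μ := ρ) (f := fun t => h t - k t) (C := η / 2)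
      (ae_of_all _ fun t => by rw [Real.norm_eq_abs, abs_sub_comm]; exact hkh t)
    simpa using this
  have c1 := abs_le.1 (close μ hμ)
  have c2 := abs_le.1 (close (gaussianReal 0 1) integrable_id_gaussianReal)
  have c3 := abs_le.1 key
  rw [abs_le]
  constructor <;> linarith [c1.1, c1.2, c2.1, c2.2, c3.1, c3.2]

/-! ### Resampling coordinates of a product measure -/

section Mix

variable {ι : Type*} [DecidableEq ι] {S : Type*}

/-- From pairs `c i`, take the second entry for `i ∈ B` and the first one otherwise. -/
def mix (B : Finset ι) (c : ι → S × S) : ι → S := fun i => if i ∈ B then (c i).2 else (c i).1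

/-- Swap the entries of the pairs `c i`, `i ∈ B`. -/
def swapOn (B : Finset ι) (c : ι → S × S) : ι → S × S :=
  fun i => if i ∈ B then (c i).swap else c i

/-- Swaps preserve the law of the pairs, so this identity shows that mixtures indexed by sets can be
shifted by a symmetric difference without changing joint laws. It is the source of every
exchangeability argument below. -/
lemma mix_swapOn (A B : Finset ι) (c : ι → S × S) :
    mix A (swapOn B c) = mix (symmDiff A B) c := by
  funext i
  by_cases hA : i ∈ A <;> by_cases hB : i ∈ B <;> simp [mix, swapOn, Finset.mem_symmDiff, hA, hB]

variable [Fintype ι] [MeasurableSpace S]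

lemma measurable_mix (B : Finset ι) : Measurable (mix B : (ι → S × S) → ι → S) := by
  refine measurable_pi_lambda _ fun i => ?_
  unfold mix
  split_ifs <;> fun_prop

lemma measurePreserving_mix (ρ : Measure S) [IsProbabilityMeasure ρ] (B : Finset ι) :
    MeasurePreserving (mix B) (Measure.pi fun _ : ι => ρ.prod ρ) (Measure.pi fun _ : ι => ρ) := by
  have := measurePreserving_pi (fun _ : ι => ρ.prod ρ) (fun _ : ι => ρ)
    (f := fun i (p : S × S) => if i ∈ B then p.2 else p.1) (fun i => by
      by_cases h : i ∈ B
      · simpa [h] using measurePreserving_snd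
      · simpa [h] using measurePreserving_fst)
  exact this

lemma measurePreserving_swapOn (ρ : Measure S) [IsProbabilityMeasure ρ] (B : Finset ι) :
    MeasurePreserving (swapOn B) (Measure.pi fun _ : ι => ρ.prod ρ)
      (Measure.pi fun _ : ι => ρ.prod ρ) := by
  have := measurePreserving_pi (fun _ : ι => ρ.prod ρ) (fun _ : ι => ρ.prod ρ)
    (f := fun i (p : S × S) => if i ∈ B then p.swap else p) (fun i => by
      by_cases h : i ∈ B
      · simpa [h] using Measure.measurePreserving_swap
      · simp only [h, if_false]
        exact MeasurePreserving.id _)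
  exact this

end Mix

/-! ### Weights on subsets and the telescoping identity -/

section Weights

/-- The weight of a set of `a` elements in the measure on subsets of an `n`-set that first chooses
the size uniformly in `{0, …, n}` and then a uniform set of this size. -/
noncomputable def sizeWeight (n a : ℕ) : ℝ := 1 / ((n + 1) * (n.choose a : ℝ))

lemma sizeWeight_nonneg (n a : ℕ) : 0 ≤ sizeWeight n a := by unfold sizeWeight; positivity

/-- Together with `sizeWeight_add_pred` this is a balance equation: the flow through a set of given
size is the same whether computed from elements that can be inserted or from elements that can be
removed. -/
lemma sizeWeight_add_succ {n a : ℕ} (h : a < n) :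
    ((n : ℝ) - a) * (sizeWeight n a + sizeWeight n (a + 1)) = 1 / n.choose a := by
  have h1 : (n.choose (a + 1) : ℝ) * (a + 1) = n.choose a * (n - a) := by
    have := Nat.choose_succ_right_eq n a
    rw [← Nat.cast_sub h.le]
    exact_mod_cast this
  have h2 : (0 : ℝ) < n.choose a := by exact_mod_cast Nat.choose_pos h.le
  have h3 : (0 : ℝ) < n - a := by
    have : (a : ℝ) < n := by exact_mod_cast h
    linarith
  have h4 : (n.choose (a + 1) : ℝ) = n.choose a * (n - a) / (a + 1) := by
    field_simp; linarith
  unfold sizeWeight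
  rw [h4]
  field_simp
  ring

lemma sizeWeight_add_pred {n a : ℕ} (h : a + 1 ≤ n) :
    ((a + 1 : ℕ) : ℝ) * (sizeWeight n (a + 1) + sizeWeight n a) = 1 / n.choose (a + 1) := by
  have h1 : (n.choose (a + 1) : ℝ) * (a + 1) = n.choose a * (n - a) := by
    have := Nat.choose_succ_right_eq n a
    rw [← Nat.cast_sub (by omega : a ≤ n)]
    exact_mod_cast this
  have h2 : (0 : ℝ) < n.choose a := by exact_mod_cast Nat.choose_pos (by omega : a ≤ n)
  have h3 : (0 : ℝ) < n - a := by
    have : (a : ℝ) < n := by exact_mod_cast h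
    linarith
  have h4 : (n.choose (a + 1) : ℝ) = n.choose a * (n - a) / (a + 1) := by
    field_simp; linarith
  unfold sizeWeight
  rw [h4]
  push_cast
  field_simp
  ring

variable {ι : Type*} [DecidableEq ι] [Fintype ι]

lemma sum_sizeWeight : ∑ B : Finset ι, sizeWeight (Fintype.card ι) B.card = 1 := by
  have := Finset.sum_powerset_apply_card (fun a => sizeWeight (Fintype.card ι) a)
    (x := (Finset.univ : Finset ι))
  rw [Finset.powerset_univ] at this
  rw [this, Finset.card_univ]
  have h : ∀ a ∈ Finset.range (Fintype.card ι + 1),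
      (Fintype.card ι).choose a • sizeWeight (Fintype.card ι) a = 1 / ((Fintype.card ι : ℝ) + 1) := by
    intro a ha
    have : (0 : ℝ) < (Fintype.card ι).choose a := by
      exact_mod_cast Nat.choose_pos (Finset.mem_range_succ_iff.1 ha)
    rw [nsmul_eq_mul, sizeWeight]
    field_simp
  rw [Finset.sum_congr rfl h]
  simp
  field_simp

/-- Removing or inserting a uniform element moves a random subset with law `sizeWeight` from `∅`
to the full set on average. -/
lemma sum_sizeWeight_mul_sub (h : Finset ι → ℝ) :
    ∑ B : Finset ι, sizeWeight (Fintype.card ι) B.card * ∑ j, (h (B.erase j) - h (insert j B))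
      = h ∅ - h Finset.univ := by
  set n := Fintype.card ι with hn
  set w := sizeWeight n with hw
  -- A set without j arises as an erasure exactly twice, from itself and from its union with {j}.
  -- `e2` is the dual count for insertions.
  have e1 : ∀ j : ι, ∑ B : Finset ι, w B.card * h (B.erase j)
      = ∑ B : Finset ι, if j ∉ B then (w B.card + w (B.card + 1)) * h B else 0 := by
    intro j
    rw [← Finset.sum_filter]
    simp only [add_mul, Finset.sum_add_distrib]
    rw [← Finset.sum_filter_add_sum_filter_not Finset.univ (fun B : Finset ι => j ∉ B)]
    congr 1
    · refine Finset.sum_congr rfl fun B hB => ?_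
      rw [Finset.erase_eq_of_notMem (by simpa using hB)]
    · refine Finset.sum_nbij' (fun B => B.erase j) (fun B => insert j B) ?_ ?_ ?_ ?_ ?_
      · simp
      · simp
      · intro B hB; exact Finset.insert_erase (by simpa using hB)
      · intro B hB; exact Finset.erase_insert (by simpa using hB)
      · intro B hB
        rw [Finset.card_erase_add_one (by simpa using hB)]
  have e2 : ∀ j : ι, ∑ B : Finset ι, w B.card * h (insert j B)
      = ∑ B : Finset ι, if j ∈ B then (w B.card + w (B.card - 1)) * h B else 0 := by
    intro j
    rw [← Finset.sum_filter]
    simp only [add_mul, Finset.sum_add_distrib]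
    rw [← Finset.sum_filter_add_sum_filter_not Finset.univ (fun B : Finset ι => j ∈ B)]
    congr 1
    · refine Finset.sum_congr rfl fun B hB => ?_
      rw [Finset.insert_eq_of_mem (by simpa using hB)]
    · refine Finset.sum_nbij' (fun B => insert j B) (fun B => B.erase j) ?_ ?_ ?_ ?_ ?_
      · simp
      · simp
      · intro B hB; exact Finset.erase_insert (by simpa using hB)
      · intro B hB; exact Finset.insert_erase (by simpa using hB)
      · intro B hB
        rw [Finset.card_insert_of_notMem (by simpa using hB), Nat.add_sub_cancel]
  have e3 : ∑ B : Finset ι, w B.card * ∑ j, (h (B.erase j) - h (insert j B))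
      = ∑ B : Finset ι, (((n : ℝ) - B.card) * (w B.card + w (B.card + 1))
          - B.card * (w B.card + w (B.card - 1))) * h B := by
    simp only [Finset.mul_sum, mul_sub]
    rw [Finset.sum_comm]
    simp only [Finset.sum_sub_distrib, e1, e2]
    rw [Finset.sum_comm, Finset.sum_comm (γ := ι), ← Finset.sum_sub_distrib]
    refine Finset.sum_congr rfl fun B _ => ?_
    rw [← Finset.sum_filter, ← Finset.sum_filter, Finset.sum_const, Finset.sum_const,
      nsmul_eq_mul, nsmul_eq_mul]
    have c1 : (Finset.univ.filter fun j => j ∈ B).card = B.card := by simp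
    have c2 : ((Finset.univ.filter fun j => j ∉ B).card : ℝ) = n - B.card := by
      rw [Finset.filter_not, Finset.filter_mem_eq_inter, Finset.univ_inter,
        Finset.cast_card_sdiff (Finset.subset_univ B), Finset.card_univ]
    rw [c1, c2]
    ring
  rw [e3]
  -- Both products equal 1 / n.choose |B| and cancel, except that the first vanishes on the full set
  -- and the second on ∅. There the values at |B| + 1 and at the truncated |B| - 1 are multiplied by
  -- 0.
  have e4 : ∀ B : Finset ι, (((n : ℝ) - B.card) * (w B.card + w (B.card + 1))
      - B.card * (w B.card + w (B.card - 1))) * h B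
      = (if B = ∅ then h B else 0) - if B = Finset.univ then h B else 0 := by
    intro B
    have hBn : B.card ≤ n := Finset.card_le_univ B
    have hu : B = Finset.univ ↔ B.card = n := (Finset.card_eq_iff_eq_univ B).symm
    have h0 : B = ∅ ↔ B.card = 0 := Finset.card_eq_zero.symm
    rw [if_congr hu rfl rfl, if_congr h0 rfl rfl]
    have t1 : ((n : ℝ) - B.card) * (w B.card + w (B.card + 1))
        = if B.card = n then 0 else 1 / (n.choose B.card : ℝ) := by
      split_ifs with hc
      · rw [hc]; ring
      · exact sizeWeight_add_succ (lt_of_le_of_ne hBn hc)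
    have t2 : (B.card : ℝ) * (w B.card + w (B.card - 1))
        = if B.card = 0 then 0 else 1 / (n.choose B.card : ℝ) := by
      split_ifs with hc
      · rw [hc]; simp
      · obtain ⟨a, ha⟩ := Nat.exists_eq_succ_of_ne_zero hc
        rw [ha, Nat.succ_eq_add_one, Nat.add_sub_cancel]
        exact sizeWeight_add_pred (by omega)
    rw [t1, t2]
    split_ifs with c1 c2 c2
    · ring
    · rw [c1]; simp
    · rw [c2]; simp
    · ring
  rw [Finset.sum_congr rfl fun B _ => e4 B, Finset.sum_sub_distrib]
  simp

end Weights

/-! ### Chatterjee's covariance formula and the Efron-Stein inequality -/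

section Covariance

variable {ι : Type*} [DecidableEq ι] [Fintype ι] {S : Type*} [MeasurableSpace S]

/-- The effect on `F` of resampling the coordinate `j`. -/
def resampleDiff (F : (ι → S) → ℝ) (j : ι) (c : ι → S × S) : ℝ := F (mix ∅ c) - F (mix {j} c)

/-- The effect on `F` of resampling the coordinate `j` when those in `B` have been resampled. -/
def resampleDiffOn (F : (ι → S) → ℝ) (B : Finset ι) (j : ι) (c : ι → S × S) : ℝ :=
  F (mix (B.erase j) c) - F (mix (insert j B) c)

/-- Since swaps preserve the law, all moments of `resampleDiffOn` are independent of B. -/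
lemma resampleDiffOn_eq_swapOn (F : (ι → S) → ℝ) (B : Finset ι) (j : ι) (c : ι → S × S) :
    resampleDiffOn F B j c = resampleDiff F j (swapOn (B.erase j) c) := by
  have h1 : symmDiff ∅ (B.erase j) = B.erase j := bot_symmDiff _
  have h2 : symmDiff {j} (B.erase j) = insert j B := by
    ext i
    by_cases h : i = j <;> simp [Finset.mem_symmDiff, h]
  rw [resampleDiffOn, resampleDiff, mix_swapOn, mix_swapOn, h1, h2]

lemma resampleDiffOn_swap (F : (ι → S) → ℝ) (B : Finset ι) (j : ι) (c : ι → S × S) :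
    resampleDiffOn F B j (swapOn {j} c) = -resampleDiffOn F B j c := by
  have h1 : symmDiff (B.erase j) {j} = insert j B := by
    ext i
    by_cases h : i = j <;> simp [Finset.mem_symmDiff, h]
  have h2 : symmDiff (insert j B) {j} = B.erase j := by
    ext i
    by_cases h : i = j <;> simp [Finset.mem_symmDiff, h]
  rw [resampleDiffOn, resampleDiffOn, mix_swapOn, mix_swapOn, neg_sub, h1, h2]

lemma mix_singleton_swapOn (j : ι) (c : ι → S × S) : mix {j} (swapOn {j} c) = mix ∅ c := by
  rw [mix_swapOn]; simp

variable (ρ : Measure S) [IsProbabilityMeasure ρ]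

lemma memLp_comp_mix {F : (ι → S) → ℝ} {q : ENNReal} (hF : MemLp F q (Measure.pi fun _ : ι => ρ))
    (B : Finset ι) : MemLp (fun c => F (mix B c)) q (Measure.pi fun _ : ι => ρ.prod ρ) :=
  hF.comp_measurePreserving (measurePreserving_mix ρ B)

lemma memLp_resampleDiff {F : (ι → S) → ℝ} {q : ENNReal}
    (hF : MemLp F q (Measure.pi fun _ : ι => ρ)) (j : ι) :
    MemLp (resampleDiff F j) q (Measure.pi fun _ : ι => ρ.prod ρ) :=
  (memLp_comp_mix ρ hF _).sub (memLp_comp_mix ρ hF _)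

lemma memLp_resampleDiffOn {F : (ι → S) → ℝ} {q : ENNReal}
    (hF : MemLp F q (Measure.pi fun _ : ι => ρ)) (B : Finset ι) (j : ι) :
    MemLp (resampleDiffOn F B j) q (Measure.pi fun _ : ι => ρ.prod ρ) :=
  (memLp_comp_mix ρ hF _).sub (memLp_comp_mix ρ hF _)

lemma integral_comp_of_measurePreserving {α β : Type*} [MeasurableSpace α] [MeasurableSpace β]
    {μ : Measure α} {ν : Measure β} {f : α → β} (hf : MeasurePreserving f μ ν) {g : β → ℝ}
    (hg : AEStronglyMeasurable g ν) : ∫ a, g (f a) ∂μ = ∫ b, g b ∂ν := by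
  rw [← hf.map_eq] at hg ⊢
  exact (integral_map hf.measurable.aemeasurable hg).symm

/-- Functions of a sample and of an independent copy are uncorrelated. -/
lemma integral_mul_mix_univ {g F : (ι → S) → ℝ} (hg : AEStronglyMeasurable g (Measure.pi fun _ : ι => ρ))
    (hF : AEStronglyMeasurable F (Measure.pi fun _ : ι => ρ)) :
    ∫ c, g (mix ∅ c) * F (mix Finset.univ c) ∂(Measure.pi fun _ : ι => ρ.prod ρ)
      = (∫ x, g x ∂(Measure.pi fun _ : ι => ρ)) * ∫ x, F x ∂(Measure.pi fun _ : ι => ρ) := by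
  have h := measurePreserving_arrowProdEquivProdArrow S S ι (fun _ => ρ) (fun _ => ρ)
  rw [← integral_prod_mul]
  rw [← integral_comp_of_measurePreserving h]
  · refine integral_congr_ae (ae_of_all _ fun c => ?_)
    simp only [MeasurableEquiv.arrowProdEquivProdArrow]
    congr 2
    funext i; simp [mix, Equiv.arrowProdEquivProdArrow]
  · exact hg.comp_fst.mul hF.comp_snd

/-- Swapping pair j exchanges the two values of g and flips the sign of `resampleDiffOn F B j`, so
the two halves of the product contribute equally. -/
lemma integral_resampleDiff_mul {g F : (ι → S) → ℝ} (hg : MemLp g 2 (Measure.pi fun _ : ι => ρ))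
    (hF : MemLp F 2 (Measure.pi fun _ : ι => ρ)) (B : Finset ι) (j : ι) :
    ∫ c, resampleDiff g j c * resampleDiffOn F B j c ∂(Measure.pi fun _ : ι => ρ.prod ρ)
      = 2 * ∫ c, g (mix ∅ c) * resampleDiffOn F B j c ∂(Measure.pi fun _ : ι => ρ.prod ρ) := by
  have hv := memLp_resampleDiffOn ρ hF B j
  have h1 : Integrable (fun c => g (mix ∅ c) * resampleDiffOn F B j c)
      (Measure.pi fun _ : ι => ρ.prod ρ) := (memLp_comp_mix ρ hg ∅).integrable_mul hv
  have h2 : Integrable (fun c => g (mix {j} c) * resampleDiffOn F B j c)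
      (Measure.pi fun _ : ι => ρ.prod ρ) := (memLp_comp_mix ρ hg {j}).integrable_mul hv
  have h3 := integral_comp_of_measurePreserving (measurePreserving_swapOn ρ {j}) h2.1
  simp only [mix_singleton_swapOn, resampleDiffOn_swap, mul_neg, integral_neg] at h3
  have h4 : ∀ c, resampleDiff g j c * resampleDiffOn F B j c
      = g (mix ∅ c) * resampleDiffOn F B j c - g (mix {j} c) * resampleDiffOn F B j c := by
    intro c; unfold resampleDiff; ring
  simp only [h4]
  rw [integral_sub h1 h2, ← h3]
  ring

/-- Chatterjee's formula for the covariance of two functions of independent variables. -/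
theorem covariance_eq_sum {g F : (ι → S) → ℝ} (hg : MemLp g 2 (Measure.pi fun _ : ι => ρ))
    (hF : MemLp F 2 (Measure.pi fun _ : ι => ρ)) :
    (∫ x, g x * F x ∂(Measure.pi fun _ : ι => ρ))
        - (∫ x, g x ∂(Measure.pi fun _ : ι => ρ)) * ∫ x, F x ∂(Measure.pi fun _ : ι => ρ)
      = ∑ B : Finset ι, sizeWeight (Fintype.card ι) B.card *
          ∑ j, (1 / 2) * ∫ c, resampleDiff g j c * resampleDiffOn F B j c
            ∂(Measure.pi fun _ : ι => ρ.prod ρ) := by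
  have hi : ∀ B j, Integrable (fun c => g (mix ∅ c) * resampleDiffOn F B j c)
      (Measure.pi fun _ : ι => ρ.prod ρ) := fun B j =>
    (memLp_comp_mix ρ hg ∅).integrable_mul (memLp_resampleDiffOn ρ hF B j)
  have h1 : ∀ B j, (1 / 2 : ℝ) * ∫ c, resampleDiff g j c * resampleDiffOn F B j c
      ∂(Measure.pi fun _ : ι => ρ.prod ρ)
      = ∫ c, g (mix ∅ c) * resampleDiffOn F B j c ∂(Measure.pi fun _ : ι => ρ.prod ρ) := by
    intro B j
    rw [integral_resampleDiff_mul ρ hg hF]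
    ring
  simp only [h1]
  have h2 : ∑ B : Finset ι, sizeWeight (Fintype.card ι) B.card *
      ∑ j, ∫ c, g (mix ∅ c) * resampleDiffOn F B j c ∂(Measure.pi fun _ : ι => ρ.prod ρ)
      = ∫ c, g (mix ∅ c) * (F (mix ∅ c) - F (mix Finset.univ c))
        ∂(Measure.pi fun _ : ι => ρ.prod ρ) := by
    -- Pointwise telescoping from the original sample to the copy. After integration the far end
    -- gives the product of the means, by independence.
    have h3 : ∀ c : ι → S × S, g (mix ∅ c) * (F (mix ∅ c) - F (mix Finset.univ c))
        = ∑ B : Finset ι, sizeWeight (Fintype.card ι) B.card *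
          ∑ j, g (mix ∅ c) * resampleDiffOn F B j c := by
      intro c
      rw [← sum_sizeWeight_mul_sub (fun B => F (mix B c)), Finset.mul_sum]
      refine Finset.sum_congr rfl fun B _ => ?_
      rw [← Finset.mul_sum]
      simp only [resampleDiffOn]
      ring
    simp only [h3]
    rw [integral_finsetSum]
    · refine Finset.sum_congr rfl fun B _ => ?_
      rw [integral_const_mul, integral_finsetSum _ fun j _ => hi B j]
    · exact fun B _ => (integrable_finsetSum _ fun j _ => hi B j).const_mul _
  rw [h2]
  simp only [mul_sub]
  rw [integral_sub, integral_mul_mix_univ ρ hg.1 hF.1]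
  · rw [← integral_comp_of_measurePreserving (measurePreserving_mix ρ (∅ : Finset ι))
      (g := fun x => g x * F x) (hg.1.mul hF.1)]
  · exact (memLp_comp_mix ρ hg ∅).integrable_mul (memLp_comp_mix ρ hF ∅)
  · exact (memLp_comp_mix ρ hg ∅).integrable_mul (memLp_comp_mix ρ hF Finset.univ)

lemma integral_comp_resampleDiffOn {F : (ι → S) → ℝ} (hF : Measurable F) {G : ℝ → ℝ}
    (hG : Measurable G) (B : Finset ι) (j : ι) :
    ∫ c, G (resampleDiffOn F B j c) ∂(Measure.pi fun _ : ι => ρ.prod ρ)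
      = ∫ c, G (resampleDiff F j c) ∂(Measure.pi fun _ : ι => ρ.prod ρ) := by
  simp only [resampleDiffOn_eq_swapOn]
  refine integral_comp_of_measurePreserving (measurePreserving_swapOn ρ _)
    (g := fun c => G (resampleDiff F j c)) ?_
  refine (hG.comp ?_).aestronglyMeasurable
  exact (hF.comp (measurable_mix _)).sub (hF.comp (measurable_mix _))

/-- The Efron-Stein inequality. -/
theorem efron_stein {F : (ι → S) → ℝ} (hFm : Measurable F)
    (hF : MemLp F 2 (Measure.pi fun _ : ι => ρ)) :
    Var[F; Measure.pi fun _ : ι => ρ]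
      ≤ 1 / 2 * ∑ j, ∫ c, resampleDiff F j c ^ 2 ∂(Measure.pi fun _ : ι => ρ.prod ρ) := by
  have hcov := covariance_eq_sum ρ hF hF
  have hvar : Var[F; Measure.pi fun _ : ι => ρ] = (∫ x, F x * F x ∂(Measure.pi fun _ : ι => ρ))
        - (∫ x, F x ∂(Measure.pi fun _ : ι => ρ)) * ∫ x, F x ∂(Measure.pi fun _ : ι => ρ) := by
    rw [variance_eq_sub hF]
    simp [sq]
  rw [hvar, hcov]
  have hj : ∀ B j, ∫ c, resampleDiff F j c * resampleDiffOn F B j c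
      ∂(Measure.pi fun _ : ι => ρ.prod ρ)
      ≤ ∫ c, resampleDiff F j c ^ 2 ∂(Measure.pi fun _ : ι => ρ.prod ρ) := by
    intro B j
    have i1 := (memLp_resampleDiff ρ hF j).integrable_sq
    have i2 := (memLp_resampleDiffOn ρ hF B j).integrable_sq
    -- By uv ≤ (u² + v²)/2 and equality in law of the two differences, the dependence on B
    -- disappears.
    calc _ ≤ ∫ c, (resampleDiff F j c ^ 2 + resampleDiffOn F B j c ^ 2) / 2
          ∂(Measure.pi fun _ : ι => ρ.prod ρ) := by
          refine integral_mono ((memLp_resampleDiff ρ hF j).integrable_mul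
            (memLp_resampleDiffOn ρ hF B j)) ((i1.add i2).div_const 2) fun c => ?_
          simp only
          nlinarith [sq_nonneg (resampleDiff F j c - resampleDiffOn F B j c)]
      _ = _ := by
          rw [integral_div, integral_add i1 i2,
            integral_comp_resampleDiffOn ρ hFm (G := fun t => t ^ 2) (by fun_prop)]
          ring
  calc _ ≤ ∑ B : Finset ι, sizeWeight (Fintype.card ι) B.card *
          ∑ j, (1 / 2) * ∫ c, resampleDiff F j c ^ 2 ∂(Measure.pi fun _ : ι => ρ.prod ρ) := by
        refine Finset.sum_le_sum fun B _ => mul_le_mul_of_nonneg_left ?_ (sizeWeight_nonneg _ _)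
        exact Finset.sum_le_sum fun j _ => mul_le_mul_of_nonneg_left (hj B j) (by norm_num)
    _ = _ := by
        rw [← Finset.sum_mul, sum_sizeWeight, one_mul, Finset.mul_sum]

end Covariance

/-! ### Normal approximation by resampling -/

section NormalApprox

variable {ι : Type*} [DecidableEq ι] [Fintype ι] {S : Type*} [MeasurableSpace S]

/-- The random variable whose fluctuations control the distance of `F` to normality. -/
noncomputable def resampleCov (F : (ι → S) → ℝ) (B : Finset ι) (c : ι → S × S) : ℝ :=
  1 / 2 * ∑ j, resampleDiff F j c * resampleDiffOn F B j c

lemma measurable_resampleDiff {F : (ι → S) → ℝ} (hF : Measurable F) (j : ι) :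
    Measurable (resampleDiff F j) :=
  (hF.comp (measurable_mix _)).sub (hF.comp (measurable_mix _))

lemma measurable_resampleDiffOn {F : (ι → S) → ℝ} (hF : Measurable F) (B : Finset ι) (j : ι) :
    Measurable (resampleDiffOn F B j) :=
  (hF.comp (measurable_mix _)).sub (hF.comp (measurable_mix _))

lemma measurable_resampleCov {F : (ι → S) → ℝ} (hF : Measurable F) (B : Finset ι) :
    Measurable (resampleCov F B) :=
  (Finset.measurable_fun_sum _ fun j _ =>
    (measurable_resampleDiff hF j).mul (measurable_resampleDiffOn hF B j)).const_mul _

lemma MeasureTheory.MemLp.mul_of_four {α : Type*} [MeasurableSpace α] {μ : Measure α}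
    {f g : α → ℝ} (hf : MemLp f 4 μ) (hg : MemLp g 4 μ) : MemLp (fun x => f x * g x) 2 μ := by
  have : ENNReal.HolderTriple 4 4 2 := ⟨by
    rw [← ENNReal.toReal_eq_toReal_iff' (by simp) (by simp),
      ENNReal.toReal_add (by simp) (by simp)]
    simp only [ENNReal.toReal_inv, ENNReal.toReal_ofNat]
    norm_num⟩
  exact hg.mul hf

/-- This is Jensen's inequality, obtained from the nonnegative variance of the absolute deviation.
-/
lemma integral_abs_sub_integral_le_sqrt_variance {α : Type*} [MeasurableSpace α] {μ : Measure α}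
    [IsProbabilityMeasure μ] {f : α → ℝ} (hf : MemLp f 2 μ) :
    ∫ x, |f x - ∫ y, f y ∂μ| ∂μ ≤ √(Var[f; μ]) := by
  have h1 : MemLp (fun x => |f x - ∫ y, f y ∂μ|) 2 μ :=
    (hf.sub (memLp_const _)).abs
  have h2 := variance_nonneg (fun x => |f x - ∫ y, f y ∂μ|) μ
  rw [variance_eq_sub h1] at h2
  refine Real.le_sqrt_of_sq_le ?_
  rw [variance_eq_integral hf.1.aemeasurable]
  simp only [Pi.pow_apply, sq_abs] at h2
  linarith

variable (ρ : Measure S) [IsProbabilityMeasure ρ]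

lemma memLp_resampleCov {F : (ι → S) → ℝ} (hF : MemLp F 4 (Measure.pi fun _ : ι => ρ))
    (B : Finset ι) : MemLp (resampleCov F B) 2 (Measure.pi fun _ : ι => ρ.prod ρ) := by
  unfold resampleCov
  refine MemLp.const_mul ?_ _
  exact memLp_finsetSum _ fun j _ =>
    (memLp_resampleDiff ρ hF j).mul_of_four (memLp_resampleDiffOn ρ hF B j)

/-- Normal approximation for a standardized function of i.i.d. random variables. -/
theorem wassersteinDist_map_le {F : (ι → S) → ℝ} (hFm : Measurable F)
    (hF : MemLp F 4 (Measure.pi fun _ : ι => ρ))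
    (h0 : ∫ x, F x ∂(Measure.pi fun _ : ι => ρ) = 0)
    (h1 : ∫ x, F x * F x ∂(Measure.pi fun _ : ι => ρ) = 1) {V R : ℝ}
    (hV : ∀ B, Var[resampleCov F B; Measure.pi fun _ : ι => ρ.prod ρ] ≤ V)
    (hR : ∑ j, ∫ c, |resampleDiff F j c| ^ 3 ∂(Measure.pi fun _ : ι => ρ.prod ρ) ≤ R) :
    wassersteinDist ((Measure.pi fun _ : ι => ρ).map F) (gaussianReal 0 1)
      ≤ ENNReal.ofReal (12 * √V + 6 * R) := by
  set ν := Measure.pi fun _ : ι => ρ with hν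
  set Q := Measure.pi fun _ : ι => ρ.prod ρ with hQ
  have : IsProbabilityMeasure (ν.map F) := Measure.isProbabilityMeasure_map hFm.aemeasurable
  have hF2 : MemLp F 2 ν := hF.mono_exponent (by norm_num)
  have hF1 : Integrable F ν := hF.integrable (by norm_num)
  refine wassersteinDist_gaussian_le
    ((integrable_map_measure (by fun_prop) hFm.aemeasurable).2 hF1) ?_
  intro φ φ' hd hb hb' hlip
  have hφc : Continuous φ := continuous_iff_continuousAt.2 fun x => (hd x).continuousAt
  have hφ'c : Continuous φ' := by
    have : LipschitzWith 12 φ' := LipschitzWith.of_dist_le_mul fun x y => by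
      simpa [Real.dist_eq] using hlip x y
    exact this.continuous
  have hgm : Measurable (fun x => φ (F x)) := hφc.measurable.comp hFm
  have hg'm : Measurable (fun x => φ' (F x)) := hφ'c.measurable.comp hFm
  have hg : MemLp (fun x => φ (F x)) 2 ν :=
    MemLp.of_bound hgm.aestronglyMeasurable 3 (ae_of_all _ fun x => hb _)
  have hu := memLp_resampleDiff ρ hF
  have hv := memLp_resampleDiffOn ρ hF
  have hT := memLp_resampleCov ρ hF
  set w := sizeWeight (Fintype.card ι) with hw
  have hcov := covariance_eq_sum ρ hg hF2
  have hvar := covariance_eq_sum ρ hF2 hF2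
  rw [← hν, ← hQ, ← hw, h0, mul_zero, sub_zero] at hcov hvar
  rw [h1] at hvar
  have hTi : ∀ B, ∫ c, resampleCov F B c ∂Q
      = ∑ j, (1 / 2) * ∫ c, resampleDiff F j c * resampleDiffOn F B j c ∂Q := by
    intro B
    unfold resampleCov
    rw [integral_const_mul, integral_finsetSum _ fun j _ =>
      ((hu j).mul_of_four (hv B j)).integrable (by norm_num), Finset.mul_sum]
  -- The covariance formula for F with itself. It lets φ'(F) be multiplied by the weighted mean of
  -- the E[T_B] and compared with φ'(F) T_B separately for each B.
  have hsum1 : ∑ B : Finset ι, w B.card * ∫ c, resampleCov F B c ∂Q = 1 := by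
    rw [hvar]
    exact Finset.sum_congr rfl fun B _ => by rw [hTi]
  set ψ : (ι → S × S) → ℝ := fun c => φ' (F (mix ∅ c)) with hψ
  have hψm : Measurable ψ := hg'm.comp (measurable_mix _)
  have hψb : ∀ c, |ψ c| ≤ 12 := fun c => hb' _
  have hψT : ∀ B, Integrable (fun c => ψ c * resampleCov F B c) Q := fun B =>
    ((hT B).integrable (by norm_num)).bdd_mul hψm.aestronglyMeasurable (ae_of_all _ hψb)
  have hψi : Integrable ψ Q :=
    Integrable.of_bound hψm.aestronglyMeasurable 12 (ae_of_all _ hψb)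
  have hu3 : ∀ j, Integrable (fun c => |resampleDiff F j c| ^ 3) Q := fun j =>
    ((hu j).mono_exponent (p := 3) (by norm_num)).integrable_norm_pow (by norm_num)
  have hv3 : ∀ B j, Integrable (fun c => |resampleDiffOn F B j c| ^ 3) Q := fun B j =>
    ((hv B j).mono_exponent (p := 3) (by norm_num)).integrable_norm_pow (by norm_num)
  have hgu := memLp_resampleDiff ρ hg
  have taylor : ∀ a b : ℝ, |φ a - φ b - φ' a * (a - b)| ≤ 12 * |a - b| ^ 2 := by
    intro a b
    rcases eq_or_ne a b with rfl | hab
    · simp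
    obtain ⟨ξ, hξ, hξ'⟩ : ∃ ξ, |ξ - a| ≤ |a - b| ∧ φ a - φ b = φ' ξ * (a - b) := by
      rcases lt_or_gt_of_ne hab with h | h
      · obtain ⟨ξ, hξ, h2⟩ := exists_hasDerivAt_eq_slope φ φ' h
          (hφc.continuousOn) (fun x _ => hd x)
        refine ⟨ξ, ?_, ?_⟩
        · rw [abs_of_nonneg (by linarith [hξ.1]), abs_of_neg (by linarith)]
          linarith [hξ.2]
        · rw [h2]
          have : b - a ≠ 0 := by linarith [h] |> fun h : 0 < b - a => h.ne'
          field_simp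
          ring
      · obtain ⟨ξ, hξ, h2⟩ := exists_hasDerivAt_eq_slope φ φ' h
          (hφc.continuousOn) (fun x _ => hd x)
        refine ⟨ξ, ?_, ?_⟩
        · rw [abs_of_nonpos (by linarith [hξ.2]), abs_of_pos (by linarith)]
          linarith [hξ.1]
        · rw [h2]
          have : a - b ≠ 0 := sub_ne_zero.2 hab
          field_simp
    rw [hξ', ← sub_mul, abs_mul, sq, ← mul_assoc]
    gcongr
    exact (hlip ξ a).trans (by gcongr)
  -- The Taylor remainder leaves 12 |Δ_j F|² |Δ_j^B F|. Young's inequality u²v ≤ (2u³ + v³)/3 and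
  -- equality in law turn this into a third moment of `resampleDiff` alone.
  have hpair : ∀ B j, |∫ c, resampleDiff (fun x => φ (F x)) j c * resampleDiffOn F B j c ∂Q
      - ∫ c, ψ c * (resampleDiff F j c * resampleDiffOn F B j c) ∂Q|
      ≤ 12 * ∫ c, |resampleDiff F j c| ^ 3 ∂Q := by
    intro B j
    have i1 : Integrable (fun c => resampleDiff (fun x => φ (F x)) j c * resampleDiffOn F B j c) Q :=
      (hgu j).integrable_mul ((hv B j).mono_exponent (p := 2) (by norm_num))
    have i2 : Integrable (fun c => ψ c * (resampleDiff F j c * resampleDiffOn F B j c)) Q :=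
      (((hu j).mul_of_four (hv B j)).integrable (by norm_num)).bdd_mul
        hψm.aestronglyMeasurable (ae_of_all _ hψb)
    rw [← integral_sub i1 i2]
    calc _ ≤ ∫ c, |resampleDiff (fun x => φ (F x)) j c * resampleDiffOn F B j c
            - ψ c * (resampleDiff F j c * resampleDiffOn F B j c)| ∂Q :=
          abs_integral_le_integral_abs
      _ ≤ ∫ c, 12 * ((2 * |resampleDiff F j c| ^ 3 + |resampleDiffOn F B j c| ^ 3) / 3) ∂Q := by
          refine integral_mono (i1.sub i2).abs
            (((((hu3 j).const_mul 2).add (hv3 B j)).div_const 3).const_mul 12) fun c => ?_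
          simp only
          rw [← mul_assoc, ← sub_mul, abs_mul]
          have ht := taylor (F (mix ∅ c)) (F (mix {j} c))
          have hy : |resampleDiff F j c| ^ 2 * |resampleDiffOn F B j c|
              ≤ (2 * |resampleDiff F j c| ^ 3 + |resampleDiffOn F B j c| ^ 3) / 3 := by
            have ha := abs_nonneg (resampleDiff F j c)
            have hb := abs_nonneg (resampleDiffOn F B j c)
            nlinarith [mul_nonneg ha (sq_nonneg (|resampleDiff F j c| - |resampleDiffOn F B j c|)),
              mul_nonneg hb (sq_nonneg (|resampleDiff F j c| - |resampleDiffOn F B j c|))]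
          calc _ ≤ 12 * |resampleDiff F j c| ^ 2 * |resampleDiffOn F B j c| :=
                mul_le_mul_of_nonneg_right ht (abs_nonneg _)
            _ ≤ _ := by rw [mul_assoc]; gcongr
      _ = _ := by
          rw [integral_const_mul, integral_div, integral_add ((hu3 j).const_mul 2) (hv3 B j),
            integral_const_mul,
            integral_comp_resampleDiffOn ρ hFm (G := fun t => |t| ^ 3) (by fun_prop)]
          ring
  have hB : ∀ B, |(∑ j, (1 / 2) * ∫ c, resampleDiff (fun x => φ (F x)) j c * resampleDiffOn F B j c ∂Q)
      - ∫ c, ψ c * resampleCov F B c ∂Q| ≤ 6 * R := by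
    intro B
    have e1 : ∫ c, ψ c * resampleCov F B c ∂Q
        = ∑ j, (1 / 2) * ∫ c, ψ c * (resampleDiff F j c * resampleDiffOn F B j c) ∂Q := by
      have : ∀ c, ψ c * resampleCov F B c
          = ∑ j, (1 / 2) * (ψ c * (resampleDiff F j c * resampleDiffOn F B j c)) := by
        intro c
        unfold resampleCov
        rw [Finset.mul_sum, Finset.mul_sum]
        exact Finset.sum_congr rfl fun j _ => by ring
      simp only [this]
      rw [integral_finsetSum]
      · exact Finset.sum_congr rfl fun j _ => integral_const_mul _ _
      · intro j _
        exact ((((hu j).mul_of_four (hv B j)).integrable (by norm_num)).bdd_mul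
          hψm.aestronglyMeasurable (ae_of_all _ hψb)).const_mul _
    rw [e1, ← Finset.sum_sub_distrib]
    calc _ ≤ ∑ j, 6 * ∫ c, |resampleDiff F j c| ^ 3 ∂Q := by
          refine (Finset.abs_sum_le_sum_abs _ _).trans (Finset.sum_le_sum fun j _ => ?_)
          rw [← mul_sub, abs_mul, abs_of_pos (by norm_num : (0 : ℝ) < 1 / 2)]
          linarith [hpair B j]
      _ ≤ 6 * R := by rw [← Finset.mul_sum]; linarith
  -- The expectation of |T_B - E T_B| is at most the standard deviation, and |ψ| ≤ 12.
  have hfluct : ∀ B, |∫ c, ψ c * (∫ c', resampleCov F B c' ∂Q) ∂Q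
      - ∫ c, ψ c * resampleCov F B c ∂Q| ≤ 12 * √V := by
    intro B
    rw [← integral_sub (hψi.mul_const _) (hψT B)]
    have hTi := (hT B).integrable (q := 2) (by norm_num)
    calc _ ≤ ∫ c, |ψ c * (∫ c', resampleCov F B c' ∂Q) - ψ c * resampleCov F B c| ∂Q :=
          abs_integral_le_integral_abs
      _ ≤ ∫ c, 12 * |resampleCov F B c - ∫ c', resampleCov F B c' ∂Q| ∂Q := by
          refine integral_mono ((hψi.mul_const _).sub (hψT B)).abs
            (((hTi.sub (integrable_const _)).abs).const_mul _) fun c => ?_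
          simp only
          rw [← mul_sub, abs_mul, abs_sub_comm]
          gcongr
          exact hψb c
      _ ≤ 12 * √V := by
          rw [integral_const_mul]
          have := integral_abs_sub_integral_le_sqrt_variance (hT B)
          have h2 := Real.sqrt_le_sqrt (hV B)
          linarith
  have hmap : ∫ x, (φ' x - x * φ x) ∂(ν.map F)
      = (∫ c, ψ c ∂Q) - ∫ x, φ (F x) * F x ∂ν := by
    rw [integral_map hFm.aemeasurable
      (f := fun x => φ' x - x * φ x) (hφ'c.sub (continuous_id.mul hφc)).aestronglyMeasurable]
    have e1 : ∫ c, ψ c ∂Q = ∫ x, φ' (F x) ∂ν :=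
      integral_comp_of_measurePreserving (measurePreserving_mix ρ (∅ : Finset ι))
        (g := fun x => φ' (F x)) hg'm.aestronglyMeasurable
    rw [e1, ← integral_sub]
    · exact integral_congr_ae (ae_of_all _ fun x => by simp only; ring)
    · exact Integrable.of_bound hg'm.aestronglyMeasurable 12 (ae_of_all _ fun x => hb' _)
    · exact hg.integrable_mul hF2
  have hψ1 : ∫ c, ψ c ∂Q
      = ∑ B : Finset ι, w B.card * ∫ c, ψ c * (∫ c', resampleCov F B c' ∂Q) ∂Q := by
    calc ∫ c, ψ c ∂Q = (∑ B : Finset ι, w B.card * ∫ c, resampleCov F B c ∂Q) * ∫ c, ψ c ∂Q := by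
          rw [hsum1, one_mul]
      _ = _ := by
          rw [Finset.sum_mul]
          refine Finset.sum_congr rfl fun B _ => ?_
          rw [integral_mul_const]
          ring
  rw [hmap, hcov, hψ1, ← Finset.sum_sub_distrib]
  calc _ ≤ ∑ B : Finset ι, w B.card * (12 * √V + 6 * R) := by
        refine (Finset.abs_sum_le_sum_abs _ _).trans (Finset.sum_le_sum fun B _ => ?_)
        rw [← mul_sub, abs_mul, abs_of_nonneg (sizeWeight_nonneg _ _)]
        refine mul_le_mul_of_nonneg_left ?_ (sizeWeight_nonneg _ _)
        have a1 := abs_le.1 (hB B)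
        have a2 := abs_le.1 (hfluct B)
        rw [abs_le]
        constructor <;> linarith [a1.1, a1.2, a2.1, a2.2]
    _ = 12 * √V + 6 * R := by rw [← Finset.sum_mul, sum_sizeWeight, one_mul]

/-- Normal approximation for a function of i.i.d. random variables, by means of bounds for the
variances of `resampleCov` and for the third moments of `resampleDiff`. -/
theorem distToNormal_le {F : (ι → S) → ℝ} (hFm : Measurable F)
    (hF : MemLp F 4 (Measure.pi fun _ : ι => ρ)) {σ : ℝ} (hσ : 0 < σ)
    (hσF : σ = √(Var[F; Measure.pi fun _ : ι => ρ])) {V R : ℝ}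
    (hV : ∀ B, Var[resampleCov F B; Measure.pi fun _ : ι => ρ.prod ρ] ≤ V)
    (hR : ∑ j, ∫ c, |resampleDiff F j c| ^ 3 ∂(Measure.pi fun _ : ι => ρ.prod ρ) ≤ R) :
    distToNormal (Measure.pi fun _ : ι => ρ) F
      ≤ ENNReal.ofReal (12 * √V / σ ^ 2 + 6 * R / σ ^ 3) := by
  set ν := Measure.pi fun _ : ι => ρ with hν
  set Q := Measure.pi fun _ : ι => ρ.prod ρ with hQ
  set e := ∫ x, F x ∂ν with he
  have hF2 : MemLp F 2 ν := hF.mono_exponent (by norm_num)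
  have hF1 : Integrable F ν := hF.integrable (by norm_num)
  have hσ2 : Var[F; ν] = σ ^ 2 := by rw [hσF, Real.sq_sqrt (variance_nonneg _ _)]
  set G : (ι → S) → ℝ := fun x => (F x - e) / σ with hG
  have hu : ∀ j c, resampleDiff G j c = resampleDiff F j c / σ := by
    intro j c; simp only [resampleDiff, hG]; ring
  have hv : ∀ B j c, resampleDiffOn G B j c = resampleDiffOn F B j c / σ := by
    intro B j c; simp only [resampleDiffOn, hG]; ring
  -- T_B is quadratic in F, so standardizing divides its variance by σ⁴; the third moments are
  -- divided by σ³.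
  have hT : ∀ B, resampleCov G B = fun c => (1 / σ ^ 2) * resampleCov F B c := by
    intro B; funext c
    simp only [resampleCov, hu, hv]
    rw [← mul_assoc, Finset.mul_sum, Finset.mul_sum]
    exact Finset.sum_congr rfl fun j _ => by field_simp
  unfold distToNormal
  rw [← hσF]
  have key := wassersteinDist_map_le ρ (F := G) ((hFm.sub_const e).div_const σ)
    ?_ ?_ ?_ (V := V / σ ^ 4) (R := R / σ ^ 3) ?_ ?_
  · refine key.trans (ENNReal.ofReal_le_ofReal ?_)
    rw [Real.sqrt_div' _ (by positivity), show σ ^ 4 = (σ ^ 2) ^ 2 by ring,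
      Real.sqrt_sq (by positivity)]
    exact le_of_eq (by ring)
  · have := (hF.sub (memLp_const e)).const_mul (1 / σ)
    refine this.congr_norm ((hFm.sub_const e).div_const σ).aestronglyMeasurable
      (ae_of_all _ fun x => ?_)
    simp only [hG, Pi.sub_apply]
    congr 1
    ring
  · simp only [hG]
    rw [integral_div, integral_sub hF1 (integrable_const _)]
    simp [he, hν]
  · have : ∀ x, G x * G x = (1 / σ ^ 2) * (F x - e) ^ 2 := by
      intro x; simp only [hG]; field_simp
    simp only [this]
    rw [integral_const_mul, ← variance_eq_integral hFm.aemeasurable, ← hν, hσ2]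
    field_simp
  · intro B
    rw [hT, variance_const_mul]
    calc _ ≤ (1 / σ ^ 2) ^ 2 * V := by gcongr; exact hV B
      _ = V / σ ^ 4 := by field_simp
  · simp only [hu, abs_div, div_pow, integral_div, abs_of_pos hσ]
    rw [← Finset.sum_div]
    gcongr

end NormalApprox

/-! ### The geometry of nearest neighbors -/

section Nearest

variable {n d k : ℕ} {r : EuclideanSpace ℝ (Fin d) → EuclideanSpace ℝ (Fin d) → Prop}
  {x y : Fin n → EuclideanSpace ℝ (Fin d)} {i j ℓ m : Fin n}

open scoped Classical in
/-- The number of points that are nearer to `x ℓ` than `x j`. -/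
noncomputable def nearRank (r : EuclideanSpace ℝ (Fin d) → EuclideanSpace ℝ (Fin d) → Prop)
    (x : Fin n → EuclideanSpace ℝ (Fin d)) (ℓ j : Fin n) : ℕ :=
  (Finset.univ.filter fun m => m ≠ ℓ ∧ Nearer r (x ℓ) (x m) (x j)).card

lemma mem_kNearest : j ∈ kNearest r k x ℓ ↔ j ≠ ℓ ∧ nearRank r x ℓ j < k := by
  simp [kNearest, nearRank]

lemma kNearest_mono {k' : ℕ} (h : k ≤ k') (hj : j ∈ kNearest r k x ℓ) : j ∈ kNearest r k' x ℓ := by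
  rw [mem_kNearest] at hj ⊢
  exact ⟨hj.1, hj.2.trans_le h⟩

lemma Nearer.trans [IsStrictTotalOrder (EuclideanSpace ℝ (Fin d)) r]
    {c p q s : EuclideanSpace ℝ (Fin d)} (h1 : Nearer r c p q) (h2 : Nearer r c q s) :
    Nearer r c p s := by
  rcases h1 with h1 | ⟨h1, h1'⟩ <;> rcases h2 with h2 | ⟨h2, h2'⟩
  · exact Or.inl (h1.trans h2)
  · exact Or.inl (h2 ▸ h1)
  · exact Or.inl (h1 ▸ h2)
  · exact Or.inr ⟨h1.trans h2, trans_of r h1' h2'⟩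

lemma Nearer.irrefl [IsStrictTotalOrder (EuclideanSpace ℝ (Fin d)) r]
    (c p : EuclideanSpace ℝ (Fin d)) : ¬ Nearer r c p p := by
  rintro (h | ⟨_, h⟩)
  · exact lt_irrefl _ h
  · exact irrefl_of r _ h

lemma Nearer.total [IsStrictTotalOrder (EuclideanSpace ℝ (Fin d)) r]
    {c p q : EuclideanSpace ℝ (Fin d)} (h : p ≠ q) : Nearer r c p q ∨ Nearer r c q p := by
  rcases lt_trichotomy ‖c - p‖ ‖c - q‖ with h1 | h1 | h1
  · exact Or.inl (Or.inl h1)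
  · rcases trichotomous_of r p q with h2 | h2 | h2
    · exact Or.inl (Or.inr ⟨h1, h2⟩)
    · exact absurd h2 h
    · exact Or.inr (Or.inr ⟨h1.symm, h2⟩)
  · exact Or.inr (Or.inl h1)

lemma nearRank_lt [IsStrictTotalOrder (EuclideanSpace ℝ (Fin d)) r] (hi : i ≠ ℓ)
    (h : Nearer r (x ℓ) (x i) (x j)) : nearRank r x ℓ i < nearRank r x ℓ j := by
  classical
  refine Finset.card_lt_card ⟨fun m hm => ?_, fun hs => ?_⟩
  · simp only [Finset.mem_filter, Finset.mem_univ, true_and] at hm ⊢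
    exact ⟨hm.1, hm.2.trans h⟩
  · have : i ∈ Finset.univ.filter fun m => m ≠ ℓ ∧ Nearer r (x ℓ) (x m) (x i) :=
      hs (by simp [hi, h])
    simp only [Finset.mem_filter] at this
    exact Nearer.irrefl _ _ this.2.2

/-- For distinct points the tie-breaking order makes ranks distinct, so the neighbors inject into
{0, …, k - 1}. -/
lemma card_kNearest_le [IsStrictTotalOrder (EuclideanSpace ℝ (Fin d)) r]
    (hx : Function.Injective x) : (kNearest r k x ℓ).card ≤ k := by
  classical
  rw [← Finset.card_range k]
  refine Finset.card_le_card_of_injOn (fun j => nearRank r x ℓ j)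
    (fun j hj => by simpa using (mem_kNearest.1 hj).2) ?_
  intro i hi j hj hij
  by_contra hne
  rcases Nearer.total (r := r) (c := x ℓ) (hx.ne hne) with h | h
  · exact (nearRank_lt (mem_kNearest.1 hi).1 h).ne hij
  · exact (nearRank_lt (mem_kNearest.1 hj).1 h).ne' hij

/-- Two vectors within 30° of v make an angle of at most 60°. The components along v have product at
least (3/4)‖a‖‖b‖, and those orthogonal to v have norms at most ‖a‖/2 and ‖b‖/2, so they cost at
most (1/4)‖a‖‖b‖. -/
lemma inner_ge_of_mem_cone60 {v a b : EuclideanSpace ℝ (Fin d)} (hv : ‖v‖ = 1)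
    (ha : a ∈ cone60 v) (hb : b ∈ cone60 v) : ‖a‖ * ‖b‖ / 2 ≤ inner ℝ a b := by
  simp only [cone60, mem_ofPred_eq, Real.cos_pi_div_six] at ha hb
  set s := inner ℝ v a with hs
  set t := inner ℝ v b with ht
  have h3 : √3 * √3 = (3 : ℝ) := Real.mul_self_sqrt (by norm_num)
  have h0 : 0 < √(3 : ℝ) := by positivity
  have na := norm_nonneg a
  have nb := norm_nonneg b
  have hvv : inner ℝ v v = (1 : ℝ) := by rw [real_inner_self_eq_norm_sq, hv]; norm_num
  have hav : inner ℝ a v = s := real_inner_comm _ _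
  have e1 : inner ℝ (a - s • v) (b - t • v) = inner ℝ a b - s * t := by
    simp only [inner_sub_left, inner_sub_right, real_inner_smul_left, real_inner_smul_right, hvv,
      hav, ← ht]
    ring
  have sq1 : ‖a - s • v‖ ^ 2 = ‖a‖ ^ 2 - s ^ 2 := by
    rw [norm_sub_sq_real, real_inner_smul_right, hav, norm_smul, hv, Real.norm_eq_abs, mul_one,
      sq_abs]
    ring
  have sq2 : ‖b - t • v‖ ^ 2 = ‖b‖ ^ 2 - t ^ 2 := by
    rw [norm_sub_sq_real, real_inner_smul_right, real_inner_comm, ← ht, norm_smul, hv,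
      Real.norm_eq_abs, mul_one, sq_abs]
    ring
  have n1 : ‖a - s • v‖ ≤ ‖a‖ / 2 := by
    refine abs_le_of_sq_le_sq' ?_ (by positivity) |>.2
    rw [sq1]
    nlinarith [mul_self_le_mul_self (by positivity) ha]
  have n2 : ‖b - t • v‖ ≤ ‖b‖ / 2 := by
    refine abs_le_of_sq_le_sq' ?_ (by positivity) |>.2
    rw [sq2]
    nlinarith [mul_self_le_mul_self (by positivity) hb]
  have h5 := (abs_le.1 (abs_real_inner_le_norm (a - s • v) (b - t • v))).1
  have h6 : ‖a - s • v‖ * ‖b - t • v‖ ≤ (‖a‖ / 2) * (‖b‖ / 2) := by gcongr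
  have h7 : (√3 / 2 * ‖a‖) * (√3 / 2 * ‖b‖) ≤ s * t :=
    mul_le_mul ha hb (by positivity) (le_trans (by positivity) ha)
  have h8 : (√3 / 2 * ‖a‖) * (√3 / 2 * ‖b‖) = 3 / 4 * (‖a‖ * ‖b‖) := by
    linear_combination (‖a‖ * ‖b‖ / 4) * h3
  nlinarith

/-- In a triangle with an angle of at most 60° at the origin, the opposite side is shorter than the
longest leg unless the triangle is equilateral. As the cones are closed, this can occur, but then v
bisects the angle and a is determined by b and v. -/
lemma norm_sub_lt_or_eq_of_mem_cone60 {v a b : EuclideanSpace ℝ (Fin d)} (hv : ‖v‖ = 1)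
    (ha : a ∈ cone60 v) (hb : b ∈ cone60 v) (h0 : a ≠ 0) (hab : ‖a‖ ≤ ‖b‖) :
    ‖b - a‖ < ‖b‖ ∨ a = (√3 * ‖b‖) • v - b := by
  have hin := inner_ge_of_mem_cone60 hv ha hb
  have na : 0 < ‖a‖ := norm_pos_iff.2 h0
  rw [or_iff_not_imp_left, not_lt]
  intro hle
  have hsq : ‖b - a‖ ^ 2 = ‖b‖ ^ 2 - 2 * inner ℝ a b + ‖a‖ ^ 2 := by
    rw [norm_sub_sq_real, real_inner_comm]
  have hge : ‖b‖ ^ 2 ≤ ‖b - a‖ ^ 2 := by gcongr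
  have heq : ‖a‖ = ‖b‖ := le_antisymm hab (by nlinarith)
  have hin2 : inner ℝ a b = ‖b‖ ^ 2 / 2 := by rw [heq] at hin hsq; nlinarith
  simp only [cone60, mem_ofPred_eq, Real.cos_pi_div_six] at ha hb
  have h3 : √3 * √3 = (3 : ℝ) := Real.mul_self_sqrt (by norm_num)
  have hz : ‖(a + b) - (√3 * ‖b‖) • v‖ ^ 2 ≤ 0 := by
    rw [norm_sub_sq_real, norm_add_sq_real, real_inner_smul_right, norm_smul, hv, mul_one,
      Real.norm_eq_abs, sq_abs, real_inner_comm v, inner_add_right, hin2, heq, mul_pow,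
      Real.sq_sqrt (by norm_num : (0 : ℝ) ≤ 3)]
    rw [heq] at ha
    have : √3 * ‖b‖ * (√3 / 2 * ‖b‖ + √3 / 2 * ‖b‖)
        ≤ √3 * ‖b‖ * (inner ℝ v a + inner ℝ v b) := by gcongr
    nlinarith
  have hz' : (a + b) - (√3 * ‖b‖) • v = 0 := by
    rw [← norm_eq_zero]
    exact pow_eq_zero_iff (two_ne_zero) |>.1 (le_antisymm hz (by positivity))
  rw [eq_sub_iff_add_eq]
  exact sub_eq_zero.1 hz'

/-- In each 60° cone at `x j` there are at most `k + 1` points that have `x j` among their `k`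
nearest neighbors. -/
lemma card_cone_le [IsStrictTotalOrder (EuclideanSpace ℝ (Fin d)) r]
    (hx : Function.Injective x) {v : EuclideanSpace ℝ (Fin d)} (hv : ‖v‖ = 1)
    {A : Finset (Fin n)} (hA : ∀ ℓ ∈ A, j ∈ kNearest r k x ℓ ∧ x ℓ - x j ∈ cone60 v) :
    A.card ≤ k + 1 := by
  classical
  rcases A.eq_empty_or_nonempty with rfl | hne
  · simp
  -- For the point z of A farthest from x j, every other point of A, apart from the equilateral
  -- exception collected in T, is nearer to x z than x j is. There are fewer than k such points, so
  -- A has at most 1 + 1 + (k - 1) elements.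
  obtain ⟨z, hz, hmax⟩ := A.exists_max_image (fun ℓ => ‖x ℓ - x j‖) hne
  set b := x z - x j with hb
  set T := A.filter fun ℓ => x ℓ - x j = (√3 * ‖b‖) • v - b with hT
  have hT1 : T.card ≤ 1 := by
    rw [Finset.card_le_one]
    intro p hp q hq
    have h1 := (Finset.mem_filter.1 hp).2
    have h2 := (Finset.mem_filter.1 hq).2
    exact hx (sub_left_injective (h1.trans h2.symm))
  have hsub : A ⊆ insert z (T ∪ Finset.univ.filter fun m => m ≠ z ∧ Nearer r (x z) (x m) (x j)) := by
    intro ℓ hℓ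
    rw [Finset.mem_insert, Finset.mem_union, Finset.mem_filter, Finset.mem_filter]
    by_cases hℓz : ℓ = z
    · exact Or.inl hℓz
    right
    have hjℓ : j ≠ ℓ := (mem_kNearest.1 (hA ℓ hℓ).1).1
    rcases norm_sub_lt_or_eq_of_mem_cone60 hv (hA ℓ hℓ).2 (hA z hz).2
      (sub_ne_zero.2 (hx.ne hjℓ.symm)) (hmax ℓ hℓ) with h | h
    · right
      refine ⟨Finset.mem_univ _, hℓz, Or.inl ?_⟩
      simpa using h
    · exact Or.inl ⟨hℓ, h⟩
  have hk : nearRank r x z j < k := (mem_kNearest.1 (hA z hz).1).2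
  calc A.card ≤ _ := Finset.card_le_card hsub
    _ ≤ (T ∪ Finset.univ.filter fun m => m ≠ z ∧ Nearer r (x z) (x m) (x j)).card + 1 :=
        Finset.card_insert_le _ _
    _ ≤ T.card + nearRank r x z j + 1 := by
        gcongr
        convert! Finset.card_union_le _ _ using 2
    _ ≤ k + 1 := by omega

/-- `ℝ^d` can be covered by finitely many 60° cones. -/
lemma exists_cone_cover (hd : 1 ≤ d) : ∃ N, ∃ v : Fin N → EuclideanSpace ℝ (Fin d),
    (∀ i, ‖v i‖ = 1) ∧ ∀ y : EuclideanSpace ℝ (Fin d), ∃ i, y ∈ cone60 (v i) := by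
  classical
  have hlt : √3 / 2 < (1 : ℝ) := by
    rw [div_lt_one (by norm_num), Real.sqrt_lt' (by norm_num)]
    norm_num
  obtain ⟨t, ht⟩ := (isCompact_sphere (0 : EuclideanSpace ℝ (Fin d)) 1).elim_finite_subcover
    (fun u : Metric.sphere (0 : EuclideanSpace ℝ (Fin d)) 1 => {y | √3 / 2 < inner ℝ (u : EuclideanSpace ℝ (Fin d)) y})
    (fun u => isOpen_lt continuous_const (by fun_prop)) (fun u hu => by
      have hu1 : ‖u‖ = 1 := by simpa using hu
      refine mem_iUnion.2 ⟨⟨u, hu⟩, ?_⟩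
      simp only [Set.mem_ofPred_eq, real_inner_self_eq_norm_sq, hu1]
      simpa using hlt)
  have unit : ∀ u : EuclideanSpace ℝ (Fin d), ‖u‖ = 1 → ∃ w ∈ t, u ∈ cone60 (w : EuclideanSpace ℝ (Fin d)) := by
    intro u hu
    obtain ⟨w, hw, h⟩ := mem_iUnion₂.1 (ht (by simpa using hu : u ∈ Metric.sphere (0 : EuclideanSpace ℝ (Fin d)) 1))
    refine ⟨w, hw, ?_⟩
    simp only [cone60, mem_ofPred_eq, Real.cos_pi_div_six, hu, mul_one] at h ⊢
    exact h.le
  refine ⟨t.card, fun i => (t.equivFin.symm i : Metric.sphere (0 : EuclideanSpace ℝ (Fin d)) 1),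
    fun i => by simp, fun y => ?_⟩
  have key : ∃ w ∈ t, y ∈ cone60 (w : EuclideanSpace ℝ (Fin d)) := by
    rcases eq_or_ne y 0 with rfl | hy
    -- The origin lies in every cone; a unit vector, available as d ≥ 1, only shows that the cover
    -- has a member.
    · obtain ⟨w, hw, -⟩ := unit (EuclideanSpace.single ⟨0, hd⟩ 1) (by simp)
      exact ⟨w, hw, by simp [cone60]⟩
    · have hn : 0 < ‖y‖ := norm_pos_iff.2 hy
      obtain ⟨w, hw, h⟩ := unit (‖y‖⁻¹ • y) (by rw [norm_smul, norm_inv, norm_norm, inv_mul_cancel₀ hn.ne'])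
      refine ⟨w, hw, ?_⟩
      simp only [cone60, mem_ofPred_eq, norm_smul, norm_inv, norm_norm, real_inner_smul_right,
        inv_mul_cancel₀ hn.ne', mul_one] at h ⊢
      rw [← mul_le_mul_iff_right₀ (inv_pos.2 hn)]
      convert! h using 1
      field_simp
  obtain ⟨w, hw, h⟩ := key
  exact ⟨t.equivFin ⟨w, hw⟩, by simpa using h⟩

/-- As a finite cover exists, the infimum is attained and is not the default value 0 of the infimum
of the empty set. -/
lemma coneCoverNumber_spec (hd : 1 ≤ d) : ∃ v : Fin (coneCoverNumber d) → EuclideanSpace ℝ (Fin d),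
    (∀ i, ‖v i‖ = 1) ∧ ∀ y : EuclideanSpace ℝ (Fin d), ∃ i, y ∈ cone60 (v i) :=
  Nat.sInf_mem (s := {N : ℕ | ∃ v : Fin N → EuclideanSpace ℝ (Fin d),
    (∀ i, ‖v i‖ = 1) ∧ ∀ y : EuclideanSpace ℝ (Fin d), ∃ i, y ∈ cone60 (v i)}) (exists_cone_cover hd)

lemma one_le_coneCoverNumber (hd : 1 ≤ d) : 1 ≤ coneCoverNumber d := by
  obtain ⟨v, -, h⟩ := coneCoverNumber_spec hd
  obtain ⟨i, -⟩ := h 0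
  have := i.2
  omega

open scoped Classical in
/-- A point is among the `k` nearest neighbors of at most `α(d) (k + 1)` other points. -/
lemma card_filter_mem_kNearest_le [IsStrictTotalOrder (EuclideanSpace ℝ (Fin d)) r] (hd : 1 ≤ d)
    (hx : Function.Injective x) (j : Fin n) :
    (Finset.univ.filter fun ℓ => j ∈ kNearest r k x ℓ).card ≤ coneCoverNumber d * (k + 1) := by
  obtain ⟨v, hv, hcov⟩ := coneCoverNumber_spec hd
  have hsub : (Finset.univ.filter fun ℓ => j ∈ kNearest r k x ℓ) ⊆
      Finset.univ.biUnion fun i => Finset.univ.filter fun ℓ =>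
        j ∈ kNearest r k x ℓ ∧ x ℓ - x j ∈ cone60 (v i) := by
    intro ℓ hℓ
    obtain ⟨i, hi⟩ := hcov (x ℓ - x j)
    simp only [Finset.mem_filter, Finset.mem_univ, true_and, Finset.mem_biUnion] at hℓ ⊢
    exact ⟨i, hℓ, hi⟩
  calc _ ≤ _ := Finset.card_le_card hsub
    _ ≤ (Finset.univ : Finset (Fin (coneCoverNumber d))).card * (k + 1) :=
        Finset.card_biUnion_le_card_mul _ _ _ fun i _ =>
          card_cone_le (r := r) (k := k) (j := j) hx (hv i) fun ℓ hℓ => by simpa using hℓ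
    _ = _ := by simp

/-- `x m` is `x ℓ` or one of its `k` nearest neighbors. -/
def IsNear (r : EuclideanSpace ℝ (Fin d) → EuclideanSpace ℝ (Fin d) → Prop) (k : ℕ)
    (x : Fin n → EuclideanSpace ℝ (Fin d)) (ℓ m : Fin n) : Prop :=
  m = ℓ ∨ m ∈ kNearest r k x ℓ

open scoped Classical in
lemma card_filter_isNear_le [IsStrictTotalOrder (EuclideanSpace ℝ (Fin d)) r] (hd : 1 ≤ d)
    (hx : Function.Injective x) (j : Fin n) :
    (Finset.univ.filter fun ℓ => IsNear r k x ℓ j).card ≤ coneCoverNumber d * (k + 2) := by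
  have hsub : (Finset.univ.filter fun ℓ => IsNear r k x ℓ j) ⊆
      insert j (Finset.univ.filter fun ℓ => j ∈ kNearest r k x ℓ) := by
    intro ℓ hℓ
    rw [Finset.mem_filter] at hℓ
    rw [Finset.mem_insert, Finset.mem_filter]
    exact hℓ.2.imp (fun h => h.symm) fun h => ⟨Finset.mem_univ _, h⟩
  have h1 := card_filter_mem_kNearest_le (r := r) (k := k) hd hx j
  have h2 := one_le_coneCoverNumber hd
  calc _ ≤ _ := Finset.card_le_card hsub
    _ ≤ coneCoverNumber d * (k + 1) + 1 := (Finset.card_insert_le _ _).trans (by gcongr)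
    _ ≤ coneCoverNumber d * (k + 2) := by nlinarith

/-- Moving the points with indices in `J` raises the rank of a neighbor by at most `J.card`. -/
lemma kNearest_of_eqOn_compl {J : Finset (Fin n)} (h : ∀ m ∉ J, x m = y m) (hℓ : x ℓ = y ℓ)
    (hj : x j = y j) {K : ℕ} (hK : k + J.card ≤ K) (hjk : j ∈ kNearest r k x ℓ) :
    j ∈ kNearest r K y ℓ := by
  classical
  rw [mem_kNearest] at hjk ⊢
  refine ⟨hjk.1, ?_⟩
  have : nearRank r y ℓ j ≤ nearRank r x ℓ j + J.card := by
    unfold nearRank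
    refine (Finset.card_le_card (t := (Finset.univ.filter fun m => m ≠ ℓ ∧
      Nearer r (x ℓ) (x m) (x j)) ∪ J) fun m hm => ?_).trans (Finset.card_union_le _ _)
    simp only [Finset.mem_filter, Finset.mem_univ, true_and, Finset.mem_union] at hm ⊢
    by_cases hmJ : m ∈ J
    · exact Or.inr hmJ
    · rw [h m hmJ, hℓ, hj]
      exact Or.inl hm
  omega

/-- Moving a point that is not among the nearest neighbors, neither before nor after, does not
change the nearest neighbors. -/
lemma kNearest_congr_of_notMem [IsStrictTotalOrder (EuclideanSpace ℝ (Fin d)) r]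
    (h : ∀ m, m ≠ i → x m = y m) (hℓ : ℓ ≠ i) (hx : i ∉ kNearest r k x ℓ)
    (hy : i ∉ kNearest r k y ℓ) : kNearest r k x ℓ = kNearest r k y ℓ := by
  classical
  have main : ∀ {x y : Fin n → EuclideanSpace ℝ (Fin d)}, (∀ m, m ≠ i → x m = y m) →
      i ∉ kNearest r k x ℓ → i ∉ kNearest r k y ℓ → kNearest r k x ℓ ⊆ kNearest r k y ℓ := by
    intro x y h hx hy j hj
    have hji : j ≠ i := fun hji => hx (hji ▸ hj)
    rw [mem_kNearest] at hj hx hy ⊢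
    refine ⟨hj.1, ?_⟩
    by_contra hge
    rw [not_lt] at hge
    have hyi : k ≤ nearRank r y ℓ i := by
      by_contra hlt
      exact hy ⟨hℓ.symm, not_le.1 hlt⟩
    -- If the moved point i were not nearer than j, the rank of j could not have grown. If it is
    -- nearer, every point preceding i in y also precedes j in x, so i has rank below k and would be
    -- a neighbor in y.
    have hnear : Nearer r (y ℓ) (y i) (y j) := by
      by_contra hnot
      have : nearRank r y ℓ j ≤ nearRank r x ℓ j := by
        refine Finset.card_le_card fun m hm => ?_
        simp only [Finset.mem_filter, Finset.mem_univ, true_and] at hm ⊢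
        have hmi : m ≠ i := by rintro rfl; exact hnot hm.2
        rw [h m hmi, h ℓ hℓ, h j hji]
        exact hm
      omega
    have : nearRank r y ℓ i ≤ nearRank r x ℓ j := by
      refine Finset.card_le_card fun m hm => ?_
      simp only [Finset.mem_filter, Finset.mem_univ, true_and] at hm ⊢
      have hmi : m ≠ i := by rintro rfl; exact Nearer.irrefl _ _ hm.2
      rw [h m hmi, h ℓ hℓ, h j hji]
      exact ⟨hm.1, hm.2.trans hnear⟩
    omega
  exact (main h hx hy).antisymm (main (fun m hm => (h m hm).symm) hy hx)

lemma DependsOnlyOnNearest.eq_of_not_isNear [IsStrictTotalOrder (EuclideanSpace ℝ (Fin d)) r]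
    {g : (Fin n → EuclideanSpace ℝ (Fin d)) → ℝ} (hg : DependsOnlyOnNearest r k ℓ g)
    (h : ∀ m, m ≠ i → x m = y m) (hx : ¬ IsNear r k x ℓ i) (hy : ¬ IsNear r k y ℓ i) :
    g x = g y := by
  have hℓ : ℓ ≠ i := fun hℓ => hx (Or.inl hℓ.symm)
  have hx' : i ∉ kNearest r k x ℓ := fun h => hx (Or.inr h)
  exact hg x y (h ℓ hℓ) (kNearest_congr_of_notMem h hℓ hx' fun h => hy (Or.inr h))
    fun j hj => h j fun hji => hx' (hji ▸ hj)

/-- If the effect on `g` of moving the point `j` is changed by moving the point `i`, then `i` and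
`j` are both near some common point. -/
lemma DependsOnlyOnNearest.exists_isNear_of_ne [IsStrictTotalOrder (EuclideanSpace ℝ (Fin d)) r]
    {g : (Fin n → EuclideanSpace ℝ (Fin d)) → ℝ} (hg : DependsOnlyOnNearest r k ℓ g)
    {Y : Bool → Bool → Fin n → EuclideanSpace ℝ (Fin d)}
    (hi : ∀ s s' t m, m ≠ i → Y s t m = Y s' t m) (hj : ∀ s t t' m, m ≠ j → Y s t m = Y s t' m)
    (hne : g (Y false false) - g (Y false true) ≠ g (Y true false) - g (Y true true)) :
    ∃ s t, (ℓ ≠ j ∧ IsNear r (k + 1) (Y s false) ℓ i ∧ IsNear r (k + 1) (Y s t) ℓ j) ∨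
      IsNear r (k + 1) (Y s t) j i := by
  -- If i is never near ℓ, g does not depend on s and both differences agree; if j is never near ℓ,
  -- both differences vanish.
  have h1 : ∃ s t, IsNear r k (Y s t) ℓ i := by
    by_contra hcon
    push Not at hcon
    exact hne (by rw [hg.eq_of_not_isNear (hi false true false) (hcon _ _) (hcon _ _),
      hg.eq_of_not_isNear (hi false true true) (hcon _ _) (hcon _ _)])
  have h2 : ∃ s t, IsNear r k (Y s t) ℓ j := by
    by_contra hcon
    push Not at hcon
    exact hne (by rw [hg.eq_of_not_isNear (hj false false true) (hcon _ _) (hcon _ _),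
      hg.eq_of_not_isNear (hj true false true) (hcon _ _) (hcon _ _), sub_self, sub_self])
  obtain ⟨s, t, hs⟩ := h1
  obtain ⟨s', t', hs'⟩ := h2
  by_cases hℓj : ℓ = j
  · subst hℓj
    exact ⟨s, t, Or.inr (hs.imp_right fun h => kNearest_mono (by omega) h)⟩
  by_cases hij : i = j
  · subst hij
    exact ⟨s', t', Or.inr (Or.inl rfl)⟩
  by_cases hℓi : ℓ = i
  · subst hℓi
    exact ⟨s', t', Or.inl ⟨hℓj, Or.inl rfl, hs'.imp_right fun h => kNearest_mono (by omega) h⟩⟩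
  -- The two proximities were found in different configurations. Moving only j in the first and only
  -- i in the second aligns them, at the price of one rank each, hence k + 1. Here ℓ, i and j are
  -- distinct, so the centre and the relevant neighbor stay fixed.
  refine ⟨s, t', Or.inl ⟨hℓj, hs.imp_right fun h => ?_, hs'.imp_right fun h => ?_⟩⟩
  · exact kNearest_of_eqOn_compl (J := {j}) (fun m hm => hj s t false m (by simpa using hm))
      (hj s t false ℓ hℓj) (hj s t false i hij) (by simp) h
  · exact kNearest_of_eqOn_compl (J := {i}) (fun m hm => hi s' s t' m (by simpa using hm))
      (hi s' s t' ℓ hℓi) (hi s' s t' j (Ne.symm hij)) (by simp) h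

lemma measurableSet_mem_kNearest
    (hr : MeasurableSet {q : EuclideanSpace ℝ (Fin d) × EuclideanSpace ℝ (Fin d) | r q.1 q.2})
    (k : ℕ) (ℓ j : Fin n) : MeasurableSet {x : Fin n → EuclideanSpace ℝ (Fin d) |
      j ∈ kNearest r k x ℓ} := by
  classical
  have h1 : ∀ m, MeasurableSet {x : Fin n → EuclideanSpace ℝ (Fin d) |
      m ≠ ℓ ∧ Nearer r (x ℓ) (x m) (x j)} := by
    intro m
    have e1 : MeasurableSet {x : Fin n → EuclideanSpace ℝ (Fin d) | ‖x ℓ - x m‖ < ‖x ℓ - x j‖} :=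
      measurableSet_lt (by fun_prop) (by fun_prop)
    have e2 : MeasurableSet {x : Fin n → EuclideanSpace ℝ (Fin d) | ‖x ℓ - x m‖ = ‖x ℓ - x j‖} :=
      measurableSet_eq_fun (by fun_prop) (by fun_prop)
    have e3 : MeasurableSet {x : Fin n → EuclideanSpace ℝ (Fin d) | r (x m) (x j)} :=
      (by fun_prop : Measurable fun x : Fin n → EuclideanSpace ℝ (Fin d) => (x m, x j)) hr
    exact (MeasurableSet.const _).inter (e1.union (e2.inter e3))
  have h2 : Measurable fun x : Fin n → EuclideanSpace ℝ (Fin d) => nearRank r x ℓ j := by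
    have : ∀ x : Fin n → EuclideanSpace ℝ (Fin d), nearRank r x ℓ j
        = ∑ m, if m ≠ ℓ ∧ Nearer r (x ℓ) (x m) (x j) then 1 else 0 := by
      intro x
      rw [nearRank, Finset.card_filter]
    simp only [this]
    exact Finset.measurable_fun_sum _ fun m _ =>
      Measurable.ite (h1 m) measurable_const measurable_const
  simp only [mem_kNearest]
  exact (MeasurableSet.const _).inter (h2 (measurableSet_Iio (a := k)))

lemma measurableSet_isNear
    (hr : MeasurableSet {q : EuclideanSpace ℝ (Fin d) × EuclideanSpace ℝ (Fin d) | r q.1 q.2})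
    (k : ℕ) (ℓ j : Fin n) : MeasurableSet {x : Fin n → EuclideanSpace ℝ (Fin d) |
      IsNear r k x ℓ j} :=
  (MeasurableSet.const _).union (measurableSet_mem_kNearest hr k ℓ j)

end Nearest

/-! ### Moments of the number of interactions -/

/-- The fourth power of a sum of indicators is expanded over 4-tuples of indices; each tuple can
then be treated with its own change of configuration. -/
lemma lintegral_indicator_card_pow_four {ι Ω : Type*} [Fintype ι] [MeasurableSpace Ω]
    {P : Measure Ω} {A : Set Ω} {E : ι → Set Ω} [∀ ω j, Decidable (ω ∈ E j)] (hA : MeasurableSet A)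
    (hE : ∀ j, MeasurableSet (E j)) :
    ∫⁻ ω, A.indicator (fun ω => ((Finset.univ.filter fun j => ω ∈ E j).card : ENNReal) ^ 4) ω ∂P
      = ∑ t : Fin 4 → ι, P (A ∩ ⋂ s, E (t s)) := by
  have hm : ∀ t : Fin 4 → ι, MeasurableSet (A ∩ ⋂ s, E (t s)) := fun t =>
    hA.inter (MeasurableSet.iInter fun s => hE _)
  have e : ∀ ω, A.indicator
      (fun ω => ((Finset.univ.filter fun j => ω ∈ E j).card : ENNReal) ^ 4) ω
      = ∑ t : Fin 4 → ι, (A ∩ ⋂ s, E (t s)).indicator 1 ω := by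
    intro ω
    classical
    by_cases hω : ω ∈ A
    · rw [Set.indicator_of_mem hω, Finset.card_filter, Nat.cast_sum, Fintype.sum_pow]
      refine Finset.sum_congr rfl fun t _ => ?_
      simp only [Nat.cast_ite, Nat.cast_one, Nat.cast_zero, Finset.prod_boole, Finset.mem_univ,
        true_imp_iff, Set.indicator_apply, Set.mem_inter_iff, hω, true_and, Set.mem_iInter,
        Pi.one_apply]
    · rw [Set.indicator_of_notMem hω]
      refine (Finset.sum_eq_zero fun t _ => ?_).symm
      exact Set.indicator_of_notMem (fun hh => hω hh.1) _
  simp only [e]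
  rw [lintegral_finsetSum _ fun t _ => measurable_one.indicator (hm t)]
  exact Finset.sum_congr rfl fun t _ => lintegral_indicator_one (hm t)

/-- Fourth moments of the number of events that occur can be compared by means of the probabilities
that four of them occur simultaneously. -/
lemma lintegral_indicator_card_pow_four_le {ι Ω₁ Ω₂ : Type*} [Fintype ι] [MeasurableSpace Ω₁]
    [MeasurableSpace Ω₂] {P₁ : Measure Ω₁} {P₂ : Measure Ω₂} {A₁ : Set Ω₁} {A₂ : Set Ω₂}
    {E₁ : ι → Set Ω₁} {E₂ : ι → Set Ω₂} [∀ ω j, Decidable (ω ∈ E₁ j)]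
    [∀ ω j, Decidable (ω ∈ E₂ j)] (hA₁ : MeasurableSet A₁) (hE₁ : ∀ j, MeasurableSet (E₁ j))
    (hA₂ : MeasurableSet A₂) (hE₂ : ∀ j, MeasurableSet (E₂ j))
    (h : ∀ t : Fin 4 → ι, P₁ (A₁ ∩ ⋂ s, E₁ (t s)) ≤ P₂ (A₂ ∩ ⋂ s, E₂ (t s))) :
    ∫⁻ ω, A₁.indicator (fun ω => ((Finset.univ.filter fun j => ω ∈ E₁ j).card : ENNReal) ^ 4) ω ∂P₁
      ≤ ∫⁻ ω, A₂.indicator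
          (fun ω => ((Finset.univ.filter fun j => ω ∈ E₂ j).card : ENNReal) ^ 4) ω ∂P₂ := by
  rw [lintegral_indicator_card_pow_four hA₁ hE₁, lintegral_indicator_card_pow_four hA₂ hE₂]
  exact Finset.sum_le_sum fun t _ => h t

/-- Toggle the membership of the elements of `J` in `B`, or do nothing. -/
def toggle {ι : Type*} [DecidableEq ι] (b : Bool) (B J : Finset ι) : Finset ι :=
  if b then symmDiff B J else B

lemma mix_toggle_of_notMem {ι S : Type*} [DecidableEq ι] (b : Bool) (B : Finset ι) {J : Finset ι}
    {m : ι} (hm : m ∉ J) (c : ι → S × S) : mix (toggle b B J) c m = mix B c m := by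
  cases b <;> simp [mix, toggle, Finset.mem_symmDiff, hm]

lemma mix_toggle_of_mem {ι S : Type*} [DecidableEq ι] (b : Bool) (B : Finset ι) {J : Finset ι}
    {m : ι} (hm : m ∈ J) (c : ι → S × S) :
    mix (toggle b B J) c m = mix (toggle b B {m}) c m := by
  cases b <;> simp [mix, toggle, Finset.mem_symmDiff, hm]

section Interaction

variable {n d K : ℕ} {r : EuclideanSpace ℝ (Fin d) → EuclideanSpace ℝ (Fin d) → Prop}
  {b : Bool} {B : Finset (Fin n)} {i j ℓ : Fin n}

/-- The points `i` and `j` are both near some point after possibly resampling the point `j`. -/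
def Interact (r : EuclideanSpace ℝ (Fin d) → EuclideanSpace ℝ (Fin d) → Prop) (K : ℕ) (b : Bool)
    (B : Finset (Fin n)) (c : Fin n → EuclideanSpace ℝ (Fin d) × EuclideanSpace ℝ (Fin d))
    (i j : Fin n) : Prop :=
  (∃ ℓ, ℓ ≠ j ∧ IsNear r K (mix B c) ℓ i ∧ IsNear r K (mix (toggle b B {j}) c) ℓ j) ∨
    IsNear r K (mix (toggle b B {j}) c) j i

open scoped Classical in
/-- The number of points `j ≠ i` that interact with `i`. -/
noncomputable def interactCount
    (r : EuclideanSpace ℝ (Fin d) → EuclideanSpace ℝ (Fin d) → Prop) (K : ℕ) (b : Bool)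
    (B : Finset (Fin n)) (i : Fin n)
    (c : Fin n → EuclideanSpace ℝ (Fin d) × EuclideanSpace ℝ (Fin d)) : ℕ :=
  (Finset.univ.filter fun j => j ≠ i ∧ Interact r K b B c i j).card

lemma measurableSet_isNear_mix
    (hr : MeasurableSet {q : EuclideanSpace ℝ (Fin d) × EuclideanSpace ℝ (Fin d) | r q.1 q.2})
    (K : ℕ) (B : Finset (Fin n)) (ℓ j : Fin n) :
    MeasurableSet {c : Fin n → EuclideanSpace ℝ (Fin d) × EuclideanSpace ℝ (Fin d) |
      IsNear r K (mix B c) ℓ j} := by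
  have h := measurable_mix B (measurableSet_isNear hr K ℓ j)
  exact h

lemma measurable_interactCount
    (hr : MeasurableSet {q : EuclideanSpace ℝ (Fin d) × EuclideanSpace ℝ (Fin d) | r q.1 q.2})
    (K : ℕ) (b : Bool) (B : Finset (Fin n)) (i : Fin n) :
    Measurable (interactCount r K b B i) := by
  classical
  have h1 : ∀ j, MeasurableSet {c : Fin n → EuclideanSpace ℝ (Fin d) × EuclideanSpace ℝ (Fin d) |
      j ≠ i ∧ Interact r K b B c i j} := by
    intro j
    have e : {c : Fin n → EuclideanSpace ℝ (Fin d) × EuclideanSpace ℝ (Fin d) |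
        j ≠ i ∧ Interact r K b B c i j} = {c | j ≠ i} ∩ ((⋃ ℓ, {c | ℓ ≠ j} ∩
          (mix B ⁻¹' {x | IsNear r K x ℓ i} ∩ mix (toggle b B {j}) ⁻¹' {x | IsNear r K x ℓ j})) ∪
          mix (toggle b B {j}) ⁻¹' {x | IsNear r K x j i}) := by
      ext c
      simp [Interact]
    rw [e]
    exact (MeasurableSet.const _).inter ((MeasurableSet.iUnion fun ℓ => (MeasurableSet.const _).inter
      ((measurableSet_isNear_mix hr K _ ℓ i).inter
        (measurableSet_isNear_mix hr K _ ℓ j))).union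
        (measurableSet_isNear_mix hr K _ j i))
  have h2 : interactCount r K b B i = fun c => ∑ j, if j ≠ i ∧ Interact r K b B c i j then 1 else 0 := by
    funext c
    rw [interactCount, Finset.card_filter]
  rw [h2]
  exact Finset.measurable_fun_sum _ fun j _ =>
    Measurable.ite (h1 j) measurable_const measurable_const

open scoped Classical in
lemma interactCount_le (c : Fin n → EuclideanSpace ℝ (Fin d) × EuclideanSpace ℝ (Fin d)) :
    interactCount r K b B i c ≤
      (∑ ℓ ∈ Finset.univ.filter fun ℓ => IsNear r K (mix B c) ℓ i,
        (Finset.univ.filter fun j => j ≠ ℓ ∧ j ≠ i ∧ IsNear r K (mix (toggle b B {j}) c) ℓ j).card)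
      + (Finset.univ.filter fun j => j ≠ i ∧ IsNear r K (mix (toggle b B {j}) c) j i).card := by
  have hsub : (Finset.univ.filter fun j => j ≠ i ∧ Interact r K b B c i j) ⊆
      ((Finset.univ.filter fun ℓ => IsNear r K (mix B c) ℓ i).biUnion fun ℓ =>
        Finset.univ.filter fun j => j ≠ ℓ ∧ j ≠ i ∧ IsNear r K (mix (toggle b B {j}) c) ℓ j) ∪
      Finset.univ.filter fun j => j ≠ i ∧ IsNear r K (mix (toggle b B {j}) c) j i := by
    intro j hj
    simp only [Finset.mem_filter, Finset.mem_univ, true_and, Finset.mem_union,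
      Finset.mem_biUnion] at hj ⊢
    obtain ⟨hji, ⟨ℓ, h1, h2, h3⟩ | h⟩ := hj
    · exact Or.inl ⟨ℓ, h2, h1.symm, hji, h3⟩
    · exact Or.inr ⟨hji, h⟩
  refine (Finset.card_le_card hsub).trans ((Finset.card_union_le _ _).trans ?_)
  gcongr
  exact Finset.card_biUnion_le

/-- Cauchy-Schwarz applied twice. -/
lemma sum_pow_four_le {α : Type*} (s : Finset α) (f : α → ℕ) :
    (∑ a ∈ s, f a) ^ 4 ≤ s.card ^ 3 * ∑ a ∈ s, f a ^ 4 := by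
  have h1 : (∑ a ∈ s, f a) ^ 2 ≤ s.card * ∑ a ∈ s, f a ^ 2 := sq_sum_le_card_mul_sum_sq
  have h2 : (∑ a ∈ s, f a ^ 2) ^ 2 ≤ s.card * ∑ a ∈ s, (f a ^ 2) ^ 2 := sq_sum_le_card_mul_sum_sq
  calc (∑ a ∈ s, f a) ^ 4 = ((∑ a ∈ s, f a) ^ 2) ^ 2 := by ring
    _ ≤ (s.card * ∑ a ∈ s, f a ^ 2) ^ 2 := by gcongr
    _ = s.card ^ 2 * (∑ a ∈ s, f a ^ 2) ^ 2 := by ring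
    _ ≤ s.card ^ 2 * (s.card * ∑ a ∈ s, (f a ^ 2) ^ 2) := by gcongr
    _ = s.card ^ 3 * ∑ a ∈ s, f a ^ 4 := by simp only [← pow_mul]; ring

variable (μ : Measure (EuclideanSpace ℝ (Fin d))) [IsProbabilityMeasure μ]

-- The events on the left live on different configurations, one for each j, and no pointwise bound
-- on their number is available. For a fixed 4-tuple with index set J, resampling all of J
-- simultaneously moves at most 4 points, so the neighbors persist at level K + 4 in the single
-- configuration `mix (toggle b B J) c`. This has the law of the original sample, where neighbor
-- counts are deterministic.
open scoped Classical in
lemma lintegral_near_card_pow_four_le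
    (hr : MeasurableSet {q : EuclideanSpace ℝ (Fin d) × EuclideanSpace ℝ (Fin d) | r q.1 q.2})
    (i ℓ : Fin n) :
    ∫⁻ c, {c | IsNear r K (mix B c) ℓ i}.indicator (fun c => ((Finset.univ.filter fun j =>
        c ∈ {c | j ≠ ℓ ∧ j ≠ i ∧ IsNear r K (mix (toggle b B {j}) c) ℓ j}).card : ENNReal) ^ 4) c
        ∂(Measure.pi fun _ : Fin n => μ.prod μ)
      ≤ ∫⁻ x, {x | IsNear r (K + 4) x ℓ i}.indicator (fun x => ((Finset.univ.filter fun j =>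
        x ∈ {x | j ∈ kNearest r (K + 4) x ℓ}).card : ENNReal) ^ 4) x
        ∂(Measure.pi fun _ : Fin n => μ) := by
  refine lintegral_indicator_card_pow_four_le
    (measurableSet_isNear_mix hr K B ℓ i)
    (fun j => (MeasurableSet.const _).inter ((MeasurableSet.const _).inter
      (measurableSet_isNear_mix hr K _ ℓ j)))
    (measurableSet_isNear hr _ ℓ i) (fun j => measurableSet_mem_kNearest hr _ ℓ j) fun t => ?_
  set J := Finset.univ.image t with hJ
  have hJc : J.card ≤ 4 := Finset.card_image_le.trans (by simp)
  rw [← (measurePreserving_mix μ (toggle b B J)).measure_preimage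
    ((measurableSet_isNear hr _ ℓ i).inter
      (MeasurableSet.iInter fun s => measurableSet_mem_kNearest hr _ ℓ (t s))).nullMeasurableSet]
  refine measure_mono fun c hc => ?_
  simp only [mem_inter_iff, mem_ofPred_eq, mem_iInter, mem_preimage] at hc ⊢
  obtain ⟨hA, hE⟩ := hc
  -- The centre ℓ and the point i must not be moved; the conditions j ≠ ℓ and j ≠ i in the events
  -- ensure this.
  have hℓJ : ℓ ∉ J := by
    intro h
    obtain ⟨s, -, hs⟩ := Finset.mem_image.1 h
    exact (hE s).1 hs
  have hiJ : i ∉ J := by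
    intro h
    obtain ⟨s, -, hs⟩ := Finset.mem_image.1 h
    exact (hE s).2.1 hs
  refine ⟨hA.imp_right fun h => ?_, fun s => ?_⟩
  · exact kNearest_of_eqOn_compl (J := J) (fun m hm => (mix_toggle_of_notMem b B hm c).symm)
      (mix_toggle_of_notMem b B hℓJ c).symm (mix_toggle_of_notMem b B hiJ c).symm (by omega) h
  · have hts : t s ∈ J := Finset.mem_image_of_mem t (Finset.mem_univ s)
    have h := (hE s).2.2.resolve_left (hE s).1
    refine kNearest_of_eqOn_compl (J := J) (fun m hm => ?_) ?_ ?_ (by omega) h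
    · rw [mix_toggle_of_notMem b B hm, mix_toggle_of_notMem]
      rw [Finset.mem_singleton]
      rintro rfl
      exact hm hts
    · rw [mix_toggle_of_notMem b B hℓJ, mix_toggle_of_notMem]
      rw [Finset.mem_singleton]
      exact fun h => (hE s).1 h.symm
    · rw [mix_toggle_of_mem b B hts]

-- The same simultaneous resampling, now for the case in which the resampled points are the centres
-- and i is their neighbor.
open scoped Classical in
lemma lintegral_center_card_pow_four_le
    (hr : MeasurableSet {q : EuclideanSpace ℝ (Fin d) × EuclideanSpace ℝ (Fin d) | r q.1 q.2})
    (i : Fin n) :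
    ∫⁻ c, univ.indicator (fun c => ((Finset.univ.filter fun j =>
        c ∈ {c | j ≠ i ∧ IsNear r K (mix (toggle b B {j}) c) j i}).card : ENNReal) ^ 4) c
        ∂(Measure.pi fun _ : Fin n => μ.prod μ)
      ≤ ∫⁻ x, univ.indicator (fun x => ((Finset.univ.filter fun j =>
        x ∈ {x | i ∈ kNearest r (K + 4) x j}).card : ENNReal) ^ 4) x
        ∂(Measure.pi fun _ : Fin n => μ) := by
  refine lintegral_indicator_card_pow_four_le MeasurableSet.univ
    (fun j => (MeasurableSet.const _).inter (measurableSet_isNear_mix hr K _ j i))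
    MeasurableSet.univ (fun j => measurableSet_mem_kNearest hr _ j i) fun t => ?_
  set J := Finset.univ.image t with hJ
  have hJc : J.card ≤ 4 := Finset.card_image_le.trans (by simp)
  rw [← (measurePreserving_mix μ (toggle b B J)).measure_preimage (MeasurableSet.univ.inter
      (MeasurableSet.iInter fun s => measurableSet_mem_kNearest hr _ (t s) i)).nullMeasurableSet]
  refine measure_mono fun c hc => ?_
  simp only [mem_inter_iff, mem_ofPred_eq, mem_iInter, mem_preimage, mem_univ, true_and] at hc ⊢
  have hiJ : i ∉ J := by
    intro h
    obtain ⟨s, -, hs⟩ := Finset.mem_image.1 h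
    exact (hc s).1 hs
  intro s
  have hts : t s ∈ J := Finset.mem_image_of_mem t (Finset.mem_univ s)
  have h := (hc s).2.resolve_left (hc s).1.symm
  refine kNearest_of_eqOn_compl (J := J) (fun m hm => ?_) ?_ ?_ (by omega) h
  · rw [mix_toggle_of_notMem b B hm, mix_toggle_of_notMem]
    rw [Finset.mem_singleton]
    rintro rfl
    exact hm hts
  · rw [mix_toggle_of_mem b B hts]
  · rw [mix_toggle_of_notMem b B hiJ, mix_toggle_of_notMem]
    rw [Finset.mem_singleton]
    exact fun h => (hc s).1 h.symm

open scoped Classical in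
/-- The fourth moment of the number of points that interact with a given point. -/
theorem lintegral_interactCount_pow_four_le [IsStrictTotalOrder (EuclideanSpace ℝ (Fin d)) r]
    (hd : 1 ≤ d)
    (hr : MeasurableSet {q : EuclideanSpace ℝ (Fin d) × EuclideanSpace ℝ (Fin d) | r q.1 q.2})
    (hinj : ∀ᵐ x ∂(Measure.pi fun _ : Fin n => μ), Function.Injective x) (K : ℕ) (b : Bool)
    (B : Finset (Fin n)) (i : Fin n) :
    ∫⁻ c, (interactCount r K b B i c : ENNReal) ^ 4 ∂(Measure.pi fun _ : Fin n => μ.prod μ)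
      ≤ ((16 * ((coneCoverNumber d * (K + 6)) * (K + 4)) ^ 4 : ℕ) : ENNReal) := by
  set A := coneCoverNumber d * (K + 6) with hA
  set ν := Measure.pi fun _ : Fin n => μ with hν
  set Q := Measure.pi fun _ : Fin n => μ.prod μ with hQ
  have hinj' : ∀ᵐ c ∂Q, Function.Injective (mix B c) :=
    (measurePreserving_mix μ B).quasiMeasurePreserving.ae hinj
  set N : Fin n → (Fin n → EuclideanSpace ℝ (Fin d) × EuclideanSpace ℝ (Fin d)) → ℕ := fun ℓ c =>
    (Finset.univ.filter fun j =>
      c ∈ {c | j ≠ ℓ ∧ j ≠ i ∧ IsNear r K (mix (toggle b B {j}) c) ℓ j}).card with hN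
  set D : (Fin n → EuclideanSpace ℝ (Fin d) × EuclideanSpace ℝ (Fin d)) → ℕ := fun c =>
    (Finset.univ.filter fun j =>
      c ∈ {c | j ≠ i ∧ IsNear r K (mix (toggle b B {j}) c) j i}).card with hD
  have hNm : ∀ ℓ, Measurable (N ℓ) := by
    intro ℓ
    simp only [hN, Finset.card_filter]
    exact Finset.measurable_fun_sum _ fun j _ => Measurable.ite
      ((MeasurableSet.const _).inter ((MeasurableSet.const _).inter
      (measurableSet_isNear_mix hr K _ ℓ j))) measurable_const measurable_const
  have hDm : Measurable D := by
    simp only [hD, Finset.card_filter]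
    exact Finset.measurable_fun_sum _ fun j _ => Measurable.ite
      ((MeasurableSet.const _).inter
      (measurableSet_isNear_mix hr K _ j i)) measurable_const measurable_const
  have hcast : Measurable (fun m : ℕ => (m : ENNReal)) := measurable_from_top
  have hpt : ∀ᵐ c ∂Q, (interactCount r K b B i c : ENNReal) ^ 4
      ≤ 8 * ((A : ENNReal) ^ 3 * ∑ ℓ, {c | IsNear r K (mix B c) ℓ i}.indicator
        (fun c => (N ℓ c : ENNReal) ^ 4) c + (D c : ENNReal) ^ 4) := by
    filter_upwards [hinj'] with c hc
    -- A = α(d)(K + 6) is the cone bound at level K + 4, where it is needed after the comparison; it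
    -- also covers level K.
    have hL : (Finset.univ.filter fun ℓ => IsNear r K (mix B c) ℓ i).card ≤ A :=
      (card_filter_isNear_le (r := r) (k := K) hd hc i).trans (by rw [hA]; gcongr; omega)
    have h1 : interactCount r K b B i c ≤
        (∑ ℓ ∈ Finset.univ.filter fun ℓ => IsNear r K (mix B c) ℓ i, N ℓ c) + D c :=
      interactCount_le c
    have h2 := sum_pow_four_le (Finset.univ.filter fun ℓ => IsNear r K (mix B c) ℓ i)
      (fun ℓ => N ℓ c)
    have h3 : interactCount r K b B i c ^ 4 ≤ 8 * (A ^ 3 *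
        ∑ ℓ ∈ Finset.univ.filter fun ℓ => IsNear r K (mix B c) ℓ i, N ℓ c ^ 4 + D c ^ 4) := by
      calc _ ≤ ((∑ ℓ ∈ Finset.univ.filter fun ℓ => IsNear r K (mix B c) ℓ i, N ℓ c) + D c) ^ 4 := by
            gcongr
        _ ≤ 2 ^ (4 - 1) * ((∑ ℓ ∈ Finset.univ.filter fun ℓ => IsNear r K (mix B c) ℓ i, N ℓ c) ^ 4
            + D c ^ 4) := add_pow_le (Nat.zero_le _) (Nat.zero_le _) 4
        _ ≤ 8 * (A ^ 3 * ∑ ℓ ∈ Finset.univ.filter fun ℓ => IsNear r K (mix B c) ℓ i, N ℓ c ^ 4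
            + D c ^ 4) := by
            refine Nat.mul_le_mul (by norm_num) (Nat.add_le_add_right (h2.trans ?_) _)
            gcongr
    have h4 : ∑ ℓ, {c | IsNear r K (mix B c) ℓ i}.indicator (fun c => (N ℓ c : ENNReal) ^ 4) c
        = ((∑ ℓ ∈ Finset.univ.filter fun ℓ => IsNear r K (mix B c) ℓ i, N ℓ c ^ 4 : ℕ) : ENNReal) := by
      rw [Finset.sum_filter]
      push_cast
      exact Finset.sum_congr rfl fun ℓ _ => by
        rw [Set.indicator_apply]
        simp only [mem_ofPred_eq]
    rw [h4]
    exact_mod_cast h3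
  have hind : ∀ ℓ, Measurable ({c | IsNear r K (mix B c) ℓ i}.indicator
      (fun c => (N ℓ c : ENNReal) ^ 4)) := fun ℓ =>
    ((hcast.comp (hNm ℓ)).pow_const 4).indicator (measurableSet_isNear_mix hr K B ℓ i)
  have hkm : ∀ ℓ, Measurable ({x | IsNear r (K + 4) x ℓ i}.indicator
      (fun x => ((Finset.univ.filter fun j =>
        x ∈ {x | j ∈ kNearest r (K + 4) x ℓ}).card : ENNReal) ^ 4)) := by
    intro ℓ
    refine Measurable.indicator ((hcast.comp (?_ : Measurable fun x => (Finset.univ.filter fun j =>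
        x ∈ {x | j ∈ kNearest r (K + 4) x ℓ}).card)).pow_const 4) (measurableSet_isNear hr _ ℓ i)
    simp only [Finset.card_filter]
    exact Finset.measurable_fun_sum _ fun j _ => Measurable.ite
      (measurableSet_mem_kNearest hr _ ℓ j) measurable_const measurable_const
  have b1 : ∑ ℓ, ∫⁻ c, {c | IsNear r K (mix B c) ℓ i}.indicator
        (fun c => (N ℓ c : ENNReal) ^ 4) c ∂Q ≤ (A : ENNReal) * ((K + 4 : ℕ) : ENNReal) ^ 4 := by
    calc _ ≤ ∑ ℓ, ∫⁻ x, {x | IsNear r (K + 4) x ℓ i}.indicator (fun x => ((Finset.univ.filter fun j =>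
            x ∈ {x | j ∈ kNearest r (K + 4) x ℓ}).card : ENNReal) ^ 4) x ∂ν :=
          Finset.sum_le_sum fun ℓ _ => lintegral_near_card_pow_four_le μ hr i ℓ
      _ = ∫⁻ x, ∑ ℓ, {x | IsNear r (K + 4) x ℓ i}.indicator (fun x => ((Finset.univ.filter fun j =>
            x ∈ {x | j ∈ kNearest r (K + 4) x ℓ}).card : ENNReal) ^ 4) x ∂ν :=
          (lintegral_finsetSum _ fun ℓ _ => hkm ℓ).symm
      _ ≤ ∫⁻ x, (A : ENNReal) * ((K + 4 : ℕ) : ENNReal) ^ 4 ∂ν := by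
          refine lintegral_mono_ae ?_
          filter_upwards [hinj] with x hx
          have h1 : ∀ ℓ, {x | IsNear r (K + 4) x ℓ i}.indicator (fun x => ((Finset.univ.filter fun j =>
              x ∈ {x | j ∈ kNearest r (K + 4) x ℓ}).card : ENNReal) ^ 4) x
              ≤ if IsNear r (K + 4) x ℓ i then ((K + 4 : ℕ) : ENNReal) ^ 4 else 0 := by
            intro ℓ
            rw [Set.indicator_apply]
            simp only [mem_ofPred_eq]
            split_ifs with h
            · have := card_kNearest_le (r := r) (k := K + 4) (ℓ := ℓ) hx
              gcongr
              convert! this using 2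
              ext j
              simp
            · exact le_rfl
          refine (Finset.sum_le_sum fun ℓ _ => h1 ℓ).trans ?_
          rw [← Finset.sum_filter, Finset.sum_const, nsmul_eq_mul]
          gcongr
          exact (card_filter_isNear_le (r := r) (k := K + 4) hd hx i).trans (by rw [hA])
      _ = _ := by simp
  have b2 : ∫⁻ c, (D c : ENNReal) ^ 4 ∂Q ≤ (A : ENNReal) ^ 4 := by
    have h1 := lintegral_center_card_pow_four_le (K := K) (b := b) (B := B) μ hr i
    simp only [Set.indicator_univ] at h1
    refine h1.trans ?_
    calc _ ≤ ∫⁻ x, (A : ENNReal) ^ 4 ∂ν := by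
          refine lintegral_mono_ae ?_
          filter_upwards [hinj] with x hx
          gcongr
          refine (card_filter_mem_kNearest_le (r := r) (k := K + 4) hd hx i).trans ?_
          rw [hA]
          exact Nat.mul_le_mul_left _ (by omega)
      _ = _ := by simp
  calc _ ≤ _ := lintegral_mono_ae hpt
    _ = 8 * ((A : ENNReal) ^ 3 * ∑ ℓ, ∫⁻ c, {c | IsNear r K (mix B c) ℓ i}.indicator
        (fun c => (N ℓ c : ENNReal) ^ 4) c ∂Q + ∫⁻ c, (D c : ENNReal) ^ 4 ∂Q) := by
        rw [lintegral_const_mul' _ _ (by simp), lintegral_add_right _ (g := fun c => (D c : ENNReal) ^ 4) ((hcast.comp hDm).pow_const 4),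
          lintegral_const_mul' _ _ (by simp), lintegral_finsetSum _ fun ℓ _ => hind ℓ]
    _ ≤ 8 * ((A : ENNReal) ^ 3 * ((A : ENNReal) * ((K + 4 : ℕ) : ENNReal) ^ 4) + (A : ENNReal) ^ 4) := by
        gcongr
    _ ≤ _ := by
        have h : 8 * (A ^ 3 * (A * (K + 4) ^ 4) + A ^ 4) ≤ 16 * (A * (K + 4)) ^ 4 := by
          have : 1 ≤ (K + 4) ^ 4 := Nat.one_le_pow _ _ (by omega)
          calc 8 * (A ^ 3 * (A * (K + 4) ^ 4) + A ^ 4)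
              ≤ 8 * (A ^ 3 * (A * (K + 4) ^ 4) + A ^ 4 * (K + 4) ^ 4) := by
                gcongr
                exact Nat.le_mul_of_pos_right _ this
            _ = _ := by ring
        exact_mod_cast h

end Interaction

/-! ### Local statistics of nearest neighbors -/

section LocalStatistic

variable {n d k : ℕ} {r : EuclideanSpace ℝ (Fin d) → EuclideanSpace ℝ (Fin d) → Prop}
  {f : Fin n → (Fin n → EuclideanSpace ℝ (Fin d)) → ℝ} {p : ℝ}
  {B : Finset (Fin n)} {i j : Fin n}
  {c c' : Fin n → EuclideanSpace ℝ (Fin d) × EuclideanSpace ℝ (Fin d)}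

/-- The sum of the `p`-th powers of the summands before and after resampling the point `j`. -/
noncomputable def pairPowSum (f : Fin n → (Fin n → EuclideanSpace ℝ (Fin d)) → ℝ) (p : ℝ)
    (B : Finset (Fin n)) (j : Fin n)
    (c : Fin n → EuclideanSpace ℝ (Fin d) × EuclideanSpace ℝ (Fin d)) : ℝ :=
  ∑ ℓ, (|f ℓ (mix (B.erase j) c)| ^ p + |f ℓ (mix (insert j B) c)| ^ p)

lemma pairPowSum_nonneg : 0 ≤ pairPowSum f p B j c :=
  Finset.sum_nonneg fun ℓ _ => by positivity

open scoped Classical in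
/-- The effect of resampling a point on the statistic is a sum over few summands. -/
lemma abs_resampleDiffOn_localSum_le [IsStrictTotalOrder (EuclideanSpace ℝ (Fin d)) r]
    (hd : 1 ≤ d) (hf : ∀ ℓ, DependsOnlyOnNearest r k ℓ (f ℓ)) (hp : 0 < p)
    (h1 : Function.Injective (mix (B.erase j) c)) (h2 : Function.Injective (mix (insert j B) c)) :
    |resampleDiffOn (localSum f) B j c|
      ≤ 4 * (coneCoverNumber d * (k + 2) : ℕ) / √n * pairPowSum f p B j c ^ (1 / p) := by
  set x := mix (B.erase j) c with hx
  set y := mix (insert j B) c with hy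
  set A := coneCoverNumber d * (k + 2) with hA
  set u := pairPowSum f p B j c ^ (1 / p) with hu
  have hu0 : 0 ≤ u := Real.rpow_nonneg pairPowSum_nonneg _
  have hxy : ∀ m, m ≠ j → x m = y m := by
    intro m hm
    simp [hx, hy, mix, hm]
  have hle : ∀ ℓ, |f ℓ x| ≤ u ∧ |f ℓ y| ≤ u := by
    intro ℓ
    have hterm : |f ℓ x| ^ p + |f ℓ y| ^ p ≤ pairPowSum f p B j c :=
      Finset.single_le_sum (f := fun ℓ => |f ℓ x| ^ p + |f ℓ y| ^ p)
        (fun ℓ _ => by positivity) (Finset.mem_univ ℓ)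
    -- The maximum of the summands is bounded by their ℓ^p norm; this is where powers of n^(1/p) are
    -- lost.
    have e : ∀ t : ℝ, 0 ≤ t → t ^ p ≤ pairPowSum f p B j c → t ≤ u := by
      intro t ht h
      have := Real.rpow_le_rpow (by positivity) h (by positivity : 0 ≤ 1 / p)
      rwa [← Real.rpow_mul ht, mul_one_div_cancel hp.ne', Real.rpow_one] at this
    have hx0 : 0 ≤ |f ℓ x| ^ p := by positivity
    have hy0 : 0 ≤ |f ℓ y| ^ p := by positivity
    exact ⟨e _ (abs_nonneg _) (by linarith), e _ (abs_nonneg _) (by linarith)⟩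
  -- Only summands whose centre has j nearby before or after the move can change: at most 2A of
  -- them, each by at most 2u.
  set L := (Finset.univ.filter fun ℓ => IsNear r k x ℓ j) ∪
    (Finset.univ.filter fun ℓ => IsNear r k y ℓ j) with hL
  have hLc : L.card ≤ 2 * A := by
    have a1 := card_filter_isNear_le (r := r) (k := k) hd h1 j
    have a2 := card_filter_isNear_le (r := r) (k := k) hd h2 j
    refine (Finset.card_union_le _ _).trans ?_
    omega
  have hsum : |∑ ℓ, (f ℓ x - f ℓ y)| ≤ 4 * A * u := by
    have hz : ∑ ℓ, (f ℓ x - f ℓ y) = ∑ ℓ ∈ L, (f ℓ x - f ℓ y) := by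
      refine (Finset.sum_subset (Finset.subset_univ L) fun ℓ _ hℓ => ?_).symm
      simp only [hL, Finset.mem_union, Finset.mem_filter, Finset.mem_univ, true_and, not_or] at hℓ
      rw [(hf ℓ).eq_of_not_isNear hxy hℓ.1 hℓ.2, sub_self]
    rw [hz]
    calc |∑ ℓ ∈ L, (f ℓ x - f ℓ y)| ≤ ∑ ℓ ∈ L, |f ℓ x - f ℓ y| := Finset.abs_sum_le_sum_abs _ _
      _ ≤ ∑ ℓ ∈ L, 2 * u := Finset.sum_le_sum fun ℓ _ =>
          (abs_sub _ _).trans (by linarith [(hle ℓ).1, (hle ℓ).2])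
      _ = L.card * (2 * u) := by rw [Finset.sum_const, nsmul_eq_mul]
      _ ≤ (2 * A : ℕ) * (2 * u) := by gcongr
      _ = 4 * A * u := by push_cast; ring
  have hd : resampleDiffOn (localSum f) B j c = 1 / √n * ∑ ℓ, (f ℓ x - f ℓ y) := by
    simp only [resampleDiffOn, localSum, Finset.sum_sub_distrib, ← hx, ← hy]
    ring
  rw [hd, abs_mul, abs_of_nonneg (by positivity)]
  calc 1 / √n * |∑ ℓ, (f ℓ x - f ℓ y)| ≤ 1 / √n * (4 * A * u) := by gcongr
    _ = _ := by ring

/-- If resampling the point `i` changes the effect of resampling `j`, then `i` and `j` interact. -/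
lemma exists_interact_of_resampleDiffOn_ne [IsStrictTotalOrder (EuclideanSpace ℝ (Fin d)) r]
    (hf : ∀ ℓ, DependsOnlyOnNearest r k ℓ (f ℓ)) (hc : ∀ m, m ≠ i → c m = c' m)
    (hne : resampleDiffOn (localSum f) B j c ≠ resampleDiffOn (localSum f) B j c') :
    ∃ b, Interact r (k + 1) b B c i j ∨ Interact r (k + 1) b B c' i j := by
  set C : Bool → Fin n → EuclideanSpace ℝ (Fin d) × EuclideanSpace ℝ (Fin d) :=
    fun s => if s then c' else c with hC
  set Y : Bool → Bool → Fin n → EuclideanSpace ℝ (Fin d) :=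
    fun s t => mix (toggle t B {j}) (C s) with hY
  -- Toggling j in B erases or inserts it according to whether j ∈ B, so the toggled difference is
  -- `resampleDiffOn` up to a sign common to both values of s.
  have hsign : ∃ ε : ℝ, ∀ s, resampleDiffOn (localSum f) B j (C s)
      = ε * (localSum f (Y s false) - localSum f (Y s true)) := by
    by_cases hj : j ∈ B
    · refine ⟨-1, fun s => ?_⟩
      have e1 : toggle true B {j} = B.erase j := by
        ext m
        by_cases hm : m = j
        · subst hm; simp [toggle, Finset.mem_symmDiff, hj]
        · simp [toggle, Finset.mem_symmDiff, hm]
      simp only [resampleDiffOn, hY, e1, Finset.insert_eq_of_mem hj]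
      simp [toggle]
    · refine ⟨1, fun s => ?_⟩
      have e1 : toggle true B {j} = insert j B := by
        ext m
        by_cases hm : m = j
        · subst hm; simp [toggle, Finset.mem_symmDiff, hj]
        · simp [toggle, Finset.mem_symmDiff, hm]
      simp only [resampleDiffOn, hY, e1, Finset.erase_eq_of_notMem hj]
      simp [toggle]
  obtain ⟨ε, hε⟩ := hsign
  have hex : ∃ ℓ, f ℓ (Y false false) - f ℓ (Y false true) ≠ f ℓ (Y true false) - f ℓ (Y true true) := by
    by_contra hcon
    push Not at hcon
    refine hne ?_
    have h0 := hε false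
    have h1 := hε true
    simp only [hC, Bool.false_eq_true, if_false, if_true] at h0 h1
    rw [h0, h1]
    simp only [localSum, ← mul_sub, ← Finset.sum_sub_distrib]
    rw [Finset.sum_congr rfl fun ℓ _ => hcon ℓ]
  obtain ⟨ℓ, hℓ⟩ := hex
  have hCC : ∀ s s' m, m ≠ i → C s m = C s' m := by
    intro s s' m hm
    cases s <;> cases s' <;> simp [hC, hc m hm]
  obtain ⟨s, t, h⟩ := (hf ℓ).exists_isNear_of_ne (i := i) (j := j) (Y := Y)
    (fun s s' t m hm => by simp only [hY, mix, hCC s s' m hm])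
    (fun s t t' m hm => by
      simp only [hY]
      rw [mix_toggle_of_notMem _ _ (by simpa using hm), mix_toggle_of_notMem _ _ (by simpa using hm)])
    hℓ
  have hI : Interact r (k + 1) t B (C s) i j := by
    rcases h with ⟨h1, h2, h3⟩ | h
    · exact Or.inl ⟨ℓ, h1, by simpa [hY, toggle] using h2, h3⟩
    · exact Or.inr h
  refine ⟨t, ?_⟩
  cases s
  · exact Or.inl (by simpa [hC] using hI)
  · exact Or.inr (by simpa [hC] using hI)

/-- A bound for the number of terms of `resampleCov` that change when the point `i` is resampled. -/
noncomputable def changeCount (r : EuclideanSpace ℝ (Fin d) → EuclideanSpace ℝ (Fin d) → Prop)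
    (k : ℕ) (B : Finset (Fin n)) (i : Fin n)
    (c c' : Fin n → EuclideanSpace ℝ (Fin d) × EuclideanSpace ℝ (Fin d)) : ℕ :=
  1 + ∑ q : Bool × Bool × Bool,
    interactCount r k q.1 (if q.2.1 then B else ∅) i (if q.2.2 then c' else c)

-- A product changes only if one of its factors does; the first factor is the case B = ∅ of the
-- second. The eight counts record whether j is toggled, which of B and ∅ is used, and which of c
-- and c' shows the interaction; the extra 1 is for j = i.
open scoped Classical in
lemma card_changed_le [IsStrictTotalOrder (EuclideanSpace ℝ (Fin d)) r]
    (hf : ∀ ℓ, DependsOnlyOnNearest r k ℓ (f ℓ)) (hc : ∀ m, m ≠ i → c m = c' m) :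
    (Finset.univ.filter fun j => resampleDiff (localSum f) j c * resampleDiffOn (localSum f) B j c
      ≠ resampleDiff (localSum f) j c' * resampleDiffOn (localSum f) B j c').card
      ≤ changeCount r (k + 1) B i c c' := by
  have hsub : (Finset.univ.filter fun j =>
      resampleDiff (localSum f) j c * resampleDiffOn (localSum f) B j c
      ≠ resampleDiff (localSum f) j c' * resampleDiffOn (localSum f) B j c') ⊆
      insert i ((Finset.univ : Finset (Bool × Bool × Bool)).biUnion fun q =>
        Finset.univ.filter fun j => j ≠ i ∧
          Interact r (k + 1) q.1 (if q.2.1 then B else ∅) (if q.2.2 then c' else c) i j) := by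
    intro j hj
    rw [Finset.mem_filter] at hj
    rw [Finset.mem_insert, Finset.mem_biUnion]
    by_cases hji : j = i
    · exact Or.inl hji
    right
    simp only [Finset.mem_filter, Finset.mem_univ, true_and]
    by_cases h0 : resampleDiff (localSum f) j c = resampleDiff (localSum f) j c'
    · have h1 : resampleDiffOn (localSum f) B j c ≠ resampleDiffOn (localSum f) B j c' := by
        intro h1
        exact hj.2 (by rw [h0, h1])
      obtain ⟨b, h | h⟩ := exists_interact_of_resampleDiffOn_ne (r := r) (k := k) hf hc h1
      · exact ⟨(b, true, false), hji, by simpa using h⟩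
      · exact ⟨(b, true, true), hji, by simpa using h⟩
    · have h1 : resampleDiffOn (localSum f) ∅ j c ≠ resampleDiffOn (localSum f) ∅ j c' := by
        simpa [resampleDiffOn, resampleDiff] using h0
      obtain ⟨b, h | h⟩ := exists_interact_of_resampleDiffOn_ne (r := r) (k := k) hf hc h1
      · exact ⟨(b, false, false), hji, by simpa using h⟩
      · exact ⟨(b, false, true), hji, by simpa using h⟩
  refine (Finset.card_le_card hsub).trans ((Finset.card_insert_le _ _).trans ?_)
  rw [changeCount, add_comm]
  gcongr
  exact Finset.card_biUnion_le

/-- Each changed term moves by at most 2M, and the factor 1/2 in `resampleCov` absorbs the 2. -/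
lemma abs_resampleCov_sub_le [IsStrictTotalOrder (EuclideanSpace ℝ (Fin d)) r]
    (hf : ∀ ℓ, DependsOnlyOnNearest r k ℓ (f ℓ)) (hc : ∀ m, m ≠ i → c m = c' m) {M : ℝ}
    (h1 : ∀ j, |resampleDiff (localSum f) j c * resampleDiffOn (localSum f) B j c| ≤ M)
    (h2 : ∀ j, |resampleDiff (localSum f) j c' * resampleDiffOn (localSum f) B j c'| ≤ M) :
    |resampleCov (localSum f) B c - resampleCov (localSum f) B c'|
      ≤ changeCount r (k + 1) B i c c' * M := by
  classical
  have hM : 0 ≤ M := (abs_nonneg _).trans (h1 i)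
  set D := fun (c : Fin n → EuclideanSpace ℝ (Fin d) × EuclideanSpace ℝ (Fin d)) j =>
    resampleDiff (localSum f) j c * resampleDiffOn (localSum f) B j c with hD
  have e : resampleCov (localSum f) B c - resampleCov (localSum f) B c'
      = 1 / 2 * ∑ j ∈ Finset.univ.filter fun j => D c j ≠ D c' j, (D c j - D c' j) := by
    unfold resampleCov
    rw [← mul_sub, ← Finset.sum_sub_distrib]
    congr 1
    refine (Finset.sum_subset (Finset.filter_subset _ _) fun j _ hj => ?_).symm
    simpa [sub_eq_zero] using hj
  rw [e, abs_mul, abs_of_pos (by norm_num)]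
  have hcard : ((Finset.univ.filter fun j => D c j ≠ D c' j).card : ℝ)
      ≤ changeCount r (k + 1) B i c c' := by
    exact_mod_cast card_changed_le (r := r) (k := k) (B := B) hf hc
  calc 1 / 2 * |∑ j ∈ Finset.univ.filter fun j => D c j ≠ D c' j, (D c j - D c' j)|
      ≤ 1 / 2 * ∑ j ∈ Finset.univ.filter fun j => D c j ≠ D c' j, |D c j - D c' j| := by
        gcongr
        exact Finset.abs_sum_le_sum_abs _ _
    _ ≤ 1 / 2 * ∑ j ∈ Finset.univ.filter fun j => D c j ≠ D c' j, 2 * M := by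
        gcongr with j _
        exact (abs_sub _ _).trans (by linarith [h1 j, h2 j])
    _ = (Finset.univ.filter fun j => D c j ≠ D c' j).card * M := by
        rw [Finset.sum_const, nsmul_eq_mul]; ring
    _ ≤ _ := by gcongr

end LocalStatistic

/-! ### Hölder-type inequalities and moments of the resampling effects -/

section Moments

/-- The power mean inequality on a probability space. -/
lemma lintegral_rpow_le_rpow_lintegral {α : Type*} [MeasurableSpace α] {μ : Measure α}
    [IsProbabilityMeasure μ] {g : α → ENNReal} (hg : AEMeasurable g μ) {θ : ℝ} (h0 : 0 < θ)
    (h1 : θ ≤ 1) : ∫⁻ x, g x ^ θ ∂μ ≤ (∫⁻ x, g x ∂μ) ^ θ := by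
  rcases h1.eq_or_lt with rfl | h1
  · simp
  have hpq : (1 / θ).HolderConjugate (1 / θ).conjExponent :=
    Real.HolderConjugate.conjExponent (by rw [lt_div_iff₀ h0]; linarith)
  have h := ENNReal.lintegral_mul_le_Lp_mul_Lq μ hpq (hg.pow_const θ)
    (g := fun _ => (1 : ENNReal)) aemeasurable_const
  simpa [← ENNReal.rpow_mul, mul_inv_cancel₀ h0.ne'] using h

/-- The Cauchy-Schwarz inequality combined with the power mean inequality. -/
lemma lintegral_sq_mul_rpow_le {α : Type*} [MeasurableSpace α] {μ : Measure α}
    [IsProbabilityMeasure μ] {g h : α → ENNReal} (hg : AEMeasurable g μ) (hh : AEMeasurable h μ)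
    {θ : ℝ} (h0 : 0 < θ) (h1 : θ ≤ 1 / 2) :
    ∫⁻ x, g x ^ 2 * h x ^ θ ∂μ ≤ (∫⁻ x, g x ^ 4 ∂μ) ^ (1 / 2 : ℝ) * (∫⁻ x, h x ∂μ) ^ θ := by
  have hpq : (2 : ℝ).HolderConjugate 2 := Real.HolderConjugate.two_two
  have H := ENNReal.lintegral_mul_le_Lp_mul_Lq μ hpq (hg.pow_const 2) (hh.pow_const θ)
  have e1 : ∀ x, (g x ^ 2) ^ (2 : ℝ) = g x ^ 4 := fun x => by
    rw [ENNReal.rpow_two, ← pow_mul]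
  have e2 : ∀ x, (h x ^ θ) ^ (2 : ℝ) = h x ^ (2 * θ) := fun x => by
    rw [← ENNReal.rpow_mul, mul_comm]
  simp only [Pi.mul_apply, e1, e2] at H
  refine H.trans ?_
  gcongr
  -- The exponent 2θ ≤ 1 makes the power mean inequality applicable. In the application θ = 4/p, so
  -- this is the condition p ≥ 8.
  calc (∫⁻ x, h x ^ (2 * θ) ∂μ) ^ (1 / 2 : ℝ)
      ≤ ((∫⁻ x, h x ∂μ) ^ (2 * θ)) ^ (1 / 2 : ℝ) := by
        gcongr
        exact lintegral_rpow_le_rpow_lintegral hh (by linarith) (by linarith)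
    _ = _ := by
        rw [← ENNReal.rpow_mul]
        congr 1
        ring

variable {n d k : ℕ} {r : EuclideanSpace ℝ (Fin d) → EuclideanSpace ℝ (Fin d) → Prop}
  {f : Fin n → (Fin n → EuclideanSpace ℝ (Fin d)) → ℝ} {p γ : ℝ}
  {μ : Measure (EuclideanSpace ℝ (Fin d))} [IsProbabilityMeasure μ]

lemma measurable_pairPowSum (hfm : ∀ ℓ, Measurable (f ℓ)) (p : ℝ) (B : Finset (Fin n))
    (j : Fin n) : Measurable (pairPowSum f p B j) := by
  unfold pairPowSum
  have h : ∀ B : Finset (Fin n), ∀ ℓ, Measurable fun c => |f ℓ (mix B c)| ^ p := fun B ℓ =>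
    ((hfm ℓ).comp (measurable_mix B)).abs.pow_const p
  exact Finset.measurable_fun_sum _ fun ℓ _ => (h _ ℓ).add (h _ ℓ)

lemma lintegral_pairPowSum_le
    (hint : ∀ ℓ, Integrable (fun x => |f ℓ x| ^ p) (Measure.pi fun _ : Fin n => μ))
    (hγ : ∀ ℓ, ∫ x, |f ℓ x| ^ p ∂(Measure.pi fun _ : Fin n => μ) ≤ γ) (B : Finset (Fin n))
    (j : Fin n) :
    ∫⁻ c, ENNReal.ofReal (pairPowSum f p B j c) ∂(Measure.pi fun _ : Fin n => μ.prod μ)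
      ≤ ENNReal.ofReal (2 * n * γ) := by
  have hi : ∀ (B : Finset (Fin n)) ℓ, Integrable (fun c => |f ℓ (mix B c)| ^ p)
      (Measure.pi fun _ : Fin n => μ.prod μ) := fun B ℓ =>
    (measurePreserving_mix μ B).integrable_comp_of_integrable (hint ℓ)
  have hadd : ∀ ℓ, Integrable (fun c => |f ℓ (mix (B.erase j) c)| ^ p
      + |f ℓ (mix (insert j B) c)| ^ p) (Measure.pi fun _ : Fin n => μ.prod μ) := fun ℓ =>
    (hi _ ℓ).add (hi _ ℓ)
  have hI : Integrable (pairPowSum f p B j) (Measure.pi fun _ : Fin n => μ.prod μ) :=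
    integrable_finsetSum _ fun ℓ _ => hadd ℓ
  rw [← ofReal_integral_eq_lintegral_ofReal hI (ae_of_all _ fun c => pairPowSum_nonneg)]
  refine ENNReal.ofReal_le_ofReal ?_
  unfold pairPowSum
  rw [integral_finsetSum _ fun ℓ _ => hadd ℓ]
  have he : ∀ (B : Finset (Fin n)) ℓ, ∫ c, |f ℓ (mix B c)| ^ p
      ∂(Measure.pi fun _ : Fin n => μ.prod μ) ≤ γ := fun B ℓ =>
    (integral_comp_of_measurePreserving (measurePreserving_mix μ B)
      (g := fun x => |f ℓ x| ^ p) (hint ℓ).1).trans_le (hγ ℓ)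
  calc _ ≤ ∑ _ℓ : Fin n, (γ + γ) := Finset.sum_le_sum fun ℓ _ => by
        rw [integral_add (hi _ ℓ) (hi _ ℓ)]
        exact add_le_add (he _ ℓ) (he _ ℓ)
    _ = 2 * n * γ := by
        rw [Finset.sum_const, nsmul_eq_mul, Finset.card_univ, Fintype.card_fin]; ring

lemma measurable_localSum (hfm : ∀ ℓ, Measurable (f ℓ)) : Measurable (localSum f) :=
  (Finset.measurable_fun_sum _ fun ℓ _ => hfm ℓ).const_mul _

lemma memLp_localSum (hfm : ∀ ℓ, Measurable (f ℓ)) (hp : 8 ≤ p)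
    (hint : ∀ ℓ, Integrable (fun x => |f ℓ x| ^ p) (Measure.pi fun _ : Fin n => μ)) :
    MemLp (localSum f) 4 (Measure.pi fun _ : Fin n => μ) := by
  have hp0 : 0 < p := by linarith
  have h4 : ENNReal.ofReal 4 ≤ ENNReal.ofReal p := ENNReal.ofReal_le_ofReal (by linarith)
  rw [ENNReal.ofReal_ofNat] at h4
  have h : ∀ ℓ, MemLp (f ℓ) 4 (Measure.pi fun _ : Fin n => μ) := by
    intro ℓ
    have : MemLp (f ℓ) (ENNReal.ofReal p) (Measure.pi fun _ : Fin n => μ) := by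
      rw [← integrable_norm_rpow_iff (hfm ℓ).aestronglyMeasurable (by simpa using hp0) (by simp),
        ENNReal.toReal_ofReal hp0.le]
      exact hint ℓ
    exact this.mono_exponent h4
  have hs : MemLp (fun x => ∑ ℓ, f ℓ x) 4 (Measure.pi fun _ : Fin n => μ) :=
    memLp_finsetSum Finset.univ fun ℓ _ => h ℓ
  exact hs.const_mul (1 / √n)

/-- The third moments of the effects of resampling a point. -/
lemma integral_abs_resampleDiff_pow_three_le [IsStrictTotalOrder (EuclideanSpace ℝ (Fin d)) r]
    (hd : 1 ≤ d) (hfm : ∀ ℓ, Measurable (f ℓ)) (hf : ∀ ℓ, DependsOnlyOnNearest r k ℓ (f ℓ))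
    (hinj : ∀ᵐ x ∂(Measure.pi fun _ : Fin n => μ), Function.Injective x) (hp : 8 ≤ p)
    (hint : ∀ ℓ, Integrable (fun x => |f ℓ x| ^ p) (Measure.pi fun _ : Fin n => μ))
    (hγ0 : 0 ≤ γ) (hγ : ∀ ℓ, ∫ x, |f ℓ x| ^ p ∂(Measure.pi fun _ : Fin n => μ) ≤ γ) (j : Fin n) :
    ∫ c, |resampleDiff (localSum f) j c| ^ 3 ∂(Measure.pi fun _ : Fin n => μ.prod μ)
      ≤ (4 * (coneCoverNumber d * (k + 2) : ℕ) / √n) ^ 3 * (2 * n * γ) ^ (3 / p) := by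
  set a := 4 * ((coneCoverNumber d * (k + 2) : ℕ) : ℝ) / √n with ha
  have ha0 : 0 ≤ a := by positivity
  have hp0 : 0 < p := by linarith
  have hinj' : ∀ B : Finset (Fin n), ∀ᵐ c ∂(Measure.pi fun _ : Fin n => μ.prod μ),
      Function.Injective (mix B c) := fun B =>
    (measurePreserving_mix μ B).quasiMeasurePreserving.ae hinj
  have hm := measurable_resampleDiff (measurable_localSum hfm) j
  rw [integral_eq_lintegral_of_nonneg_ae (ae_of_all _ fun c => by positivity)
    ((hm.abs.pow_const 3).aestronglyMeasurable)]
  refine ENNReal.toReal_le_of_le_ofReal (by positivity) ?_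
  calc ∫⁻ c, ENNReal.ofReal (|resampleDiff (localSum f) j c| ^ 3)
        ∂(Measure.pi fun _ : Fin n => μ.prod μ)
      ≤ ∫⁻ c, ENNReal.ofReal (a ^ 3) * ENNReal.ofReal (pairPowSum f p ∅ j c) ^ (3 / p)
        ∂(Measure.pi fun _ : Fin n => μ.prod μ) := by
        refine lintegral_mono_ae ?_
        filter_upwards [hinj' ((∅ : Finset (Fin n)).erase j), hinj' (insert j ∅)] with c h1 h2
        have h3 := abs_resampleDiffOn_localSum_le (r := r) (k := k) (p := p) hd hf hp0 h1 h2
        have h4 : resampleDiffOn (localSum f) ∅ j c = resampleDiff (localSum f) j c := by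
          simp [resampleDiffOn, resampleDiff]
        rw [h4, ← ha] at h3
        rw [ENNReal.ofReal_rpow_of_nonneg pairPowSum_nonneg (by positivity),
          ← ENNReal.ofReal_mul (by positivity)]
        refine ENNReal.ofReal_le_ofReal ?_
        calc _ ≤ (a * pairPowSum f p ∅ j c ^ (1 / p)) ^ 3 := by gcongr
          _ = _ := by
            rw [mul_pow, ← Real.rpow_natCast (_ ^ (1 / p)), ← Real.rpow_mul pairPowSum_nonneg]
            congr 2
            push_cast
            ring
    _ = ENNReal.ofReal (a ^ 3) * ∫⁻ c, ENNReal.ofReal (pairPowSum f p ∅ j c) ^ (3 / p)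
        ∂(Measure.pi fun _ : Fin n => μ.prod μ) := lintegral_const_mul' _ _ (by simp)
    _ ≤ ENNReal.ofReal (a ^ 3) * ENNReal.ofReal (2 * n * γ) ^ (3 / p) := by
        gcongr
        refine (lintegral_rpow_le_rpow_lintegral
          (measurable_pairPowSum hfm p ∅ j).ennreal_ofReal.aemeasurable (by positivity) ?_).trans ?_
        · rw [div_le_one hp0]; linarith
        · gcongr
          exact lintegral_pairPowSum_le hint hγ ∅ j
    _ = _ := by
        rw [ENNReal.ofReal_rpow_of_nonneg (by positivity) (by positivity),
          ← ENNReal.ofReal_mul (by positivity)]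

end Moments

/-! ### Second-order resampling: the effect of one pair on `resampleCov` -/

section Variance

variable {n d k : ℕ} {r : EuclideanSpace ℝ (Fin d) → EuclideanSpace ℝ (Fin d) → Prop}
  {f : Fin n → (Fin n → EuclideanSpace ℝ (Fin d)) → ℝ} {p γ : ℝ}
  {μ : Measure (EuclideanSpace ℝ (Fin d))} [IsProbabilityMeasure μ]

/-- The fourth moment of the number of terms that change when a point is resampled. -/
lemma lintegral_changeCount_pow_four_le [IsStrictTotalOrder (EuclideanSpace ℝ (Fin d)) r]
    (hd : 1 ≤ d)
    (hr : MeasurableSet {q : EuclideanSpace ℝ (Fin d) × EuclideanSpace ℝ (Fin d) | r q.1 q.2})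
    (hinj : ∀ᵐ x ∂(Measure.pi fun _ : Fin n => μ), Function.Injective x)
    (K : ℕ) (B : Finset (Fin n)) (i : Fin n) :
    ∫⁻ e, (changeCount r K B i (mix ∅ e) (mix {i} e) : ENNReal) ^ 4
        ∂(Measure.pi fun _ : Fin n => (μ.prod μ).prod (μ.prod μ))
      ≤ ((2 ^ 10 * ((coneCoverNumber d * (K + 6)) * (K + 4)) ^ 2 : ℕ) : ENNReal) ^ 2 := by
  set g := (coneCoverNumber d * (K + 6)) * (K + 4) with hg
  have hg1 : 1 ≤ g := by
    have := one_le_coneCoverNumber hd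
    exact Nat.one_le_iff_ne_zero.2 (by positivity)
  have hcast : Measurable (fun m : ℕ => (m : ENNReal)) := measurable_from_top
  have hcm : ∀ q : Bool × Bool × Bool, Measurable
      (fun c => (interactCount r K q.1 (if q.2.1 then B else ∅) i c : ENNReal) ^ 4) := fun q =>
    (hcast.comp (measurable_interactCount hr K q.1 _ i)).pow_const 4
  have hq : ∀ q : Bool × Bool × Bool,
      ∫⁻ e, (interactCount r K q.1 (if q.2.1 then B else ∅) i
        (if q.2.2 then mix {i} e else mix ∅ e) : ENNReal) ^ 4
        ∂(Measure.pi fun _ : Fin n => (μ.prod μ).prod (μ.prod μ)) ≤ ((16 * g ^ 4 : ℕ) : ENNReal) := by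
    intro q
    have h1 : ∀ e : Fin n → (EuclideanSpace ℝ (Fin d) × EuclideanSpace ℝ (Fin d)) ×
        (EuclideanSpace ℝ (Fin d) × EuclideanSpace ℝ (Fin d)),
        (if q.2.2 then mix {i} e else mix ∅ e) = mix (if q.2.2 then {i} else ∅) e := by
      intro e; split_ifs <;> rfl
    simp only [h1]
    rw [(measurePreserving_mix (μ.prod μ) (if q.2.2 then {i} else ∅)).lintegral_comp (hcm q)]
    exact lintegral_interactCount_pow_four_le μ hd hr hinj K _ _ i
  -- The constant 4096 is 8 · 8³: the first factor comes from (1 + s)⁴ ≤ 8(1 + s⁴), the second from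
  -- the power mean of eight counts.
  have hpt : ∀ e : Fin n → (EuclideanSpace ℝ (Fin d) × EuclideanSpace ℝ (Fin d)) ×
        (EuclideanSpace ℝ (Fin d) × EuclideanSpace ℝ (Fin d)),
      (changeCount r K B i (mix ∅ e) (mix {i} e) : ENNReal) ^ 4
      ≤ 8 + ∑ q : Bool × Bool × Bool, 4096 * (interactCount r K q.1 (if q.2.1 then B else ∅) i
        (if q.2.2 then mix {i} e else mix ∅ e) : ENNReal) ^ 4 := by
    intro e
    have h1 : changeCount r K B i (mix ∅ e) (mix {i} e) ^ 4
        ≤ 8 + ∑ q : Bool × Bool × Bool, 4096 * interactCount r K q.1 (if q.2.1 then B else ∅) i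
          (if q.2.2 then mix {i} e else mix ∅ e) ^ 4 := by
      rw [changeCount]
      refine (add_pow_le (Nat.zero_le _) (Nat.zero_le _) 4).trans ?_
      have := sum_pow_four_le (Finset.univ : Finset (Bool × Bool × Bool)) fun q =>
        interactCount r K q.1 (if q.2.1 then B else ∅) i (if q.2.2 then mix {i} e else mix ∅ e)
      rw [Finset.card_univ, show Fintype.card (Bool × Bool × Bool) = 8 by simp] at this
      rw [← Finset.mul_sum]
      omega
    exact_mod_cast h1
  have hqm : ∀ q : Bool × Bool × Bool, Measurable
      (fun e : Fin n → (EuclideanSpace ℝ (Fin d) × EuclideanSpace ℝ (Fin d)) ×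
        (EuclideanSpace ℝ (Fin d) × EuclideanSpace ℝ (Fin d)) =>
        4096 * (interactCount r K q.1 (if q.2.1 then B else ∅) i
        (if q.2.2 then mix {i} e else mix ∅ e) : ENNReal) ^ 4) := by
    intro q
    refine Measurable.const_mul ?_ _
    by_cases h : q.2.2
    · simpa [h, Function.comp_def] using (hcm q).comp (measurable_mix {i})
    · simpa [h, Function.comp_def] using (hcm q).comp (measurable_mix ∅)
  calc _ ≤ _ := lintegral_mono hpt
    _ = 8 + ∑ q : Bool × Bool × Bool, 4096 * ∫⁻ e, (interactCount r K q.1 (if q.2.1 then B else ∅) i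
        (if q.2.2 then mix {i} e else mix ∅ e) : ENNReal) ^ 4
        ∂(Measure.pi fun _ : Fin n => (μ.prod μ).prod (μ.prod μ)) := by
        rw [lintegral_add_left measurable_const, lintegral_finsetSum _ fun q _ => hqm q]
        congr 1
        · simp
        · exact Finset.sum_congr rfl fun q _ => lintegral_const_mul' _ _ (by simp)
    _ ≤ 8 + ∑ q : Bool × Bool × Bool, 4096 * ((16 * g ^ 4 : ℕ) : ENNReal) := by
        gcongr with q _
        exact hq q
    _ = ((8 + 8 * (4096 * (16 * g ^ 4)) : ℕ) : ENNReal) := by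
        rw [Finset.sum_const, Finset.card_univ, show Fintype.card (Bool × Bool × Bool) = 8 by simp]
        push_cast
        simp
    _ ≤ _ := by
        have : 8 + 8 * (4096 * (16 * g ^ 4)) ≤ (2 ^ 10 * g ^ 2) ^ 2 := by
          have h4 : 1 ≤ g ^ 4 := Nat.one_le_pow _ _ hg1
          calc _ ≤ 2 ^ 20 * g ^ 4 := by omega
            _ = _ := by ring
        exact_mod_cast this

/-- The mean square of the effect of resampling a point on `resampleCov`. -/
lemma integral_resampleDiff_resampleCov_sq_le [IsStrictTotalOrder (EuclideanSpace ℝ (Fin d)) r]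
    (hd : 1 ≤ d)
    (hr : MeasurableSet {q : EuclideanSpace ℝ (Fin d) × EuclideanSpace ℝ (Fin d) | r q.1 q.2})
    (hfm : ∀ ℓ, Measurable (f ℓ)) (hf : ∀ ℓ, DependsOnlyOnNearest r k ℓ (f ℓ))
    (hinj : ∀ᵐ x ∂(Measure.pi fun _ : Fin n => μ), Function.Injective x) (hp : 8 ≤ p)
    (hint : ∀ ℓ, Integrable (fun x => |f ℓ x| ^ p) (Measure.pi fun _ : Fin n => μ))
    (hγ0 : 0 ≤ γ) (hγ : ∀ ℓ, ∫ x, |f ℓ x| ^ p ∂(Measure.pi fun _ : Fin n => μ) ≤ γ)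
    (B : Finset (Fin n)) (i : Fin n) :
    ∫ e, resampleDiff (resampleCov (localSum f) B) i e ^ 2
        ∂(Measure.pi fun _ : Fin n => (μ.prod μ).prod (μ.prod μ))
      ≤ (4 * (coneCoverNumber d * (k + 2) : ℕ) / √n) ^ 4 *
        (2 ^ 10 * ((coneCoverNumber d * (k + 7)) * (k + 5)) ^ 2 : ℕ) *
        (8 * n ^ 2 * γ) ^ (4 / p) := by
  set a := 4 * ((coneCoverNumber d * (k + 2) : ℕ) : ℝ) / √n with ha
  set G : ℕ := 2 ^ 10 * ((coneCoverNumber d * (k + 7)) * (k + 5)) ^ 2 with hG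
  set Q2 := Measure.pi fun _ : Fin n => (μ.prod μ).prod (μ.prod μ) with hQ2
  have ha0 : 0 ≤ a := by positivity
  have hp0 : 0 < p := by linarith
  have hinjQ : ∀ B : Finset (Fin n), ∀ᵐ c ∂(Measure.pi fun _ : Fin n => μ.prod μ),
      Function.Injective (mix B c) := fun B =>
    (measurePreserving_mix μ B).quasiMeasurePreserving.ae hinj
  have hinjQ2 : ∀ S : Finset (Fin n), ∀ᵐ e ∂Q2, ∀ B : Finset (Fin n),
      Function.Injective (mix B (mix S e)) := fun S =>
    ae_all_iff.2 fun B => (measurePreserving_mix (μ.prod μ) S).quasiMeasurePreserving.ae (hinjQ B)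
  -- One variable dominating every summand in all configurations: B or ∅, before or after resampling
  -- pair i, and all j. Its mean is at most 4 · n · 2nγ.
  set z : (Fin n → (EuclideanSpace ℝ (Fin d) × EuclideanSpace ℝ (Fin d)) ×
        (EuclideanSpace ℝ (Fin d) × EuclideanSpace ℝ (Fin d))) → ℝ := fun e =>
    ∑ s : Bool × Bool, ∑ j, pairPowSum f p (if s.1 then B else ∅) j
      (mix (if s.2 then {i} else ∅) e) with hz
  have hz0 : ∀ e, 0 ≤ z e := fun e =>
    Finset.sum_nonneg fun s _ => Finset.sum_nonneg fun j _ => pairPowSum_nonneg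
  have hzle : ∀ e (s : Bool × Bool) j, pairPowSum f p (if s.1 then B else ∅) j
      (mix (if s.2 then {i} else ∅) e) ≤ z e := by
    intro e s j
    refine le_trans ?_ (Finset.single_le_sum
      (f := fun s : Bool × Bool => ∑ j, pairPowSum f p (if s.1 then B else ∅) j
        (mix (if s.2 then {i} else ∅) e))
      (fun s _ => Finset.sum_nonneg fun j _ => pairPowSum_nonneg) (Finset.mem_univ s))
    exact Finset.single_le_sum (f := fun j => pairPowSum f p (if s.1 then B else ∅) j
        (mix (if s.2 then {i} else ∅) e)) (fun j _ => pairPowSum_nonneg) (Finset.mem_univ j)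
  have hpm : ∀ (s : Bool × Bool) j, Measurable fun c =>
      ENNReal.ofReal (pairPowSum f p (if s.1 then B else ∅) j c) := fun s j =>
    (measurable_pairPowSum hfm p _ j).ennreal_ofReal
  have hpmc : ∀ (s : Bool × Bool) j, Measurable fun e : Fin n →
      (EuclideanSpace ℝ (Fin d) × EuclideanSpace ℝ (Fin d)) ×
        (EuclideanSpace ℝ (Fin d) × EuclideanSpace ℝ (Fin d)) =>
      ENNReal.ofReal (pairPowSum f p (if s.1 then B else ∅) j
        (mix (if s.2 then {i} else ∅) e)) := fun s j => (hpm s j).comp (measurable_mix _)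
  have hzm : Measurable z :=
    Finset.measurable_fun_sum _ fun s _ => Finset.measurable_fun_sum _ fun j _ =>
      (measurable_pairPowSum hfm p _ j).comp (measurable_mix _)
  have hzint : ∫⁻ e, ENNReal.ofReal (z e) ∂Q2 ≤ ENNReal.ofReal (8 * n ^ 2 * γ) := by
    have e1 : ∀ e, ENNReal.ofReal (z e) = ∑ s : Bool × Bool, ∑ j,
        ENNReal.ofReal (pairPowSum f p (if s.1 then B else ∅) j
          (mix (if s.2 then {i} else ∅) e)) := by
      intro e
      simp only [hz]
      rw [ENNReal.ofReal_sum_of_nonneg fun s _ => Finset.sum_nonneg fun j _ => pairPowSum_nonneg]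
      exact Finset.sum_congr rfl fun s _ =>
        ENNReal.ofReal_sum_of_nonneg fun j _ => pairPowSum_nonneg
    simp only [e1]
    rw [lintegral_finsetSum _ fun s _ => Finset.measurable_fun_sum _ fun j _ =>
      hpmc s j]
    have e2 : ∀ s : Bool × Bool, ∫⁻ e, ∑ j, ENNReal.ofReal (pairPowSum f p (if s.1 then B else ∅) j
          (mix (if s.2 then {i} else ∅) e)) ∂Q2 ≤ ENNReal.ofReal (n * (2 * n * γ)) := by
      intro s
      rw [lintegral_finsetSum _ fun j _ => hpmc s j,
        ENNReal.ofReal_mul (by positivity), ENNReal.ofReal_natCast]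
      calc _ ≤ ∑ _j : Fin n, ENNReal.ofReal (2 * n * γ) := Finset.sum_le_sum fun j _ => by
            rw [hQ2, (measurePreserving_mix (μ.prod μ) (if s.2 then {i} else ∅)).lintegral_comp
              (hpm s j)]
            exact lintegral_pairPowSum_le hint hγ _ j
        _ = _ := by simp
    calc _ ≤ ∑ _s : Bool × Bool, ENNReal.ofReal (n * (2 * n * γ)) :=
          Finset.sum_le_sum fun s _ => e2 s
      _ = _ := by
          rw [Finset.sum_const, Finset.card_univ, show Fintype.card (Bool × Bool) = 4 by simp,
            nsmul_eq_mul, show ((4 : ℕ) : ENNReal) = ENNReal.ofReal 4 by simp,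
            ← ENNReal.ofReal_mul (by norm_num)]
          congr 1
          ring
  have hδm : Measurable fun e : Fin n → (EuclideanSpace ℝ (Fin d) × EuclideanSpace ℝ (Fin d)) ×
        (EuclideanSpace ℝ (Fin d) × EuclideanSpace ℝ (Fin d)) =>
      (changeCount r (k + 1) B i (mix ∅ e) (mix {i} e) : ENNReal) := by
    refine (measurable_from_top (f := fun m : ℕ => (m : ENNReal))).comp ?_
    unfold changeCount
    refine measurable_const.add (Finset.measurable_fun_sum _ fun q _ => ?_)
    by_cases h : q.2.2
    · simpa [h, Function.comp_def] using
        (measurable_interactCount hr (k + 1) _ _ i).comp (measurable_mix {i})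
    · simpa [h, Function.comp_def] using
        (measurable_interactCount hr (k + 1) _ _ i).comp (measurable_mix ∅)
  have hpt : ∀ᵐ e ∂Q2, ENNReal.ofReal (resampleDiff (resampleCov (localSum f) B) i e ^ 2)
      ≤ ENNReal.ofReal (a ^ 4) * ((changeCount r (k + 1) B i (mix ∅ e) (mix {i} e) : ENNReal) ^ 2
        * ENNReal.ofReal (z e) ^ (4 / p)) := by
    filter_upwards [hinjQ2 ∅, hinjQ2 {i}] with e h0 h1
    -- This is the uniform bound M required by `abs_resampleCov_sub_le`.
    have hD : ∀ (b : Bool) j, |resampleDiff (localSum f) j (mix (if b then {i} else ∅) e)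
        * resampleDiffOn (localSum f) B j (mix (if b then {i} else ∅) e)| ≤ a ^ 2 * z e ^ (2 / p) := by
      intro b j
      have hI : ∀ B' : Finset (Fin n), Function.Injective (mix B' (mix (if b then {i} else ∅) e)) := by
        cases b
        · simpa using h0
        · simpa using h1
      have key : ∀ t : Bool, |resampleDiffOn (localSum f) (if t then B else ∅) j
          (mix (if b then {i} else ∅) e)| ≤ a * z e ^ (1 / p) := by
        intro t
        refine (abs_resampleDiffOn_localSum_le (r := r) (k := k) (p := p) hd hf hp0
          (hI _) (hI _)).trans ?_
        rw [← ha]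
        gcongr
        · exact pairPowSum_nonneg
        · exact hzle e (t, b) j
      have k1 := key false
      have k2 := key true
      simp only [Bool.false_eq_true, if_false, if_true] at k1 k2
      have h4 : resampleDiffOn (localSum f) ∅ j (mix (if b then {i} else ∅) e)
          = resampleDiff (localSum f) j (mix (if b then {i} else ∅) e) := by
        simp [resampleDiffOn, resampleDiff]
      rw [h4] at k1
      rw [abs_mul]
      calc _ ≤ (a * z e ^ (1 / p)) * (a * z e ^ (1 / p)) :=
            mul_le_mul k1 k2 (abs_nonneg _) (mul_nonneg ha0 (Real.rpow_nonneg (hz0 e) _))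
        _ = a ^ 2 * (z e ^ (1 / p)) ^ 2 := by ring
        _ = _ := by
            rw [← Real.rpow_natCast (z e ^ (1 / p)), ← Real.rpow_mul (hz0 e)]
            congr 2
            push_cast
            ring
    have hdiff := abs_resampleCov_sub_le (r := r) (k := k) (B := B) (i := i) (c := mix ∅ e)
      (c' := mix {i} e) hf (fun m hm => by simp [mix, hm])
      (fun j => by simpa using hD false j) (fun j => by simpa using hD true j)
    rw [← ENNReal.ofReal_natCast, ← ENNReal.ofReal_pow (by positivity),
      ENNReal.ofReal_rpow_of_nonneg (hz0 e) (by positivity),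
      ← ENNReal.ofReal_mul (by positivity), ← ENNReal.ofReal_mul (by positivity)]
    refine ENNReal.ofReal_le_ofReal ?_
    rw [← sq_abs]
    calc _ ≤ (changeCount r (k + 1) B i (mix ∅ e) (mix {i} e) * (a ^ 2 * z e ^ (2 / p))) ^ 2 := by
          gcongr
          exact hdiff
      _ = a ^ 4 * ((changeCount r (k + 1) B i (mix ∅ e) (mix {i} e) : ℝ) ^ 2
          * (z e ^ (2 / p)) ^ 2) := by ring
      _ = _ := by
          rw [← Real.rpow_natCast (z e ^ (2 / p)), ← Real.rpow_mul (hz0 e)]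
          congr 3
          push_cast
          ring
  have hTm : Measurable (resampleDiff (resampleCov (localSum f) B) i) :=
    measurable_resampleDiff (measurable_resampleCov (measurable_localSum hfm) B) i
  rw [integral_eq_lintegral_of_nonneg_ae (ae_of_all _ fun e => sq_nonneg _)
    (hTm.pow_const 2).aestronglyMeasurable]
  refine ENNReal.toReal_le_of_le_ofReal (by positivity) ?_
  calc _ ≤ _ := lintegral_mono_ae hpt
    _ = ENNReal.ofReal (a ^ 4) * ∫⁻ e, (changeCount r (k + 1) B i (mix ∅ e) (mix {i} e) : ENNReal) ^ 2
        * ENNReal.ofReal (z e) ^ (4 / p) ∂Q2 := lintegral_const_mul' _ _ (by simp)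
    _ ≤ ENNReal.ofReal (a ^ 4) * ((G : ENNReal) * ENNReal.ofReal (8 * n ^ 2 * γ) ^ (4 / p)) := by
        gcongr
        refine (lintegral_sq_mul_rpow_le hδm.aemeasurable hzm.ennreal_ofReal.aemeasurable
          (by positivity) ?_).trans ?_
        · rw [div_le_div_iff₀ hp0 (by norm_num)]; linarith
        · gcongr
          calc _ ≤ ((G : ENNReal) ^ 2) ^ (1 / 2 : ℝ) := by
                gcongr
                exact lintegral_changeCount_pow_four_le hd hr hinj (k + 1) B i
            _ = G := by
                rw [← ENNReal.rpow_two, ← ENNReal.rpow_mul]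
                norm_num
    _ = _ := by
        rw [ENNReal.ofReal_rpow_of_nonneg (by positivity) (by positivity),
          ← ENNReal.ofReal_natCast, ← ENNReal.ofReal_mul (by positivity),
          ← ENNReal.ofReal_mul (by positivity)]
        congr 1
        ring

end Variance

/-! ### Collecting the bounds and the powers of n -/

section Main

variable {n d k : ℕ} {r : EuclideanSpace ℝ (Fin d) → EuclideanSpace ℝ (Fin d) → Prop}
  {f : Fin n → (Fin n → EuclideanSpace ℝ (Fin d)) → ℝ} {p γ : ℝ}
  {μ : Measure (EuclideanSpace ℝ (Fin d))} [IsProbabilityMeasure μ]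

lemma variance_resampleCov_localSum_le [IsStrictTotalOrder (EuclideanSpace ℝ (Fin d)) r]
    (hd : 1 ≤ d)
    (hr : MeasurableSet {q : EuclideanSpace ℝ (Fin d) × EuclideanSpace ℝ (Fin d) | r q.1 q.2})
    (hfm : ∀ ℓ, Measurable (f ℓ)) (hf : ∀ ℓ, DependsOnlyOnNearest r k ℓ (f ℓ))
    (hinj : ∀ᵐ x ∂(Measure.pi fun _ : Fin n => μ), Function.Injective x) (hp : 8 ≤ p)
    (hint : ∀ ℓ, Integrable (fun x => |f ℓ x| ^ p) (Measure.pi fun _ : Fin n => μ))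
    (hγ0 : 0 ≤ γ) (hγ : ∀ ℓ, ∫ x, |f ℓ x| ^ p ∂(Measure.pi fun _ : Fin n => μ) ≤ γ)
    (B : Finset (Fin n)) :
    Var[resampleCov (localSum f) B; Measure.pi fun _ : Fin n => μ.prod μ]
      ≤ (23 * √n * (4 * (coneCoverNumber d * (k + 2) : ℕ) / √n) ^ 2 *
        ((coneCoverNumber d * (k + 7)) * (k + 5) : ℕ) * (8 * n ^ 2 * γ) ^ (2 / p)) ^ 2 := by
  set a := 4 * ((coneCoverNumber d * (k + 2) : ℕ) : ℝ) / √n with ha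
  set g : ℕ := (coneCoverNumber d * (k + 7)) * (k + 5) with hg
  have hγn : (0 : ℝ) ≤ 8 * n ^ 2 * γ := by positivity
  refine (efron_stein (μ.prod μ) (measurable_resampleCov (measurable_localSum hfm) B)
    (memLp_resampleCov μ (memLp_localSum hfm hp hint) B)).trans ?_
  calc _ ≤ 1 / 2 * ∑ _i : Fin n, a ^ 4 * (2 ^ 10 * g ^ 2 : ℕ) * (8 * n ^ 2 * γ) ^ (4 / p) := by
        gcongr with i _
        exact integral_resampleDiff_resampleCov_sq_le hd hr hfm hf hinj hp hint hγ0 hγ B i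
    _ = 512 * (n * (a ^ 4 * g ^ 2 * (8 * n ^ 2 * γ) ^ (4 / p))) := by
        rw [Finset.sum_const, nsmul_eq_mul, Finset.card_univ, Fintype.card_fin]
        push_cast
        ring
    -- 512 = 2¹⁰/2 is rounded up to the square 529, so that the bound is a perfect square.
    _ ≤ 23 ^ 2 * (n * (a ^ 4 * g ^ 2 * (8 * n ^ 2 * γ) ^ (4 / p))) := by
        gcongr
        norm_num
    _ = _ := by
        have h1 : (8 * (n : ℝ) ^ 2 * γ) ^ (4 / p) = ((8 * (n : ℝ) ^ 2 * γ) ^ (2 / p)) ^ 2 := by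
          rw [← Real.rpow_natCast (_ ^ (2 / p)), ← Real.rpow_mul hγn]
          congr 1
          push_cast
          ring
        have h2 : (n : ℝ) = √n ^ 2 := (Real.sq_sqrt (Nat.cast_nonneg n)).symm
        rw [h1]
        generalize (8 * (n : ℝ) ^ 2 * γ) ^ (2 / p) = u
        rw [mul_pow, mul_pow, mul_pow, mul_pow, ← h2]
        ring

lemma distToNormal_localSum_le [IsStrictTotalOrder (EuclideanSpace ℝ (Fin d)) r]
    (hn : 1 ≤ n) (hd : 1 ≤ d) (hk : 1 ≤ k)
    (hr : MeasurableSet {q : EuclideanSpace ℝ (Fin d) × EuclideanSpace ℝ (Fin d) | r q.1 q.2})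
    (hfm : ∀ ℓ, Measurable (f ℓ)) (hf : ∀ ℓ, DependsOnlyOnNearest r k ℓ (f ℓ))
    (hinj : ∀ᵐ x ∂(Measure.pi fun _ : Fin n => μ), Function.Injective x) (hp : 8 ≤ p)
    (hint : ∀ ℓ, Integrable (fun x => |f ℓ x| ^ p) (Measure.pi fun _ : Fin n => μ))
    (hγ0 : 0 ≤ γ) (hγ : ∀ ℓ, ∫ x, |f ℓ x| ^ p ∂(Measure.pi fun _ : Fin n => μ) ≤ γ)
    {σ : ℝ} (hσ : 0 < σ) (hσf : σ = √(Var[localSum f; Measure.pi fun _ : Fin n => μ])) :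
    distToNormal (Measure.pi fun _ : Fin n => μ) (localSum f) ≤ ENNReal.ofReal
      (10 ^ 7 * ((coneCoverNumber d : ℝ) ^ 3 * (k : ℝ) ^ 4 * γ ^ (2 / p)
          / (σ ^ 2 * (n : ℝ) ^ ((p - 8) / (2 * p))))
        + 10 ^ 7 * ((coneCoverNumber d : ℝ) ^ 3 * (k : ℝ) ^ 3 * γ ^ (3 / p)
          / (σ ^ 3 * (n : ℝ) ^ ((p - 6) / (2 * p))))) := by
  have hp0 : 0 < p := by linarith
  have hn0 : (0 : ℝ) < n := by exact_mod_cast hn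
  set a := 4 * ((coneCoverNumber d * (k + 2) : ℕ) : ℝ) / √n with ha
  have key := distToNormal_le μ (measurable_localSum hfm) (memLp_localSum hfm hp hint) hσ hσf
    (variance_resampleCov_localSum_le hd hr hfm hf hinj hp hint hγ0 hγ)
    (R := n * (a ^ 3 * (2 * n * γ) ^ (3 / p))) (by
      calc _ ≤ ∑ _j : Fin n, a ^ 3 * (2 * n * γ) ^ (3 / p) := Finset.sum_le_sum fun j _ =>
            integral_abs_resampleDiff_pow_three_le hd hfm hf hinj hp hint hγ0 hγ j
        _ = _ := by rw [Finset.sum_const, nsmul_eq_mul, Finset.card_univ, Fintype.card_fin])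
  refine key.trans (ENNReal.ofReal_le_ofReal ?_)
  rw [Real.sqrt_sq (by positivity), ← ha]
  set α : ℝ := ((coneCoverNumber d : ℕ) : ℝ) with hα
  have hk1 : (1 : ℝ) ≤ k := by exact_mod_cast hk
  have hα0 : 0 ≤ α := by positivity
  set s := √(n : ℝ) with hs
  have hs0 : 0 < s := Real.sqrt_pos.2 hn0
  have hss : (n : ℝ) = s ^ 2 := (Real.sq_sqrt hn0.le).symm
  have hsr : s = (n : ℝ) ^ (1 / 2 : ℝ) := Real.sqrt_eq_rpow _
  -- 4(k + 2) ≤ 12k, as k ≥ 1.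
  have hale : a ≤ 12 * (α * k) / s := by
    rw [ha]
    push_cast
    rw [← hα]
    refine div_le_div_of_nonneg_right ?_ hs0.le
    nlinarith [mul_le_mul_of_nonneg_left hk1 hα0]
  have ha0 : 0 ≤ a := by positivity
  -- 2/p ≤ 1/3 because p ≥ 6.
  have h8 : (8 : ℝ) ^ (2 / p) ≤ 2 := by
    calc (8 : ℝ) ^ (2 / p) ≤ 8 ^ (1 / 3 : ℝ) := by
          refine Real.rpow_le_rpow_of_exponent_le (by norm_num) ?_
          rw [div_le_div_iff₀ hp0 (by norm_num)]
          linarith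
      _ = 2 := by
          rw [show (8 : ℝ) = 2 ^ (3 : ℝ) by norm_num, ← Real.rpow_mul (by norm_num)]
          norm_num
  have h2 : (2 : ℝ) ^ (3 / p) ≤ 2 := by
    calc (2 : ℝ) ^ (3 / p) ≤ 2 ^ (1 : ℝ) := by
          refine Real.rpow_le_rpow_of_exponent_le (by norm_num) ?_
          rw [div_le_one hp0]
          linarith
      _ = 2 := by norm_num
  refine add_le_add ?_ ?_
  · set E := (n : ℝ) ^ ((p - 8) / (2 * p)) with hE
    set F := (n : ℝ) ^ (4 / p) with hF
    have hE0 : 0 < E := by positivity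
    have hF0 : 0 < F := by positivity
    -- The exponents add up to (p - 8)/(2p) + 4/p = 1/2: the rate n^(-1/2) less the loss n^(4/p). In
    -- the second term the loss is n^(3/p).
    have hEF : E * F = s := by
      rw [hE, hF, hsr, ← Real.rpow_add hn0]
      congr 1
      field_simp
      ring
    have e1 : (8 * (n : ℝ) ^ 2 * γ) ^ (2 / p) = 8 ^ (2 / p) * F * γ ^ (2 / p) := by
      rw [Real.mul_rpow (by positivity) hγ0, Real.mul_rpow (by norm_num) (by positivity),
        ← Real.rpow_natCast (n : ℝ) 2, ← Real.rpow_mul hn0.le, hF]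
      congr 3
      push_cast
      ring
    -- k + 7 ≤ 8k and k + 5 ≤ 6k.
    have hg : (((coneCoverNumber d * (k + 7)) * (k + 5) : ℕ) : ℝ) ≤ 48 * (α * k ^ 2) := by
      push_cast
      rw [← hα]
      have : ((k : ℝ) + 7) * (k + 5) ≤ 48 * k ^ 2 := by nlinarith
      calc α * (k + 7) * (k + 5) = α * ((k + 7) * (k + 5)) := by ring
        _ ≤ α * (48 * k ^ 2) := by gcongr
        _ = _ := by ring
    have hFE : F / s = 1 / E := by
      rw [← hEF]
      field_simp
    calc 12 * (23 * s * a ^ 2 * (((coneCoverNumber d * (k + 7)) * (k + 5) : ℕ) : ℝ)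
          * (8 * (n : ℝ) ^ 2 * γ) ^ (2 / p)) / σ ^ 2
        ≤ 12 * (23 * s * (12 * (α * k) / s) ^ 2 * (48 * (α * k ^ 2))
          * (2 * F * γ ^ (2 / p))) / σ ^ 2 := by
          rw [e1]
          gcongr
      _ = 3815424 * (α ^ 3 * k ^ 4 * γ ^ (2 / p) * (F / s) / σ ^ 2) := by
          field_simp
          ring
      _ ≤ 10 ^ 7 * (α ^ 3 * k ^ 4 * γ ^ (2 / p) * (F / s) / σ ^ 2) := by
          gcongr
          norm_num
      _ = _ := by
          rw [hFE]
          field_simp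
  · set E := (n : ℝ) ^ ((p - 6) / (2 * p)) with hE
    set F := (n : ℝ) ^ (3 / p) with hF
    have hE0 : 0 < E := by positivity
    have hF0 : 0 < F := by positivity
    have hEF : E * F = s := by
      rw [hE, hF, hsr, ← Real.rpow_add hn0]
      congr 1
      field_simp
      ring
    have e1 : (2 * (n : ℝ) * γ) ^ (3 / p) = 2 ^ (3 / p) * F * γ ^ (3 / p) := by
      rw [Real.mul_rpow (by positivity) hγ0, Real.mul_rpow (by norm_num) (by positivity)]
    have hFE : F / s = 1 / E := by
      rw [← hEF]
      field_simp
    calc 6 * ((n : ℝ) * (a ^ 3 * (2 * n * γ) ^ (3 / p))) / σ ^ 3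
        ≤ 6 * ((n : ℝ) * ((12 * (α * k) / s) ^ 3 * (2 * F * γ ^ (3 / p)))) / σ ^ 3 := by
          rw [e1]
          gcongr
      _ = 20736 * (α ^ 3 * k ^ 3 * γ ^ (3 / p) * (F / s) / σ ^ 3) := by
          rw [hss]
          field_simp
          ring
      _ ≤ 10 ^ 7 * (α ^ 3 * k ^ 3 * γ ^ (3 / p) * (F / s) / σ ^ 3) := by
          gcongr
          norm_num
      _ = _ := by
          rw [hFE]
          field_simp

end Main

/-- The distance to normality depends only on the law of the random variable. -/
lemma distToNormal_comp {Ω Ω' : Type*} [MeasurableSpace Ω] [MeasurableSpace Ω'] {P : Measure Ω}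
    {J : Ω → Ω'} (hJ : Measurable J) {g : Ω' → ℝ} (hg : Measurable g) :
    distToNormal P (fun ω => g (J ω)) = distToNormal (P.map J) g := by
  unfold distToNormal
  have h1 : ∫ x, g x ∂(P.map J) = ∫ ω, g (J ω) ∂P :=
    integral_map hJ.aemeasurable hg.aestronglyMeasurable
  have h2 : variance g (P.map J) = variance (fun ω => g (J ω)) P :=
    variance_map hg.aemeasurable hJ.aemeasurable
  rw [h1, h2, Measure.map_map ((hg.sub_const _).div_const _) hJ]
  rfl

end

theorem theorem3p4 :
    ∃ C : ℝ, 0 < C ∧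
      ∀ (n d k : ℕ) (hn : 4 ≤ n) (_ : 1 ≤ d) (_ : 1 ≤ k)
        -- the order that is used to break ties between equal distances
        (r : EuclideanSpace ℝ (Fin d) → EuclideanSpace ℝ (Fin d) → Prop)
        (_ : IsStrictTotalOrder (EuclideanSpace ℝ (Fin d)) r)
        (_ : MeasurableSet
          {q : EuclideanSpace ℝ (Fin d) × EuclideanSpace ℝ (Fin d) | r q.1 q.2})
        -- the i.i.d. random vectors
        (Ω : Type*) (_ : MeasurableSpace Ω) (P : Measure Ω) (_ : IsProbabilityMeasure P)
        (X : Fin n → Ω → EuclideanSpace ℝ (Fin d))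
        (_ : ∀ i, Measurable (X i))
        (_ : iIndepFun X P)
        (_ : ∀ i j, IdentDistrib (X i) (X j) P P)
        (_ : ∀ t : ℝ, P {ω | ‖X ⟨0, by omega⟩ ω - X ⟨1, by omega⟩ ω‖ = t} = 0)
        -- the summands
        (f : Fin n → (Fin n → EuclideanSpace ℝ (Fin d)) → ℝ)
        (_ : ∀ ℓ, Measurable (f ℓ))
        (_ : ∀ ℓ, DependsOnlyOnNearest r k ℓ (f ℓ))
        (p : ℝ) (_ : 8 ≤ p)
        (_ : ∀ ℓ, Integrable (fun ω => |f ℓ (fun i => X i ω)| ^ p) P)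
        (γ : ℝ) (_ : γ = ⨆ ℓ, ∫ ω, |f ℓ (fun i => X i ω)| ^ p ∂P)
        (W : Ω → ℝ) (_ : W = fun ω => localSum f (fun i => X i ω))
        (σ : ℝ) (_ : σ = Real.sqrt (variance W P)) (_ : 0 < σ),
        distToNormal P W ≤ ENNReal.ofReal
          (C * ((coneCoverNumber d : ℝ) ^ 3 * (k : ℝ) ^ 4 * γ ^ (2 / p)
              / (σ ^ 2 * (n : ℝ) ^ ((p - 8) / (2 * p))))
            + C * ((coneCoverNumber d : ℝ) ^ 3 * (k : ℝ) ^ 3 * γ ^ (3 / p)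
              / (σ ^ 3 * (n : ℝ) ^ ((p - 6) / (2 * p))))) := by
  refine ⟨10 ^ 7, by norm_num, ?_⟩
  intro n d k hn hd hk r hro hr Ω _ P _ X hX hind hid hcont f hfm hf p hp hint γ hγ W hW σ hσ hσ0
  set μ : Measure (EuclideanSpace ℝ (Fin d)) := P.map (X ⟨0, by omega⟩) with hμ
  have : IsProbabilityMeasure μ := Measure.isProbabilityMeasure_map (hX _).aemeasurable
  have hμi : ∀ i, P.map (X i) = μ := fun i => (hid i ⟨0, by omega⟩).map_eq
  have hJm : Measurable fun ω i => X i ω := measurable_pi_lambda _ hX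
  have hJ : P.map (fun ω i => X i ω) = Measure.pi fun _ : Fin n => μ := by
    rw [(iIndepFun_iff_map_fun_eq_pi_map fun i => (hX i).aemeasurable).1 hind]
    simp only [hμi]
  have hpair : ∀ i j : Fin n, i ≠ j → P {ω | X i ω = X j ω} = (μ.prod μ) {q | q.1 = q.2} := by
    intro i j hij
    have h1 := (indepFun_iff_map_prod_eq_prod_map_map (hX i).aemeasurable
      (hX j).aemeasurable).1 (hind.indepFun hij)
    rw [hμi, hμi] at h1
    rw [← h1, Measure.map_apply ((hX i).prodMk (hX j))
      (measurableSet_eq_fun measurable_fst measurable_snd)]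
    rfl
  -- Continuity of the distance at t = 0 says that two sample points almost surely differ; the law
  -- of a pair is the same for all i ≠ j, so the sample is almost surely injective.
  have hdiag : (μ.prod μ) {q | q.1 = q.2} = 0 := by
    rw [← hpair ⟨0, by omega⟩ ⟨1, by omega⟩ (by simp)]
    have := hcont 0
    simpa [sub_eq_zero] using this
  have hinj : ∀ᵐ x ∂(Measure.pi fun _ : Fin n => μ), Function.Injective x := by
    have h1 : ∀ i j : Fin n, ∀ᵐ x ∂(Measure.pi fun _ : Fin n => μ), x i = x j → i = j := by
      intro i j
      by_cases hij : i = j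
      · exact ae_of_all _ fun x _ => hij
      · rw [← hJ, ae_map_iff hJm.aemeasurable]
        · have h2 : ∀ᵐ ω ∂P, X i ω ≠ X j ω := by
            rw [ae_iff]
            simpa using (hpair i j hij).trans hdiag
          filter_upwards [h2] with ω hω h
          exact absurd h hω
        · simp only [hij, imp_false]
          exact (measurableSet_eq_fun (measurable_pi_apply i) (measurable_pi_apply j)).compl
    filter_upwards [ae_all_iff.2 fun i => ae_all_iff.2 (h1 i)] with x hx i j h
    exact hx i j h
  have hpm : ∀ ℓ, Measurable fun x => |f ℓ x| ^ p := fun ℓ => (hfm ℓ).abs.pow_const p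
  have hint' : ∀ ℓ, Integrable (fun x => |f ℓ x| ^ p) (Measure.pi fun _ : Fin n => μ) := by
    intro ℓ
    rw [← hJ, integrable_map_measure (hpm ℓ).aestronglyMeasurable hJm.aemeasurable]
    exact hint ℓ
  have hγ' : ∀ ℓ, ∫ x, |f ℓ x| ^ p ∂(Measure.pi fun _ : Fin n => μ) ≤ γ := by
    intro ℓ
    rw [← hJ, integral_map hJm.aemeasurable (hpm ℓ).aestronglyMeasurable, hγ]
    -- The supremum is over a finite index set, hence bounded above and not a default value.
    exact le_ciSup (f := fun ℓ => ∫ ω, |f ℓ (fun i => X i ω)| ^ p ∂P)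
      (Set.finite_range _).bddAbove ℓ
  have hγ0 : 0 ≤ γ :=
    (integral_nonneg fun x => by positivity).trans (hγ' ⟨0, by omega⟩)
  have hsm := measurable_localSum hfm
  have hdist : distToNormal P W = distToNormal (Measure.pi fun _ : Fin n => μ) (localSum f) := by
    rw [hW, ← hJ]
    exact distToNormal_comp hJm hsm
  have hvar : σ = √(Var[localSum f; Measure.pi fun _ : Fin n => μ]) := by
    rw [hσ, ← hJ, variance_map hsm.aemeasurable hJm.aemeasurable, hW]
    rfl
  rw [hdist]
  exact distToNormal_localSum_le (by omega) hd hk hr hfm hf hinj hp hint' hγ0 hγ' hσ0 hvar
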